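/- Let $d$ be a positive integer. For positive integers $n_1,\dots,n_d$ let $\mathcal G=\mathbb F_2^{n_1}\otimes\dots\otimes\mathbb F_2^{n_d}$, and let $B\subset\mathcal G$ be the set of rank-1 tensors $u_1\otimes\dots\otimes u_d$ with all $u_i\neq 0$. For non-empty $I\subset[d]$ write $\mathbb F_2^I=\bigotimes_{i\in I}\mathbb F_2^{n_i}$, and identify $\mathcal G$ with $\mathbb F_2^{I}\otimes\mathbb F_2^{I^c}$, where $I^c=[d]\setminus I$. Definitions. For subsets $S,X\subset\mathcal G$ and a real number $t$, the set $X$ is $(S,t)$-closed if $|\{(a,b)\in X\times S: a+b\in X\}|\geq t|X||S|$. A non-empty set $\mathcal A\subset\mathcal G$ is $\eta$-closed if $\mathbb P[a+u_1\otimes\dots\otimes u_d\in\mathcal A]\geq\eta$ when $a\in\mathcal A$ and $u_i\in\mathbb F_2^{n_i}\setminus\{0\}$ are chosen independently and uniformly at random. A set $\mathcal C\subset\mathcal G$ is $k$-simple if it is a translate of $\bigcap_{\emptyset\neq I\subset[d]}(H_I\otimes\mathbb F_2^{I^c})$ for some subspaces $H_I\subset\mathbb F_2^I$ of codimension at most $k$.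 For $f,g:\mathcal G\to\mathbb R$ put $f*g(x)=\mathbb E_{y+z=x}f(y)g(z)$, and let $\mu_B$ take the value $|\mathcal G|/|B|$ on $B$ and $0$ elsewhere. Hypothesis. Suppose that for every $\eta,\epsilon>0$ there exist $c>0$, $\delta>0$ and a positive integer $l$ (depending only on $d,\eta,\epsilon$) such that for all positive integers $n_1,\dots,n_d$ and every non-empty $(B,\eta)$-closed set $A\subset\mathcal G$ there are a subset $B'\subset B$ and a non-empty subset $C\subset\mathcal G$ with the following properties: (1) $|B'|\geq\delta|B|$; (2) $C$ is $(B',1-\epsilon)$-closed; (3) $C\subset\{x\in\mathcal G: 1_A*\mu_B*\dots*\mu_B(x)\geq c\}$, where the number of factors $\mu_B$ is $l$. Conclusion. Then for every $\eta>0$ there exist $k=k(d,\eta)\in\mathbb N$ and $\rho=\rho(d,\eta)>0$ such that for all positive integers $n_1,\dots,n_d$ and every non-empty $\eta$-closed set $\mathcal A\subset\mathcal G$ there is a $k$-simple set $\mathcal C\subset\mathcal G$ with $|\mathcal A\cap\mathcal C|\geq\rho|\mathcal C|$. -/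

import Mathlib

open scoped TensorProduct

noncomputable section

namespace ClosedTensor

/-! ### Closed sets in Cayley graphs of finite Abelian groups -/

section Group

variable {G : Type*} [AddCommGroup G]

/-- `A` is `(B, η)`-closed: the number of pairs `(a, b) ∈ A × B` with `a + b ∈ A` is at least
`η |A| |B|`. -/
def IsClosedFor (B : Set G) (η : ℝ) (A : Set G) : Prop :=
  η * A.ncard * B.ncard ≤ ({p : G × G | p.1 ∈ A ∧ p.2 ∈ B ∧ p.1 + p.2 ∈ A}.ncard : ℝ)

/-- Normalised convolution `f * g (x) = 𝔼_{y + z = x} f(y) g(z)` on a finite Abelian group. -/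
def conv (f g : G → ℝ) (x : G) : ℝ :=
  (∑ᶠ y : G, f y * g (x - y)) / Nat.card G

/-- The characteristic measure of `B`: it is `|G| / |B|` on `B` and `0` elsewhere. -/
def charMeasure (B : Set G) : G → ℝ :=
  B.indicator fun _ => (Nat.card G : ℝ) / B.ncard

/-- The function `1_A * μ_B * ⋯ * μ_B`, with `l` factors `μ_B`. -/
def smoothed (A B : Set G) (l : ℕ) : G → ℝ :=
  (fun f => conv f (charMeasure B))^[l] (A.indicator fun _ => 1)

end Group

/-! ### Tensor products of the spaces `𝔽₂^{n_i}` -/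

section Tensors

variable {d : ℕ} (n : Fin d → ℕ)

/-- The group `𝔽₂^{n_1} ⊗ ⋯ ⊗ 𝔽₂^{n_d}`. -/
abbrev TensorSpace : Type :=
  ⨂[ZMod 2] i : Fin d, (Fin (n i) → ZMod 2)

/-- The tensor product of the `𝔽₂^{n_i}` over those `i` that satisfy `p`. -/
abbrev PartialTensorSpace (p : Fin d → Prop) : Type :=
  ⨂[ZMod 2] i : {i : Fin d // p i}, (Fin (n i) → ZMod 2)

/-- The natural identification `𝔽₂^I ⊗ 𝔽₂^{I^c} = 𝔽₂^{n_1} ⊗ ⋯ ⊗ 𝔽₂^{n_d}`. -/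
def mergeEquiv (I : Finset (Fin d)) :
    (PartialTensorSpace n (fun i => i ∈ I)) ⊗[ZMod 2] (PartialTensorSpace n (fun i => i ∉ I))
      ≃ₗ[ZMod 2] TensorSpace n :=
  (PiTensorProduct.tmulEquivDep (ZMod 2)
      (fun j => Fin (n (Equiv.sumCompl (fun i => i ∈ I) j)) → ZMod 2)).trans
    (PiTensorProduct.reindex (ZMod 2) (fun i : Fin d => Fin (n i) → ZMod 2)
      (Equiv.sumCompl (fun i => i ∈ I)).symm).symm

/-- The identification does what it should on pure tensors. -/
theorem mergeEquiv_tprod (I : Finset (Fin d)) (u : ∀ i : Fin d, Fin (n i) → ZMod 2) :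
    mergeEquiv n I
        ((PiTensorProduct.tprod (ZMod 2) fun i : {i : Fin d // i ∈ I} => u i) ⊗ₜ[ZMod 2]
          (PiTensorProduct.tprod (ZMod 2) fun i : {i : Fin d // i ∉ I} => u i)) =
      PiTensorProduct.tprod (ZMod 2) u := by
  refine (LinearEquiv.symm_apply_eq _).2 ((PiTensorProduct.tmulEquivDep_apply (ZMod 2)
    (fun j => Fin (n (Equiv.sumCompl (fun i => i ∈ I) j)) → ZMod 2) _ _).trans ?_)
  refine Eq.trans ?_ (PiTensorProduct.reindex_tprod (R := ZMod 2)
    (s := fun i : Fin d => Fin (n i) → ZMod 2) (Equiv.sumCompl (fun i => i ∈ I)).symm u).symm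
  refine congrArg (PiTensorProduct.tprod (ZMod 2)) ?_
  funext j
  rcases j with j | j <;> rfl

/-- The subspace `H ⊗ 𝔽₂^{I^c}` of `𝔽₂^{n_1} ⊗ ⋯ ⊗ 𝔽₂^{n_d}`, for a subspace `H` of `𝔽₂^I`. -/
def cylinder (I : Finset (Fin d))
    (H : Submodule (ZMod 2) (PartialTensorSpace n (fun i => i ∈ I))) :
    Submodule (ZMod 2) (TensorSpace n) :=
  (LinearMap.range
    (H.subtype.rTensor (PartialTensorSpace n (fun i => i ∉ I)))).map
      (mergeEquiv n I).toLinearMap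

/-- The set of rank-1 tensors `u_1 ⊗ ⋯ ⊗ u_d`, all `u_i` non-zero. -/
def rankOne : Set (TensorSpace n) :=
  {t | ∃ u : ∀ i : Fin d, Fin (n i) → ZMod 2,
    (∀ i, u i ≠ 0) ∧ t = PiTensorProduct.tprod (ZMod 2) u}

variable {n}

/-- `A` is `η`-closed: with probability at least `η` we have `a + u_1 ⊗ ⋯ ⊗ u_d ∈ A` when
`a ∈ A` and the non-zero vectors `u_i ∈ 𝔽₂^{n_i}` are chosen independently and uniformly.
(The probability makes sense when `A` is non-empty and every `n_i` is positive.) -/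
def IsEtaClosed (η : ℝ) (A : Set (TensorSpace n)) : Prop :=
  η ≤ ({p : TensorSpace n × (∀ i : Fin d, Fin (n i) → ZMod 2) |
        p.1 ∈ A ∧ (∀ i, p.2 i ≠ 0) ∧ p.1 + PiTensorProduct.tprod (ZMod 2) p.2 ∈ A}.ncard : ℝ) /
      (A.ncard * {u : ∀ i : Fin d, Fin (n i) → ZMod 2 | ∀ i, u i ≠ 0}.ncard : ℝ)

/-- `C` is `k`-simple: it is a translate of the intersection, over all non-empty `I ⊆ [d]`, of
`H_I ⊗ 𝔽₂^{I^c}`, for some subspaces `H_I` of `𝔽₂^I` of codimension at most `k`. -/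
def IsSimple (k : ℕ) (C : Set (TensorSpace n)) : Prop :=
  ∃ (H : ∀ I : Finset (Fin d),
      Submodule (ZMod 2) (PartialTensorSpace n (fun i => i ∈ I))) (x : TensorSpace n),
    (∀ I : Finset (Fin d), I.Nonempty →
      Module.finrank (ZMod 2) (PartialTensorSpace n (fun i => i ∈ I) ⧸ H I) ≤ k) ∧
    C = (fun y => x + y) ''
      ((⨅ (I : Finset (Fin d)) (_ : I.Nonempty), cylinder n I (H I) :
        Submodule (ZMod 2) (TensorSpace n)) : Set (TensorSpace n))

variable (n) in
/-- The group is finite, so cardinalities and finite sums over it carry their usual meaning. -/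
theorem finite_tensorSpace : Finite (TensorSpace n) :=
  Module.finite_of_finite (ZMod 2)

end Tensors

/-- The question about almost closed sets has a positive answer for the groups
`G = 𝔽₂^{n_1} ⊗ ⋯ ⊗ 𝔽₂^{n_d}` and the generating sets `B` of rank-1 tensors: for all
`η, ε > 0` there are `c, δ > 0` and a positive integer `l`, not depending on the `n_i`, such
that for every non-empty `(B, η)`-closed `A` there are `B' ⊆ B` and a non-empty `C` with
`|B'| ≥ δ |B|`, `C` being `(B', 1 - ε)`-closed, and `1_A * μ_B * ⋯ * μ_B ≥ c` on `C`, where the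
number of factors `μ_B` is `l`. -/
def PositiveAnswer (d : ℕ) : Prop :=
  ∀ η ε : ℝ, 0 < η → 0 < ε → ∃ (c δ : ℝ) (l : ℕ), 0 < c ∧ 0 < δ ∧ 0 < l ∧
    ∀ n : Fin d → ℕ, (∀ i, 0 < n i) →
      ∀ A : Set (TensorSpace n), A.Nonempty → IsClosedFor (rankOne n) η A →
        ∃ B' C : Set (TensorSpace n), B' ⊆ rankOne n ∧ C.Nonempty ∧
          δ * (rankOne n).ncard ≤ (B'.ncard : ℝ) ∧
          IsClosedFor B' (1 - ε) C ∧
          C ⊆ {x | c ≤ smoothed A (rankOne n) l x}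

end ClosedTensor

end

/-!
Multilinear forms on `∏ i, E i`, where `E i = 𝔽₂^{n_i}`, and on subproducts are treated as
functions on the whole product (`IsForm`), so that tensor products of forms are pointwise
products. For a finite set `G` of forms on non-empty sets of coordinates, `formSpan univ G` is the
space of the sums `∑ φ ψ` with `φ ∈ G` and `ψ` a form on the complementary coordinates. If `H_I`
is the common kernel of the functionals on `𝔽₂^I` that belong to `G`, then a character of
`𝒢 = 𝔽₂^{n_1} ⊗ ⋯ ⊗ 𝔽₂^{n_d}` that is, as a form, in `formSpan univ G` vanishes on
`K = ⋂ H_I ⊗ 𝔽₂^{I^c}` (`exists_cylinders`), and the codimensions of the `H_I` are at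
most `|G|`. So `k`-simple sets are produced by sets `G` of bounded size.

The hypothesis provides a non-empty set `C` that is almost invariant under each element of a dense
set `B₁` of rank-1 tensors. Suppose that `b` is a random element of `B₁`, not necessarily uniform,
such that every character that is trivial at `b` with probability at least `1 - α` lies in
`formSpan univ G`. Almost all the Fourier mass of `1_C` is on characters of this kind, because `C`
is almost invariant under all values of `b`. As these characters are trivial on `K`, the set `C`
has density at least `1/2` on some coset of `K` (`exists_dense_coset`). A smoothed version of
`1_A` is at least `c` on `C`, and smoothing is an average over translates, so `A` has density at
least `c/2` on some coset of `K` (`exists_le_prob_of_smoothed`).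

Hence the theorem comes down to the construction of `b` with a `G` of bounded size
(`exists_random_point`). This goes by induction on the number of coordinates. The slices of a
dense set at the points `v` of a dense set `D ⊆ E e` are dense, so each of them carries a random
point and a bounded set of forms `𝒢₀ v`. The coordinate `e` of the new random point is uniform on
a suitable `D' ⊆ D`. If a form `r` mostly vanishes at the random point, then its slice at `v` lies
in `formSpan (𝒢₀ v)` for most `v ∈ D'`. All `t` in a subspace of bounded codimension are sums of
four elements of `D'` in many ways, robustly under the removal of a small part of `D'`
(`exists_robust_four_sums`), so the slice of `r` at `t` lies in a bounded `formSpan` for at least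
half of the quadruples with sum `t`. It remains to collect spaces of forms: a form that lies in a
positive proportion of given bounded spaces lies in one bounded space
(`exists_formSpan_of_popular`), and so does a form all of whose slices at the points of a subspace
of bounded codimension lie in given bounded spaces (`exists_formSpan_of_slices`).

Both of these rest on the fact that a linear space of forms with many common zeros is contained in
a bounded `formSpan` (`exists_formSpan_of_common_zeros`). This is the theorem that forms of large
bias have bounded partition rank (`exists_biasRank`), applied to the evaluation form
`(r, u) ↦ r u`. Its proof follows the argument of Green and Tao for polynomials. A biased form is
close to a function of boundedly many forms with fewer variables (`IsForm.exists_approx`); by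
induction these may be replaced by a family that is regular, in the sense that no sum of its forms
on the same coordinates is biased (`exists_rank_of_approx`). The values of a regular family are
equidistributed, by the Gowers–Cauchy–Schwarz inequality `IsForm.expect_pow_le_bias`. So the
function of these values inherits the multilinearity of the form approximately, it is close to an
exactly multilinear one by linearity testing (`exists_isBlockForm`), and two forms that agree at
most points are equal (`exists_accuracy`).
-/

namespace ClosedTensor

open Finset Function
open scoped BigOperators

/-! ### Averages, probabilities and signs -/

section Averages

variable {α β : Type*} [Fintype α] [Fintype β]

open Classical in
/-- The proportion of the elements of a finite type that satisfy `p`. -/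
noncomputable def prob (p : α → Prop) : ℝ := 𝔼 a, if p a then (1 : ℝ) else 0

theorem prob_eq (p : α → Prop) [DecidablePred p] : prob p = 𝔼 a, if p a then (1 : ℝ) else 0 :=
  expect_congr rfl fun a _ => by congr

theorem prob_nonneg (p : α → Prop) : 0 ≤ prob p := by
  classical
  exact expect_nonneg fun a _ => by split_ifs <;> norm_num

theorem prob_le_one [Nonempty α] (p : α → Prop) : prob p ≤ 1 := by
  classical
  exact expect_le univ_nonempty fun a _ => by split_ifs <;> norm_num

theorem prob_mono {p q : α → Prop} (h : ∀ a, p a → q a) : prob p ≤ prob q := by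
  classical
  refine expect_le_expect fun a _ => ?_
  by_cases hp : p a
  · simp [hp, h a hp]
  · simp only [hp, if_false]; split_ifs <;> norm_num

theorem prob_congr {p q : α → Prop} (h : ∀ a, p a ↔ q a) : prob p = prob q :=
  le_antisymm (prob_mono fun a => (h a).1) (prob_mono fun a => (h a).2)

theorem prob_or_le (p q : α → Prop) : prob (fun a => p a ∨ q a) ≤ prob p + prob q := by
  classical
  unfold prob
  rw [← expect_add_distrib]
  refine expect_le_expect fun a _ => ?_
  by_cases hp : p a <;> by_cases hq : q a <;> simp [hp, hq]

theorem prob_true [Nonempty α] : prob (fun _ : α => True) = 1 := by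
  simp [prob]

theorem prob_false : prob (fun _ : α => False) = 0 := by
  simp [prob]

theorem prob_add_prob_not [Nonempty α] (p : α → Prop) :
    prob p + prob (fun a => ¬ p a) = 1 := by
  classical
  unfold prob
  rw [← expect_add_distrib, ← Fintype.expect_one (M := ℝ) (ι := α)]
  refine expect_congr rfl fun a _ => ?_
  by_cases hp : p a <;> simp [hp]

theorem prob_exists_le {κ : Type*} (s : Finset κ) (p : κ → α → Prop) :
    prob (fun a => ∃ k ∈ s, p k a) ≤ ∑ k ∈ s, prob (p k) := by
  classical
  induction s using Finset.induction_on with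
  | empty => simp [prob]
  | insert k s hk ih =>
    rw [sum_insert hk]
    refine le_trans (prob_mono (q := fun a => p k a ∨ ∃ k ∈ s, p k a) ?_)
      ((prob_or_le _ _).trans (by gcongr))
    intro a ⟨k', hk', h⟩
    rcases Finset.mem_insert.1 hk' with rfl | hk'
    · exact Or.inl h
    · exact Or.inr ⟨k', hk', h⟩

theorem exists_of_prob_pos {p : α → Prop} (h : 0 < prob p) : ∃ a, p a := by
  by_contra! h'
  have : prob p = 0 := by
    rw [← prob_false (α := α)]
    exact prob_congr fun a => by simp [h' a]
  linarith

theorem exists_not_of_prob_lt_one [Nonempty α] {p : α → Prop} (h : prob p < 1) : ∃ a, ¬ p a :=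
  exists_of_prob_pos (p := fun a => ¬ p a) (by have := prob_add_prob_not p; linarith)

theorem expect_prod_type (f : α × β → ℝ) : 𝔼 x, f x = 𝔼 a, 𝔼 b, f (a, b) := by
  rw [← univ_product_univ, expect_product]

theorem prob_prod (p : α × β → Prop) : prob p = 𝔼 a, prob fun b => p (a, b) := by
  classical
  unfold prob
  rw [expect_prod_type]

theorem prob_fst [Nonempty β] (p : α → Prop) : (prob fun z : α × β => p z.1) = prob p := by
  classical
  rw [prob_eq, prob_eq, expect_prod_type]
  exact expect_congr rfl fun y _ => Fintype.expect_const (ι := β) (if p y then (1 : ℝ) else 0)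

theorem prob_equiv (e : α ≃ β) (p : α → Prop) (q : β → Prop) (h : ∀ a, p a ↔ q (e a)) :
    prob p = prob q := by
  classical
  exact Fintype.expect_equiv e _ _ fun a => by simp [h a]

/-- Markov's inequality. -/
theorem mul_prob_le_expect (f : α → ℝ) (hf : ∀ a, 0 ≤ f a) (t : ℝ) :
    t * prob (fun a => t ≤ f a) ≤ 𝔼 a, f a := by
  classical
  unfold prob
  rw [mul_expect]
  refine expect_le_expect fun a _ => ?_
  split_ifs with h
  · simpa using h
  · simpa using hf a

theorem card_eq_prob_mul (p : α → Prop) [DecidablePred p] [Nonempty α] :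
    ((univ.filter p).card : ℝ) = prob p * Fintype.card α := by
  rw [prob_eq, Fintype.expect_eq_sum_div_card, div_mul_cancel₀ _ (by positivity), card_filter]
  push_cast
  rfl

/-- Jensen’s inequality for the convex function `x ↦ x ^ 2 ^ n`. -/
theorem expect_pow_two_pow_le [Nonempty α] (f : α → ℝ) (n : ℕ) :
    (𝔼 a, f a) ^ 2 ^ n ≤ 𝔼 a, f a ^ 2 ^ n := by
  induction n generalizing f with
  | zero => simp
  | succ n ih =>
    have h2 : (𝔼 a, f a) ^ 2 ≤ 𝔼 a, f a ^ 2 := by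
      have hc : (0 : ℝ) < Fintype.card α := by positivity
      rw [Fintype.expect_eq_sum_div_card, Fintype.expect_eq_sum_div_card, div_pow, sq (_ : ℝ),
        sq (Fintype.card α : ℝ), div_le_div_iff₀ (by positivity) hc]
      have := sq_sum_le_card_mul_sum_sq (s := (univ : Finset α)) (f := f)
      rw [card_univ] at this
      nlinarith
    rw [pow_succ' 2 n, pow_mul]
    refine (pow_le_pow_left₀ (sq_nonneg _) h2 _).trans ((ih _).trans_eq ?_)
    simp only [← pow_mul]

theorem exists_of_expect_le [Nonempty α] {f : α → ℝ} {c : ℝ} (h : 𝔼 a, f a ≤ c) :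
    ∃ a, f a ≤ c := by
  obtain ⟨a, -, ha⟩ := exists_le_of_expect_le univ_nonempty h
  exact ⟨a, ha⟩

theorem expect_translate {V : Type*} [AddGroup V] [Fintype V] (f : V → ℝ) (a : V) :
    𝔼 v, f (v + a) = 𝔼 v, f v :=
  Fintype.expect_equiv (Equiv.addRight a) _ _ fun _ => rfl

theorem prob_translate {V : Type*} [AddGroup V] [Fintype V] (p : V → Prop) (a : V) :
    prob (fun v => p (v + a)) = prob p := by
  classical
  exact expect_translate (fun v => if p v then (1 : ℝ) else 0) a

theorem prob_translate_left {V : Type*} [AddGroup V] [Fintype V] (p : V → Prop) (a : V) :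
    prob (fun v => p (a + v)) = prob p :=
  prob_equiv (Equiv.addLeft a) _ _ fun _ => Iff.rfl

end Averages

/-- The non-trivial additive character of `𝔽₂`, with values `1` and `-1`. -/
def sgn (a : ZMod 2) : ℝ := if a = 0 then 1 else -1

theorem zmod_two_cases (a : ZMod 2) : a = 0 ∨ a = 1 := by
  revert a; decide

@[simp] theorem sgn_zero : sgn 0 = 1 := by simp [sgn]

@[simp] theorem sgn_one : sgn 1 = -1 := by simp [sgn]

theorem sgn_add (a b : ZMod 2) : sgn (a + b) = sgn a * sgn b := by
  have h : (1 : ZMod 2) + 1 = 0 := by decide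
  rcases zmod_two_cases a with rfl | rfl <;> rcases zmod_two_cases b with rfl | rfl <;> simp [h]

@[simp] theorem sgn_mul_self (a : ZMod 2) : sgn a * sgn a = 1 := by
  rcases zmod_two_cases a with rfl | rfl <;> simp

@[simp] theorem abs_sgn (a : ZMod 2) : |sgn a| = 1 := by
  rcases zmod_two_cases a with rfl | rfl <;> simp

theorem sgn_sum {κ : Type*} (s : Finset κ) (f : κ → ZMod 2) :
    sgn (∑ k ∈ s, f k) = ∏ k ∈ s, sgn (f k) := by
  classical
  induction s using Finset.induction_on with
  | empty => simp
  | insert k s hk ih => rw [sum_insert hk, prod_insert hk, sgn_add, ih]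

theorem sgn_eq (a : ZMod 2) : sgn a = 1 - 2 * (if a ≠ 0 then (1 : ℝ) else 0) := by
  rcases zmod_two_cases a with rfl | rfl <;> norm_num [sgn]

/-- Every element of an `𝔽₂`-vector space is its own negative. -/
theorem add_self_two {V : Type*} [AddCommGroup V] [Module (ZMod 2) V] (v : V) : v + v = 0 := by
  have h : (1 : ZMod 2) + 1 = 0 := by decide
  calc v + v = (1 : ZMod 2) • v + (1 : ZMod 2) • v := by simp
    _ = 0 := by rw [← add_smul, h, zero_smul]

theorem neg_eq_self_two {V : Type*} [AddCommGroup V] [Module (ZMod 2) V] (v : V) : -v = v :=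
  neg_eq_of_add_eq_zero_left (add_self_two v)

theorem add_eq_zero_two {V : Type*} [AddCommGroup V] [Module (ZMod 2) V] {v w : V} :
    v + w = 0 ↔ v = w := by
  rw [add_eq_zero_iff_eq_neg, neg_eq_self_two]

/-- A non-trivial character has mean zero. -/
theorem expect_sgn_addHom {V : Type*} [AddCommGroup V] [Fintype V] (χ : V → ZMod 2)
    (h : ∀ v w, χ (v + w) = χ v + χ w) (h0 : ∃ v, χ v ≠ 0) : 𝔼 v, sgn (χ v) = 0 := by
  obtain ⟨v, hv⟩ := h0
  have h1 := expect_translate (fun w => sgn (χ w)) v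
  have h2 : ∀ w, sgn (χ (w + v)) = -sgn (χ w) := fun w => by
    rw [h, (zmod_two_cases (χ v)).resolve_left hv, sgn_add]
    simp
  simp only [h2] at h1
  rw [expect_neg_distrib] at h1
  linarith

theorem expect_sgn_addHom_nonneg {V : Type*} [AddCommGroup V] [Fintype V] (χ : V → ZMod 2)
    (h : ∀ v w, χ (v + w) = χ v + χ w) : 0 ≤ 𝔼 v, sgn (χ v) := by
  by_cases h0 : ∃ v, χ v ≠ 0
  · exact (expect_sgn_addHom χ h h0).ge
  · push Not at h0
    exact expect_nonneg fun v _ => by simp [h0 v]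

/-! ### Forms on a product of vector spaces -/

section Forms

variable {ι : Type} [DecidableEq ι] {E : ι → Type} [∀ i, AddCommGroup (E i)]

/-- `φ` is a form on the coordinates in `I`: it depends only on these coordinates and is additive
in each of them. Over `𝔽₂` this says that `φ` comes from a multilinear map on `∏_{i ∈ I} E i`.
Forms on all subsets `I` are thus functions on the same space `∏ i, E i`, which makes products
of forms pointwise products. -/
structure IsForm {W : Type*} [AddCommGroup W] (I : Finset ι) (φ : (∀ i, E i) → W) : Prop where
  dep : ∀ u v : ∀ i, E i, (∀ i ∈ I, u i = v i) → φ u = φ v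
  add : ∀ i ∈ I, ∀ (u : ∀ i, E i) (x y : E i),
    φ (update u i (x + y)) = φ (update u i x) + φ (update u i y)

namespace IsForm

variable {W : Type*} [AddCommGroup W] {I J : Finset ι} {φ ψ : (∀ i, E i) → W}

theorem update_of_notMem (h : IsForm I φ) {i : ι} (hi : i ∉ I) (u : ∀ i, E i) (x : E i) :
    φ (update u i x) = φ u :=
  h.dep _ _ fun j hj => update_of_ne (by rintro rfl; exact hi hj) _ _

theorem zero : IsForm I (0 : (∀ i, E i) → W) := ⟨fun _ _ _ => rfl, by simp⟩

theorem add' (hφ : IsForm I φ) (hψ : IsForm I ψ) : IsForm I (φ + ψ) :=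
  ⟨fun u v h => by simp [hφ.dep u v h, hψ.dep u v h], fun i hi u x y => by
    simp only [Pi.add_apply, hφ.add i hi, hψ.add i hi]; abel⟩

theorem const (c : W) : IsForm (∅ : Finset ι) (fun _ : ∀ i, E i => c) :=
  ⟨fun _ _ _ => rfl, by simp⟩

theorem sum {κ : Type*} (s : Finset κ) {f : κ → (∀ i, E i) → W} (h : ∀ k ∈ s, IsForm I (f k)) :
    IsForm I (fun u => ∑ k ∈ s, f k u) := by
  refine ⟨fun u v huv => sum_congr rfl fun k hk => (h k hk).dep u v huv, fun i hi u x y => ?_⟩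
  rw [← sum_add_distrib]
  exact sum_congr rfl fun k hk => (h k hk).add i hi u x y

theorem update_zero (h : IsForm I φ) {i : ι} (hi : i ∈ I) (u : ∀ i, E i) :
    φ (update u i 0) = 0 := by
  have := h.add i hi u 0 0
  simpa using this

/-- Fixing one coordinate of a form gives a form on the remaining ones. -/
theorem slice (h : IsForm I φ) (e : ι) (v : E e) :
    IsForm (I.erase e) (fun u => φ (update u e v)) := by
  refine ⟨fun u w huw => h.dep _ _ fun i hi => ?_, fun i hi u x y => ?_⟩
  · by_cases hie : i = e
    · subst hie; simp
    · rw [update_of_ne hie, update_of_ne hie]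
      exact huw i (mem_erase.2 ⟨hie, hi⟩)
  · obtain ⟨hie, hi⟩ := mem_erase.1 hi
    simp only [update_comm hie]
    exact h.add i hi _ x y

theorem of_eq (h : IsForm I φ) (hIJ : I = J) : IsForm J φ := hIJ ▸ h

/-- The product of forms on disjoint sets of coordinates is a form. -/
theorem smul [Module (ZMod 2) W] {f : (∀ i, E i) → ZMod 2} (hf : IsForm I f) (hφ : IsForm J φ)
    (hIJ : Disjoint I J) : IsForm (I ∪ J) (fun u => f u • φ u) := by
  refine ⟨fun u v h => ?_, fun i hi u x y => ?_⟩
  · rw [hf.dep u v fun i hi => h i (mem_union_left _ hi),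
      hφ.dep u v fun i hi => h i (mem_union_right _ hi)]
  · rcases mem_union.1 hi with hi | hi
    · have hj := disjoint_left.1 hIJ hi
      simp only [hφ.update_of_notMem hj, hf.add i hi, add_smul]
    · have hj := disjoint_right.1 hIJ hi
      simp only [hf.update_of_notMem hj, hφ.add i hi, smul_add]

theorem comp_addHom {W' : Type*} [AddCommGroup W'] (h : IsForm I φ) (g : W →+ W') :
    IsForm I (fun u => g (φ u)) :=
  ⟨fun u v huv => by rw [h.dep u v huv], fun i hi u x y => by rw [h.add i hi, map_add]⟩

end IsForm

section Averaging

variable [Fintype ι] [∀ i, Fintype (E i)]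

/-- Resampling one coordinate does not change the uniform distribution. -/
theorem expect_update (e : ι) (F : (∀ i, E i) → ℝ) :
    𝔼 u, F u = 𝔼 u, 𝔼 v : E e, F (update u e v) := by
  have key : ∀ G : (∀ i, E i) → ℝ,
      𝔼 u, G u = 𝔼 x : E e, 𝔼 y : ∀ j : {j // j ≠ e}, E j,
        G ((Equiv.piSplitAt e E).symm (x, y)) := fun G => by
    rw [← expect_prod_type fun p => G ((Equiv.piSplitAt e E).symm p)]
    exact Fintype.expect_equiv (Equiv.piSplitAt e E) _ _ fun u =>
      congrArg G ((Equiv.piSplitAt e E).symm_apply_apply u).symm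
  have hup : ∀ (x v : E e) (y : ∀ j : {j // j ≠ e}, E j),
      update ((Equiv.piSplitAt e E).symm (x, y)) e v = (Equiv.piSplitAt e E).symm (v, y) := by
    intro x v y
    funext i
    by_cases h : i = e
    · subst h; simp [Equiv.piSplitAt]
    · simp [Equiv.piSplitAt, h]
  rw [key F, key fun u => 𝔼 v : E e, F (update u e v)]
  simp only [hup]
  rw [Fintype.expect_const]
  exact expect_comm _ _ _

theorem prob_update (e : ι) (p : (∀ i, E i) → Prop) :
    prob p = 𝔼 u, prob fun v : E e => p (update u e v) := by
  classical
  exact expect_update e _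

/-- A form that is not identically zero is non-zero at a proportion of at least `2^{-|I|}` of the
points. -/
theorem IsForm.prob_ne_zero {W : Type*} [AddCommGroup W] {I : Finset ι}
    {φ : (∀ i, E i) → W} (hφ : IsForm I φ) (h0 : φ ≠ 0) :
    (2⁻¹ : ℝ) ^ I.card ≤ prob fun u => φ u ≠ 0 := by
  classical
  induction I using Finset.induction_on generalizing φ with
  | empty =>
    have : ∀ u, φ u ≠ 0 := by
      intro u hu
      exact h0 (funext fun v => by rw [hφ.dep v u (by simp), hu]; rfl)
    rw [prob_congr (q := fun _ => True) (by simpa using this), prob_true]; simp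
  | insert e I he ih =>
    obtain ⟨u₀, hu₀⟩ : ∃ u, φ u ≠ 0 := by
      by_contra! h; exact h0 (funext h)
    have hs : IsForm I fun u => φ (update u e (u₀ e)) :=
      (hφ.slice e (u₀ e)).of_eq (erase_insert he)
    have h1 := ih hs (fun h => hu₀ (by simpa using congrFun h u₀))
    rw [card_insert_of_notMem he, pow_succ, prob_update e]
    calc (2⁻¹ : ℝ) ^ I.card * 2⁻¹
        ≤ (prob fun u => φ (update u e (u₀ e)) ≠ 0) * 2⁻¹ := by gcongr
      _ = 𝔼 u, (if φ (update u e (u₀ e)) ≠ 0 then (1 : ℝ) else 0) * 2⁻¹ := by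
          rw [← expect_mul, prob_eq]
      _ ≤ _ := expect_le_expect fun u _ => ?_
    split_ifs with h
    · -- of `v` and `v + u₀ e`, at least one gives a non-zero value
      have h2 : (1 : ℝ) ≤ (prob fun v : E e => φ (update u e v) ≠ 0) +
          prob fun v : E e => φ (update u e (v + u₀ e)) ≠ 0 := by
        rw [← prob_true (α := E e)]
        refine (prob_mono fun v _ => ?_).trans (prob_or_le _ _)
        by_contra! hc
        rw [hφ.add e (mem_insert_self _ _), hc.1, zero_add] at hc
        exact h hc.2
      rw [prob_translate (fun v : E e => φ (update u e v) ≠ 0)] at h2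
      linarith
    · simpa using prob_nonneg _

end Averaging

end Forms

/-! ### Bias and the Gowers–Cauchy–Schwarz inequality -/

section Bias

variable {ι : Type} [DecidableEq ι] [Fintype ι] {E : ι → Type} [∀ i, AddCommGroup (E i)]
  [∀ i, Fintype (E i)]

/-- The bias of a function with values in `𝔽₂`: the average of `(-1)^{φ(u)}`. -/
noncomputable def bias (φ : (∀ i, E i) → ZMod 2) : ℝ := 𝔼 u, sgn (φ u)

/-- The Gowers–Cauchy–Schwarz inequality: a form that correlates with a product of functions, each
of which ignores one of its coordinates, has large bias. One application of the Cauchy–Schwarz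
inequality to the coordinate `e` removes the factor `h e`, and leaves slices of the form because of
additivity. -/
theorem IsForm.expect_pow_le_bias {I : Finset ι} {g : (∀ i, E i) → ZMod 2} (hg : IsForm I g)
    (h : ι → (∀ i, E i) → ℝ) (h1 : ∀ i u, |h i u| ≤ 1)
    (hind : ∀ i ∈ I, ∀ u x, h i (update u i x) = h i u) :
    (𝔼 u, sgn (g u) * ∏ i ∈ I, h i u) ^ 2 ^ I.card ≤ bias g := by
  induction I using Finset.induction_on generalizing g h with
  | empty => simp [bias]
  | insert e I he ih =>
    set A := 𝔼 u, sgn (g u) * ∏ i ∈ insert e I, h i u with hA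
    -- the function of `t` to which the induction hypothesis is applied
    set H : E e → ι → (∀ i, E i) → ℝ :=
      fun t i u => h i u * h i (update u e (u e + t)) with hH
    set X : E e → ℝ := fun t => 𝔼 u, sgn (g (update u e t)) * ∏ i ∈ I, H t i u with hX
    have hsq : A ^ 2 ≤ 𝔼 t, X t := by
      have e1 : A = 𝔼 u, h e u *
          𝔼 v : E e, sgn (g (update u e v)) * ∏ i ∈ I, h i (update u e v) := by
        rw [hA, expect_update e]
        refine expect_congr rfl fun u _ => ?_
        rw [mul_expect]
        refine expect_congr rfl fun v _ => ?_
        rw [prod_insert he, hind e (mem_insert_self _ _)]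
        ring
      have e2 : A ^ 2 ≤ 𝔼 u, (𝔼 v : E e, sgn (g (update u e v)) *
          ∏ i ∈ I, h i (update u e v)) ^ 2 := by
        rw [e1]
        refine (by simpa using expect_pow_two_pow_le (α := ∀ i, E i) _ 1 : _ ≤ _).trans
          (expect_le_expect fun u _ => ?_)
        rw [mul_pow]
        refine mul_le_of_le_one_left (sq_nonneg _) ?_
        rw [← sq_abs]
        exact pow_le_one₀ (abs_nonneg _) (h1 _ _)
      refine e2.trans_eq ?_
      calc 𝔼 u, (𝔼 v : E e, sgn (g (update u e v)) * ∏ i ∈ I, h i (update u e v)) ^ 2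
          = 𝔼 u, 𝔼 v : E e, 𝔼 t : E e, sgn (g (update u e t)) *
              ∏ i ∈ I, H t i (update u e v) := by
            refine expect_congr rfl fun u _ => ?_
            rw [sq, Fintype.expect_mul_expect]
            refine expect_congr rfl fun v _ => ?_
            rw [← expect_translate _ v]
            refine expect_congr rfl fun t _ => ?_
            have : sgn (g (update u e (t + v))) =
                sgn (g (update u e t)) * sgn (g (update u e v)) := by
              rw [hg.add e (mem_insert_self _ _), sgn_add]
            simp only [hH, update_self, update_idem, prod_mul_distrib, this, add_comm v t]
            linear_combination (sgn (g (update u e t)) * (∏ i ∈ I, h i (update u e v)) *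
              ∏ i ∈ I, h i (update u e (t + v))) * sgn_mul_self (g (update u e v))
        _ = 𝔼 u, 𝔼 t : E e, sgn (g (update u e t)) * ∏ i ∈ I, H t i u := by
            rw [expect_update e fun u => 𝔼 t : E e, sgn (g (update u e t)) *
              ∏ i ∈ I, H t i u]
            simp only [update_idem]
        _ = 𝔼 t, X t := expect_comm _ _ _
    rw [card_insert_of_notMem he, pow_succ' 2, pow_mul]
    calc (A ^ 2) ^ 2 ^ I.card ≤ (𝔼 t, X t) ^ 2 ^ I.card := pow_le_pow_left₀ (sq_nonneg _) hsq _
      _ ≤ 𝔼 t, X t ^ 2 ^ I.card := expect_pow_two_pow_le _ _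
      _ ≤ 𝔼 t, bias fun u => g (update u e t) := expect_le_expect fun t _ => ?_
      _ = bias g := by
          unfold bias
          rw [expect_update e fun u => sgn (g u)]
          exact expect_comm _ _ _
    refine ih ((hg.slice e t).of_eq (erase_insert he)) (H t) (fun i u => ?_)
      (fun i hi u x => ?_)
    · rw [abs_mul]
      exact mul_le_one₀ (h1 _ _) (abs_nonneg _) (h1 _ _)
    · have hie : i ≠ e := by rintro rfl; exact he hi
      simp only [hH, update_comm hie, hind i (mem_insert_of_mem hi), update_of_ne hie.symm]

/-- A form on at least one coordinate is as equidistributed after adding functions that each ignore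
one of its coordinates. -/
theorem IsForm.abs_expect_pow_le {I : Finset ι} {g : (∀ i, E i) → ZMod 2} (hg : IsForm I g)
    (hI : I.Nonempty) {κ : Type*} (s : Finset κ) (k : κ → (∀ i, E i) → ZMod 2)
    (hk : ∀ m ∈ s, ∃ i ∈ I, ∀ u x, k m (update u i x) = k m u) :
    |𝔼 u, sgn (g u + ∑ m ∈ s, k m u)| ^ 2 ^ I.card ≤ bias g := by
  classical
  have hc : ∀ m, ∃ i, m ∈ s → i ∈ I ∧ ∀ u x, k m (update u i x) = k m u := by
    intro m
    by_cases hm : m ∈ s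
    · obtain ⟨i, hi⟩ := hk m hm
      exact ⟨i, fun _ => hi⟩
    · exact ⟨hI.choose, fun h => absurd h hm⟩
  choose c hc using hc
  have hev : Even (2 ^ I.card) := (Nat.even_pow.2 ⟨even_two, hI.card_pos.ne'⟩)
  rw [hev.pow_abs]
  convert hg.expect_pow_le_bias (fun i u => ∏ m ∈ s with c m = i, sgn (k m u)) ?_ ?_ using 4
    with u
  · rw [sgn_add, sgn_sum, prod_fiberwise_of_maps_to (g := c) (fun m hm => (hc m hm).1)]
  · intro i u
    rw [abs_prod]
    simp
  · intro i _ u x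
    refine prod_congr rfl fun m hm => ?_
    obtain ⟨hms, rfl⟩ := mem_filter.1 hm
    rw [(hc m hms).2]

/-! ### Equidistribution of regular families of forms -/

variable {L : Type*}

/-- A family of forms is `κ`-regular if the sum of finitely many (and at least one) of its forms
that live on the same coordinates always has bias at most `κ`. -/
def Regular (κ : ℝ) (I : L → Finset ι) (f : L → (∀ i, E i) → ZMod 2) : Prop :=
  ∀ (T : Finset L) (J : Finset ι), T.Nonempty → (∀ l ∈ T, I l = J) →
    bias (fun u => ∑ l ∈ T, f l u) ≤ κ

variable {I : L → Finset ι} {f : L → (∀ i, E i) → ZMod 2} {d : ℕ} {κ τ : ℝ}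

/-- The non-trivial sums of a regular family are nearly unbiased, and so they remain after adding
functions that each ignore a coordinate of a form `f l₀` of maximal size. Indeed the forms of the
sum on the same coordinates as `f l₀` add up to a form of small bias, and all the other ones ignore
a coordinate of `f l₀`. -/
theorem Regular.abs_expect_le (hreg : Regular κ I f) (hf : ∀ l, IsForm (I l) (f l))
    (hI : ∀ l, (I l).Nonempty) (hd : ∀ l, (I l).card ≤ d) (hτ : 0 ≤ τ) (hκ : κ ≤ τ ^ 2 ^ d)
    (T : Finset L) (l₀ : L) (hl₀ : l₀ ∈ T) (hmax : ∀ l ∈ T, (I l).card ≤ (I l₀).card)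
    {K : Type*} (s : Finset K) (k : K → (∀ i, E i) → ZMod 2)
    (hk : ∀ m ∈ s, ∃ i ∈ I l₀, ∀ u x, k m (update u i x) = k m u) :
    |𝔼 u, sgn (∑ l ∈ T, f l u + ∑ m ∈ s, k m u)| ≤ τ := by
  classical
  set T₀ := T.filter fun l => I l = I l₀ with hT₀
  set T₁ := T.filter fun l => ¬ I l = I l₀ with hT₁
  have hg : IsForm (I l₀) fun u => ∑ l ∈ T₀, f l u :=
    IsForm.sum _ fun l hl => (hf l).of_eq (mem_filter.1 hl).2
  have h1 := hg.abs_expect_pow_le (hI l₀) (T₁.disjSum s)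
    (Sum.elim f k) (by
      rintro (l | m) hm
      · rw [inl_mem_disjSum, hT₁, mem_filter] at hm
        obtain ⟨i, hi, hi'⟩ : ∃ i ∈ I l₀, i ∉ I l := by
          by_contra! hsub
          exact hm.2 (eq_of_subset_of_card_le hsub (hmax l hm.1)).symm
        exact ⟨i, hi, fun u x => (hf l).update_of_notMem hi' u x⟩
      · exact hk m (inr_mem_disjSum.1 hm))
  have h2 : ∀ u, ∑ l ∈ T₀, f l u + ∑ m ∈ T₁.disjSum s, Sum.elim f k m u =
      ∑ l ∈ T, f l u + ∑ m ∈ s, k m u := by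
    intro u
    rw [sum_disjSum, ← add_assoc, ← sum_filter_add_sum_filter_not T fun l => I l = I l₀]
    rfl
  simp only [h2] at h1
  set x := |𝔼 u, sgn (∑ l ∈ T, f l u + ∑ m ∈ s, k m u)| with hx
  have hx1 : x ≤ 1 := (Finset.abs_expect_le _ _).trans (by simp)
  have h3 : x ^ 2 ^ d ≤ τ ^ 2 ^ d :=
    (pow_le_pow_of_le_one (abs_nonneg _) hx1 (Nat.pow_le_pow_right two_pos (hd l₀))).trans
      (h1.trans ((hreg T₀ (I l₀) ⟨l₀, by simp [hT₀, hl₀]⟩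
        fun l hl => (mem_filter.1 hl).2).trans hκ))
  exact le_of_pow_le_pow_left₀ (by positivity) hτ h3

/-- Resampling the coordinate `e`, the roles of the old and the new point are symmetric. -/
theorem expect_update_swap (e : ι) (F : (∀ i, E i) → (∀ i, E i) → ℝ) :
    𝔼 u, 𝔼 w : E e, F u (update u e w) = 𝔼 u, 𝔼 w : E e, F (update u e w) u := by
  rw [expect_update e, expect_update e fun u => 𝔼 w : E e, F (update u e w) u]
  refine expect_congr rfl fun u _ => ?_
  simp only [update_idem]
  exact expect_comm _ _ _

/-- The values of a regular family of forms at a random point, together with their values after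
resampling one coordinate, have small Fourier coefficients. -/
theorem Regular.abs_expect_pair_le (hreg : Regular κ I f) (hf : ∀ l, IsForm (I l) (f l))
    (hI : ∀ l, (I l).Nonempty) (hd : ∀ l, (I l).card ≤ d) (hτ : 0 ≤ τ) (hκ : κ ≤ τ ^ 2 ^ d)
    (e : ι) (T T' : Finset L) (hT' : ∀ l ∈ T', e ∈ I l) (hne : T.Nonempty ∨ T'.Nonempty) :
    |𝔼 u, 𝔼 w : E e, sgn (∑ l ∈ T, f l u + ∑ l ∈ T', f l (update u e w))| ≤ τ := by
  classical
  have core : ∀ (T T' : Finset L) (l₀ : L), l₀ ∈ T → (∀ l ∈ T, (I l).card ≤ (I l₀).card) →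
      (∀ l ∈ T', ((I l).erase e).card < (I l₀).card) →
      |𝔼 u, 𝔼 w : E e, sgn (∑ l ∈ T, f l u + ∑ l ∈ T', f l (update u e w))| ≤ τ := by
    intro T T' l₀ hl₀ hmax hlt
    rw [expect_comm]
    refine (Finset.abs_expect_le _ _).trans (expect_le univ_nonempty fun w _ => ?_)
    refine hreg.abs_expect_le hf hI hd hτ hκ T l₀ hl₀ hmax T' (fun l u => f l (update u e w))
      fun l hl => ?_
    obtain ⟨i, hi, hi'⟩ : ∃ i ∈ I l₀, i ∉ (I l).erase e := by
      by_contra! hsub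
      exact absurd (card_le_card hsub) (not_le.2 (hlt l hl))
    exact ⟨i, hi, fun u x => ((hf l).slice e w).update_of_notMem hi' u x⟩
  -- the largest form of both sums may be assumed to be in the first one, by `expect_update_swap`
  obtain ⟨l₁, hl₁, hmax⟩ := exists_max_image (T ∪ T') (fun l => (I l).card)
    (by rcases hne with h | h
        · exact h.mono subset_union_left
        · exact h.mono subset_union_right)
  have hT'lt : ∀ l ∈ T', ((I l).erase e).card < (I l₁).card := fun l hl =>
    (card_erase_lt_of_mem (hT' l hl)).trans_le (hmax l (mem_union_right _ hl))
  by_cases hT : ∃ l₀ ∈ T, (I l₀).card = (I l₁).card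
  · obtain ⟨l₀, hl₀, heq⟩ := hT
    exact core T T' l₀ hl₀ (fun l hl => heq ▸ hmax l (mem_union_left _ hl)) (heq ▸ hT'lt)
  · have hl₁' : l₁ ∈ T' := (mem_union.1 hl₁).resolve_left fun h => hT ⟨l₁, h, rfl⟩
    have h := core T' T l₁ hl₁' (fun l hl => hmax l (mem_union_right _ hl)) fun l hl =>
      (card_le_card (erase_subset _ _)).trans_lt
        (lt_of_le_of_ne (hmax l (mem_union_left _ hl)) fun h => hT ⟨l, hl, h⟩)
    rw [expect_update_swap e fun u v => sgn (∑ l ∈ T', f l u + ∑ l ∈ T, f l v)] at h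
    simpa only [add_comm] using h

end Bias

/-! ### Almost uniform random bit vectors -/

section Uniform

variable {Ω : Type*} [Fintype Ω] [Nonempty Ω] {K : Type*} [Fintype K] [DecidableEq K]

/-- A random bit vector all of whose non-trivial Fourier coefficients are at most `τ` takes each
value with probability within `τ` of the uniform one. -/
theorem abs_prob_eq_sub_le (X : Ω → K → ZMod 2) {τ : ℝ} (hτ : 0 ≤ τ)
    (hX : ∀ T : Finset K, T.Nonempty → |𝔼 ω, sgn (∑ k ∈ T, X ω k)| ≤ τ) (y : K → ZMod 2) :
    |(prob fun ω => X ω = y) - (2⁻¹ : ℝ) ^ Fintype.card K| ≤ τ := by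
  classical
  have h1 : ∀ ω, (if X ω = y then (1 : ℝ) else 0) =
      (2⁻¹ : ℝ) ^ Fintype.card K * ∑ T : Finset K,
        sgn (∑ k ∈ T, y k) * sgn (∑ k ∈ T, X ω k) := by
    intro ω
    have h2 : ∀ k, 1 + sgn (y k) * sgn (X ω k) = if X ω k = y k then (2 : ℝ) else 0 := by
      intro k
      rcases zmod_two_cases (X ω k) with h | h <;> rcases zmod_two_cases (y k) with h' | h' <;>
        norm_num [h, h']
    simp only [sgn_sum, ← prod_mul_distrib]
    rw [← powerset_univ, ← prod_one_add]
    simp only [h2]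
    split_ifs with h
    · simp [h]
    · obtain ⟨k, hk⟩ : ∃ k, X ω k ≠ y k := by
        by_contra! h'; exact h (funext h')
      rw [prod_eq_zero (mem_univ k) (if_neg hk), mul_zero]
  have h3 : (prob fun ω => X ω = y) - (2⁻¹ : ℝ) ^ Fintype.card K =
      (2⁻¹ : ℝ) ^ Fintype.card K * ∑ T ∈ (univ : Finset (Finset K)).erase ∅,
        sgn (∑ k ∈ T, y k) * 𝔼 ω, sgn (∑ k ∈ T, X ω k) := by
    rw [prob_eq]
    simp only [h1]
    rw [← mul_expect, expect_sum_comm, ← sum_erase_add _ _ (mem_univ (∅ : Finset K))]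
    simp only [← mul_expect]
    simp
    ring
  rw [h3, abs_mul, abs_of_nonneg (by positivity)]
  have h4 : |∑ T ∈ (univ : Finset (Finset K)).erase ∅,
      sgn (∑ k ∈ T, y k) * 𝔼 ω, sgn (∑ k ∈ T, X ω k)| ≤ 2 ^ Fintype.card K * τ := by
    refine (abs_sum_le_sum_abs _ _).trans ?_
    calc _ ≤ ∑ T ∈ (univ : Finset (Finset K)).erase ∅, τ := by
          refine sum_le_sum fun T hT => ?_
          rw [abs_mul, abs_sgn, one_mul]
          exact hX T (nonempty_iff_ne_empty.2 (mem_erase.1 hT).1)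
      _ ≤ ∑ T : Finset K, τ := sum_le_sum_of_subset_of_nonneg (erase_subset _ _) fun _ _ _ => hτ
      _ = 2 ^ Fintype.card K * τ := by simp
  calc _ ≤ (2⁻¹ : ℝ) ^ Fintype.card K * (2 ^ Fintype.card K * τ) := by gcongr
    _ = τ := by rw [← mul_assoc, ← mul_pow]; norm_num

/-- An event that depends on a random bit vector with small Fourier coefficients has almost the same
probability as for a uniform bit vector. -/
theorem abs_prob_comp_sub_le (X : Ω → K → ZMod 2) {τ : ℝ} (hτ : 0 ≤ τ)
    (hX : ∀ T : Finset K, T.Nonempty → |𝔼 ω, sgn (∑ k ∈ T, X ω k)| ≤ τ)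
    (p : (K → ZMod 2) → Prop) :
    |(prob fun ω => p (X ω)) - prob p| ≤ 2 ^ Fintype.card K * τ := by
  classical
  have h1 : (prob fun ω => p (X ω)) = ∑ y with p y, prob fun ω => X ω = y := by
    simp only [prob_eq]
    rw [← expect_sum_comm]
    refine expect_congr rfl fun ω _ => ?_
    simp [sum_ite_eq]
  have h2 : prob p = ∑ y : K → ZMod 2 with p y, (2⁻¹ : ℝ) ^ Fintype.card K := by
    rw [sum_const, nsmul_eq_mul, card_eq_prob_mul]
    simp only [Fintype.card_fun, ZMod.card]
    push_cast
    rw [mul_assoc, ← mul_pow]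
    norm_num
  rw [h1, h2, ← sum_sub_distrib]
  refine (abs_sum_le_sum_abs _ _).trans ?_
  calc _ ≤ ∑ y : K → ZMod 2 with p y, τ :=
        sum_le_sum fun y _ => abs_prob_eq_sub_le X hτ hX y
    _ ≤ ∑ y : K → ZMod 2, τ := sum_le_sum_of_subset_of_nonneg (filter_subset _ _) fun _ _ _ => hτ
    _ = 2 ^ Fintype.card K * τ := by simp

/-- The version of `abs_prob_comp_sub_le` for pairs of bit vectors. -/
theorem abs_prob_comp_pair_sub_le (X X' : Ω → K → ZMod 2) {τ : ℝ} (hτ : 0 ≤ τ)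
    (hX : ∀ T T' : Finset K, T.Nonempty ∨ T'.Nonempty →
      |𝔼 ω, sgn (∑ k ∈ T, X ω k + ∑ k ∈ T', X' ω k)| ≤ τ)
    (p : (K → ZMod 2) × (K → ZMod 2) → Prop) :
    |(prob fun ω => p (X ω, X' ω)) - prob p| ≤ 4 ^ Fintype.card K * τ := by
  classical
  have h := abs_prob_comp_sub_le (K := K ⊕ K) (fun ω => Sum.elim (X ω) (X' ω)) hτ
    (fun T hT => by
      rw [← T.toLeft_disjSum_toRight]
      simp only [sum_disjSum, Sum.elim_inl, Sum.elim_inr]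
      refine hX _ _ ?_
      obtain ⟨k | k, hk⟩ := hT
      · exact Or.inl ⟨k, by simpa using hk⟩
      · exact Or.inr ⟨k, by simpa using hk⟩)
    (fun z => p (fun k => z (Sum.inl k), fun k => z (Sum.inr k)))
  have h2 : prob (fun z : K ⊕ K → ZMod 2 => p (fun k => z (Sum.inl k), fun k => z (Sum.inr k))) =
      prob p :=
    prob_equiv (Equiv.sumArrowEquivProdArrow K K (ZMod 2)) _ _ fun _ => Iff.rfl
  rw [h2, Fintype.card_sum, ← two_mul, pow_mul] at h
  norm_num at h
  exact h

end Uniform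

/-! ### Linearity testing -/

section Linearity

/-- A map between groups that is additive for most pairs of arguments agrees with a homomorphism
at most points. The homomorphism kills the periods of the map. -/
theorem exists_addMonoidHom_of_prob {V W : Type*} [AddCommGroup V] [Fintype V] [AddCommGroup W]
    (g : V → W) : ∃ χ : V →+ W,
      (prob fun v => g v ≠ χ v) ≤ 12 * (prob fun z : V × V => g (z.1 + z.2) ≠ g z.1 + g z.2) ∧
      ∀ a, (∀ v, g (a + v) = g v) → χ a = 0 := by
  classical
  set ε := prob fun z : V × V => g (z.1 + z.2) ≠ g z.1 + g z.2 with hε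
  have hε0 : 0 ≤ ε := prob_nonneg _
  rcases le_or_gt (1 / 12) ε with h12 | h12
  · exact ⟨0, (prob_le_one _).trans (by linarith), fun _ _ => rfl⟩
  have hε' : ε = 𝔼 b', prob fun b => g (b + b') ≠ g b + g b' := by
    rw [hε, prob_prod]
    simp only [prob_eq]
    exact expect_comm _ _ _
  -- the most popular value of `g (a + b) - g b`
  have key : ∀ a, ∃ w, (prob fun b => g (a + b) - g b ≠ w) ≤ 2 * ε := by
    intro a
    have h : 𝔼 b', prob (fun b => g (a + b) - g b ≠ g (a + b') - g b') ≤ 2 * ε := by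
      have h1 : 𝔼 b', prob (fun b => g (a + b + b') ≠ g (a + b) + g b') = ε := by
        rw [hε']
        exact expect_congr rfl fun b' _ =>
          prob_translate_left (fun b => g (b + b') ≠ g b + g b') a
      have h2 : 𝔼 b', prob (fun b => g (b + (a + b')) ≠ g b + g (a + b')) = ε := by
        rw [hε']
        simpa only [add_comm a] using
          expect_translate (fun b' => prob fun b => g (b + b') ≠ g b + g b') a
      calc _ ≤ 𝔼 b', (prob (fun b => g (a + b + b') ≠ g (a + b) + g b') +
            prob fun b => g (b + (a + b')) ≠ g b + g (a + b')) := by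
            refine expect_le_expect fun b' _ =>
              (prob_mono fun b hb => ?_).trans (prob_or_le _ _)
            by_contra! hc
            apply hb
            have h3 : a + b + b' = b + (a + b') := by abel
            have h4 := hc.1.symm.trans ((congrArg g h3).trans hc.2)
            rw [sub_eq_sub_iff_add_eq_add, h4]; abel
        _ = 2 * ε := by rw [expect_add_distrib, h1, h2]; ring
    obtain ⟨b', hb'⟩ := exists_of_expect_le h
    exact ⟨_, hb'⟩
  choose χ hχ using key
  have hadd : ∀ a a', χ (a + a') = χ a + χ a' := by
    intro a a'
    have h1 : (prob fun b => g (a + (a' + b)) - g (a' + b) ≠ χ a) ≤ 2 * ε :=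
      (prob_translate_left (fun b => g (a + b) - g b ≠ χ a) a').trans_le (hχ a)
    have h2 := (prob_or_le (fun b => g (a + (a' + b)) - g (a' + b) ≠ χ a)
      (fun b => g (a' + b) - g b ≠ χ a' ∨ g (a + a' + b) - g b ≠ χ (a + a'))).trans
      (add_le_add h1 ((prob_or_le _ _).trans (add_le_add (hχ a') (hχ (a + a')))))
    obtain ⟨b, hb⟩ := exists_not_of_prob_lt_one (h2.trans_lt (by linarith))
    push Not at hb
    rw [← hb.1, ← hb.2.1, ← hb.2.2, add_assoc]
    abel
  refine ⟨AddMonoidHom.mk' χ hadd, ?_, fun a ha => ?_⟩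
  · -- if `g a ≠ χ a` then every `b` violates one of two conditions, each valid for most `b`
    have h1 : (prob fun v => g v ≠ χ v) ≤ 𝔼 a, ((prob fun b => g (a + b) ≠ g a + g b) +
        prob fun b => g (a + b) - g b ≠ χ a) := by
      rw [prob_eq]
      refine expect_le_expect fun a _ => ?_
      split_ifs with h
      · rw [← prob_true (α := V)]
        refine (prob_mono fun b _ => ?_).trans (prob_or_le _ _)
        by_contra! hc
        rw [hc.1, add_sub_cancel_right] at hc
        exact h hc.2
      · exact add_nonneg (prob_nonneg _) (prob_nonneg _)
    rw [expect_add_distrib, ← prob_prod (fun z : V × V => g (z.1 + z.2) ≠ g z.1 + g z.2)] at h1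
    have h2 : 𝔼 a, (prob fun b => g (a + b) - g b ≠ χ a) ≤ 2 * ε :=
      expect_le univ_nonempty fun a _ => hχ a
    simp only [AddMonoidHom.mk'_apply]
    linarith
  · by_contra h0
    have h1 := hχ a
    have h2 : (prob fun b => g (a + b) - g b ≠ χ a) = 1 := by
      rw [← prob_true (α := V)]
      refine prob_congr fun b => ?_
      rw [ha b, sub_self]
      simpa using fun h => h0 h.symm
    linarith

end Linearity

/-! ### Testing for block multilinearity -/

section BlockTesting

variable {ι : Type} [DecidableEq ι] {L : Type} (I : L → Finset ι)

/-- The vector `y` with the coordinates in the block of `e`, that is those `l` with `e ∈ I l`,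
replaced by those of `y'`. -/
def mix (e : ι) (y y' : L → ZMod 2) : L → ZMod 2 := fun l => if e ∈ I l then y' l else y l

/-- The vector `y` with the coordinates of `y'` in the block of `e` added. -/
def addMix (e : ι) (y y' : L → ZMod 2) : L → ZMod 2 :=
  fun l => if e ∈ I l then y l + y' l else y l

variable [Fintype L] [DecidableEq L]

/-- Resampling a block preserves the uniform distribution. -/
theorem expect_mix (e : ι) (F : (L → ZMod 2) → ℝ) :
    𝔼 y, F y = 𝔼 y, 𝔼 y', F (mix I e y y') := by
  have h : ∀ z : (L → ZMod 2) × (L → ZMod 2),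
      (mix I e (mix I e z.1 z.2) (mix I e z.2 z.1), mix I e (mix I e z.2 z.1) (mix I e z.1 z.2))
        = z := by
    intro z
    ext l <;> simp only [mix] <;> split_ifs <;> rfl
  let σ : (L → ZMod 2) × (L → ZMod 2) ≃ (L → ZMod 2) × (L → ZMod 2) :=
    ⟨fun z => (mix I e z.1 z.2, mix I e z.2 z.1), fun z => (mix I e z.1 z.2, mix I e z.2 z.1), h, h⟩
  calc 𝔼 y, F y = 𝔼 z : (L → ZMod 2) × (L → ZMod 2), F z.1 := by
        rw [expect_prod_type]; simp
    _ = 𝔼 z : (L → ZMod 2) × (L → ZMod 2), F (mix I e z.1 z.2) :=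
        (Fintype.expect_equiv σ _ _ fun _ => rfl).symm
    _ = _ := expect_prod_type _

theorem prob_mix (e : ι) (p : (L → ZMod 2) → Prop) :
    (prob fun z : (L → ZMod 2) × (L → ZMod 2) => p (mix I e z.1 z.2)) = prob p := by
  classical
  rw [prob_eq, prob_eq, expect_prod_type, expect_mix I e fun y => if p y then (1 : ℝ) else 0]

theorem prob_addMix (e : ι) (p : (L → ZMod 2) → Prop) :
    (prob fun z : (L → ZMod 2) × (L → ZMod 2) => p (addMix I e z.1 z.2)) = prob p := by
  have h : ∀ z : (L → ZMod 2) × (L → ZMod 2),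
      (addMix I e (addMix I e z.1 z.2) z.2, z.2) = z := by
    intro z
    ext l
    · simp only [addMix]
      split_ifs
      · rw [add_assoc, add_self_two, add_zero]
      · rfl
    · rfl
  rw [← prob_fst (β := L → ZMod 2) p]
  let σ : (L → ZMod 2) × (L → ZMod 2) ≃ (L → ZMod 2) × (L → ZMod 2) :=
    ⟨fun z => (addMix I e z.1 z.2, z.2), fun z => (addMix I e z.1 z.2, z.2), h, h⟩
  exact prob_equiv σ _ _ fun _ => Iff.rfl

variable {W : Type} [AddCommGroup W] [Module (ZMod 2) W]

/-- A non-trivial linear combination of uniformly random bits is non-zero with probability at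
least `1/2`. -/
theorem half_le_prob_sum_ne_zero (a b : L → W) (h : ∃ l, a l ≠ 0 ∨ b l ≠ 0) :
    (1 / 2 : ℝ) ≤ prob fun z : (L → ZMod 2) × (L → ZMod 2) =>
      ∑ l, (z.1 l • a l + z.2 l • b l) ≠ 0 := by
  set Λ : (L → ZMod 2) × (L → ZMod 2) → W := fun z => ∑ l, (z.1 l • a l + z.2 l • b l) with hΛ
  have hadd : ∀ z z', Λ (z + z') = Λ z + Λ z' := by
    intro z z'
    simp only [hΛ, ← sum_add_distrib]
    refine sum_congr rfl fun l _ => ?_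
    simp only [Prod.fst_add, Prod.snd_add, Pi.add_apply, add_smul]
    abel
  obtain ⟨z₀, hz₀⟩ : ∃ z₀, Λ z₀ ≠ 0 := by
    obtain ⟨l, h | h⟩ := h
    · exact ⟨(Pi.single l 1, 0), by simpa [hΛ, Pi.single_apply] using h⟩
    · exact ⟨(0, Pi.single l 1), by simpa [hΛ, Pi.single_apply] using h⟩
  have h1 : (1 : ℝ) ≤ (prob fun z => Λ z ≠ 0) + prob fun z => Λ (z + z₀) ≠ 0 := by
    rw [← prob_true (α := (L → ZMod 2) × (L → ZMod 2))]
    refine (prob_mono fun z _ => ?_).trans (prob_or_le _ _)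
    by_contra! hc
    rw [hadd, hc.1, zero_add] at hc
    exact hz₀ hc.2
  rw [prob_translate (fun z => Λ z ≠ 0) z₀] at h1
  linarith

/-- If after resampling the block of `i` a function becomes a linear combination of the new bits,
then the coefficients mostly vanish, provided the function itself mostly vanishes. -/
theorem prob_coeff_ne_zero_le (i : ι) (D : (L → ZMod 2) → (L → ZMod 2) → W)
    (a b : (L → ZMod 2) → (L → ZMod 2) → L → W)
    (hD : ∀ y y' z z', D (mix I i y z) (mix I i y' z') =
      ∑ l, (z l • a y y' l + z' l • b y y' l)) :
    (prob fun z : (L → ZMod 2) × (L → ZMod 2) => ∃ l, a z.1 z.2 l ≠ 0 ∨ b z.1 z.2 l ≠ 0) ≤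
      2 * prob fun z : (L → ZMod 2) × (L → ZMod 2) => D z.1 z.2 ≠ 0 := by
  classical
  have h1 : (prob fun z : (L → ZMod 2) × (L → ZMod 2) => D z.1 z.2 ≠ 0) =
      𝔼 y, 𝔼 y', prob fun z : (L → ZMod 2) × (L → ZMod 2) =>
        D (mix I i y z.1) (mix I i y' z.2) ≠ 0 := by
    simp only [prob_eq, expect_prod_type]
    rw [expect_mix I i]
    refine expect_congr rfl fun y _ => ?_
    conv_lhs =>
      enter [2, z]
      rw [expect_mix I i fun y' => if D (mix I i y z) y' ≠ 0 then (1 : ℝ) else 0]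
    rw [expect_comm]
  have h2 : (1 / 2 : ℝ) * (prob fun z : (L → ZMod 2) × (L → ZMod 2) =>
      ∃ l, a z.1 z.2 l ≠ 0 ∨ b z.1 z.2 l ≠ 0) ≤
      prob fun z : (L → ZMod 2) × (L → ZMod 2) => D z.1 z.2 ≠ 0 := by
    rw [h1, prob_eq, expect_prod_type, mul_expect]
    refine expect_le_expect fun y _ => ?_
    rw [mul_expect]
    refine expect_le_expect fun y' _ => ?_
    simp only [hD]
    split_ifs with h
    · rw [mul_one]; exact half_le_prob_sum_ne_zero _ _ h
    · rw [mul_zero]; exact prob_nonneg _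
  linarith

end BlockTesting

section BlockTesting

variable {ι : Type} [DecidableEq ι] {L : Type} [Fintype L] [DecidableEq L]

/-- A function that is mostly unchanged when any one block is resampled is mostly constant. -/
theorem exists_const_of_inv_tests {W : Type} {I : L → Finset ι} {S : Finset ι}
    (hI : ∀ l, (I l).Nonempty ∧ I l ⊆ S) (Γ : (L → ZMod 2) → W) {ε : ℝ}
    (hinv : ∀ j ∈ S, (prob fun z : (L → ZMod 2) × (L → ZMod 2) =>
      Γ (mix I j z.1 z.2) ≠ Γ z.1) ≤ ε) :
    ∃ w, (prob fun y => Γ y ≠ w) ≤ S.card * ε := by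
  classical
  have key : ∀ S₀ : Finset ι, S₀ ⊆ S → ∃ Γ' : (L → ZMod 2) → W,
      (prob fun y => Γ y ≠ Γ' y) ≤ S₀.card * ε ∧
      ∀ y y', (∀ l, (∀ e ∈ S₀, e ∉ I l) → y l = y' l) → Γ' y = Γ' y' := by
    intro S₀
    induction S₀ using Finset.induction_on with
    | empty => exact fun _ => ⟨Γ, by simp [prob_false], fun y y' h => congrArg Γ (funext fun l =>
        h l (by simp))⟩
    | insert e S₀ he ih =>
      intro hS
      obtain ⟨Γ', h1, h2⟩ := ih ((subset_insert _ _).trans hS)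
      have h3 : 𝔼 y', (prob fun y => Γ y ≠ Γ' (mix I e y y')) ≤ ε + S₀.card * ε := by
        calc _ = prob fun z : (L → ZMod 2) × (L → ZMod 2) =>
                Γ z.1 ≠ Γ' (mix I e z.1 z.2) := by
              rw [prob_prod]
              simp only [prob_eq]
              exact expect_comm _ _ _
          _ ≤ (prob fun z : (L → ZMod 2) × (L → ZMod 2) => Γ (mix I e z.1 z.2) ≠ Γ z.1) +
              prob fun z : (L → ZMod 2) × (L → ZMod 2) =>
                Γ (mix I e z.1 z.2) ≠ Γ' (mix I e z.1 z.2) := by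
              refine (prob_mono fun z hz => ?_).trans (prob_or_le _ _)
              by_contra! hc
              exact hz (hc.1.symm.trans hc.2)
          _ ≤ ε + S₀.card * ε := by
              rw [prob_mix I e fun y => Γ y ≠ Γ' y]
              exact add_le_add (hinv e (hS (mem_insert_self _ _))) h1
      obtain ⟨y₀, hy₀⟩ := exists_of_expect_le h3
      refine ⟨fun y => Γ' (mix I e y y₀), hy₀.trans_eq ?_, fun y y' h => h2 _ _ fun l hl => ?_⟩
      · rw [card_insert_of_notMem he]; push_cast; ring
      · simp only [mix]
        split_ifs with hel
        · rfl
        · refine h l fun e' he' => ?_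
          rcases Finset.mem_insert.1 he' with rfl | he'
          · exact hel
          · exact hl e' he'
  obtain ⟨Γ', h1, h2⟩ := key S subset_rfl
  refine ⟨Γ' 0, ?_⟩
  have : ∀ y, Γ' y = Γ' 0 := fun y => h2 _ _ fun l hl => by
    obtain ⟨e, he⟩ := (hI l).1
    exact absurd he (hl e ((hI l).2 he))
  simpa only [this] using h1

variable {E : ι → Type} [∀ i, AddCommGroup (E i)]

/-- The conclusion of the testing theorem: `p` is a combination of products of the bits `y l` over
families of `l` whose `I l` partition `A`. It is recorded through its values at the values of the
forms `f l`: these make a form on `A`, which is a sum of the `f l` times forms on `A \ I l`. -/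
structure IsBlockForm {W : Type} [AddCommGroup W] [Module (ZMod 2) W] (I : L → Finset ι)
    (f : L → (∀ i, E i) → ZMod 2) (A : Finset ι) (p : (L → ZMod 2) → W) : Prop where
  isForm : IsForm A fun u => p fun l => f l u
  decomp : A.Nonempty → ∃ q : L → (L → ZMod 2) → W, (∀ y, p y = ∑ l, y l • q l y) ∧
    ∀ l, (I l ⊆ A ∧ IsForm (A \ I l) fun u => q l fun l => f l u) ∨ q l = 0

variable {W : Type} [AddCommGroup W] [Module (ZMod 2) W] {I : L → Finset ι} {S A : Finset ι}

theorem hom_eq_sum (χ : (L → ZMod 2) →+ W) (z : L → ZMod 2) :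
    χ z = ∑ l, z l • χ (Pi.single l 1) := by
  conv_lhs => rw [← univ_sum_single z, map_sum]
  refine sum_congr rfl fun l _ => ?_
  rcases zmod_two_cases (z l) with h | h <;> simp [h]

/-- One step of the testing theorem: a function that passes the linearity test for the block of `i`
is close to a combination of the bits in this block, with coefficients that do not depend on them.
The coefficients inherit the tests for the other blocks. -/
theorem exists_coeff_of_tests {i : ι} (hiS : i ∈ A) (Γ : (L → ZMod 2) → W)
    {ε : ℝ}
    (hlin : ∀ j ∈ A, (prob fun z : (L → ZMod 2) × (L → ZMod 2) =>
      Γ (addMix I j z.1 z.2) ≠ Γ z.1 + Γ (mix I j z.1 z.2)) ≤ ε)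
    (hinv : ∀ j ∈ S \ A, (prob fun z : (L → ZMod 2) × (L → ZMod 2) =>
      Γ (mix I j z.1 z.2) ≠ Γ z.1) ≤ ε) :
    ∃ γ : (L → ZMod 2) → L → W,
      (prob fun y => Γ y ≠ ∑ l, y l • γ y l) ≤ 12 * ε ∧
      (∀ y l, i ∉ I l → γ y l = 0) ∧ (∀ y z, γ (mix I i y z) = γ y) ∧
      (∀ j ∈ A, j ≠ i → (prob fun z : (L → ZMod 2) × (L → ZMod 2) => ¬ ∀ l,
        (j ∈ I l → γ (mix I j z.1 z.2) l = γ z.1 l) ∧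
        (j ∉ I l → γ (addMix I j z.1 z.2) l = γ z.1 l + γ (mix I j z.1 z.2) l)) ≤ 74 * ε) ∧
      (∀ j ∈ S \ A, (prob fun z : (L → ZMod 2) × (L → ZMod 2) => ¬ ∀ l,
        (j ∈ I l → γ z.1 l = 0 ∧ γ (mix I j z.1 z.2) l = 0) ∧
        (j ∉ I l → γ (mix I j z.1 z.2) l = γ z.1 l)) ≤ 74 * ε) := by
  classical
  have hε : 0 ≤ ε := (prob_nonneg _).trans (hlin i hiS)
  choose B hB1 hB2 using fun g : (L → ZMod 2) → W => exists_addMonoidHom_of_prob g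
  -- the homomorphism `B` is constructed with the bits outside the block of `i` fixed
  set γ : (L → ZMod 2) → L → W := fun y l => B (fun z => Γ (mix I i y z)) (Pi.single l 1) with hγ
  have hmixmix : ∀ y z z', mix I i (mix I i y z) z' = mix I i y z' := by
    intro y z z'; ext l; simp only [mix]; split_ifs <;> rfl
  have hγmix : ∀ y z, γ (mix I i y z) = γ y := by
    intro y z; simp only [hγ, hmixmix]
  have hγ0 : ∀ y l, i ∉ I l → γ y l = 0 := by
    intro y l hl
    refine hB2 _ _ fun v => congrArg Γ ?_
    ext k
    simp only [mix]
    split_ifs with hk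
    · have : k ≠ l := by rintro rfl; exact hl hk
      simp [this]
    · rfl
  -- `Γ₁` passes the tests, up to a larger error, and its tests concern only the coefficients `γ`
  set Γ₁ : (L → ZMod 2) → W := fun y => ∑ l, y l • γ y l with hΓ₁
  have hclose : (prob fun y => Γ y ≠ Γ₁ y) ≤ 12 * ε := by
    have h1 : ∀ y z, Γ₁ (mix I i y z) = B (fun z => Γ (mix I i y z)) z := by
      intro y z
      rw [hom_eq_sum]
      refine sum_congr rfl fun l _ => ?_
      rw [hγmix]
      by_cases hl : i ∈ I l
      · simp [mix, hl, hγ]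
      · rw [hγ0 y l hl, smul_zero]
        have := hγ0 y l hl
        simp only [hγ] at this
        rw [this, smul_zero]
    calc (prob fun y => Γ y ≠ Γ₁ y)
        = 𝔼 y, prob fun z => Γ (mix I i y z) ≠ B (fun z => Γ (mix I i y z)) z := by
          simp only [prob_eq]
          rw [expect_mix I i]
          simp only [h1]
      _ ≤ 𝔼 y, 12 * prob fun z : (L → ZMod 2) × (L → ZMod 2) =>
            Γ (mix I i y (z.1 + z.2)) ≠ Γ (mix I i y z.1) + Γ (mix I i y z.2) :=
          expect_le_expect fun y _ => hB1 _
      _ = 12 * prob fun z : (L → ZMod 2) × (L → ZMod 2) =>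
            Γ (addMix I i z.1 z.2) ≠ Γ z.1 + Γ (mix I i z.1 z.2) := by
          rw [← mul_expect]
          congr 1
          simp only [prob_eq, expect_prod_type]
          rw [expect_mix I i fun y => 𝔼 z', if Γ (addMix I i y z') ≠ Γ y + Γ (mix I i y z')
            then (1 : ℝ) else 0]
          have h2 : ∀ y z z', addMix I i (mix I i y z) z' = mix I i y (z + z') := by
            intro y z z'; ext l; simp only [mix, addMix]; split_ifs <;> rfl
          simp only [h2, hmixmix]
      _ ≤ 12 * ε := by gcongr; exact hlin i hiS
  have hmm : ∀ j y y' z z', mix I j (mix I i y z) (mix I i y' z') =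
      mix I i (mix I j y y') (mix I j z z') := by
    intro j y y' z z'; ext l; simp only [mix]; split_ifs <;> rfl
  have ham : ∀ j y y' z z', addMix I j (mix I i y z) (mix I i y' z') =
      mix I i (addMix I j y y') (addMix I j z z') := by
    intro j y y' z z'; ext l; simp only [mix, addMix]; split_ifs <;> rfl
  have hΓmix : ∀ y z, Γ₁ (mix I i y z) = ∑ l, z l • γ y l := by
    intro y z
    refine sum_congr rfl fun l _ => ?_
    rw [hγmix]
    by_cases hl : i ∈ I l
    · simp [mix, hl]
    · rw [hγ0 y l hl, smul_zero, smul_zero]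
  refine ⟨γ, hclose, hγ0, hγmix, fun j hj hji => ?_, fun j hj => ?_⟩
  · have h1 : (prob fun z : (L → ZMod 2) × (L → ZMod 2) =>
        Γ₁ (addMix I j z.1 z.2) + (Γ₁ z.1 + Γ₁ (mix I j z.1 z.2)) ≠ 0) ≤ 37 * ε := by
      calc _ ≤ (prob fun z : (L → ZMod 2) × (L → ZMod 2) =>
              Γ (addMix I j z.1 z.2) ≠ Γ z.1 + Γ (mix I j z.1 z.2)) +
            ((prob fun z : (L → ZMod 2) × (L → ZMod 2) =>
              Γ (addMix I j z.1 z.2) ≠ Γ₁ (addMix I j z.1 z.2)) +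
            ((prob fun z : (L → ZMod 2) × (L → ZMod 2) => Γ z.1 ≠ Γ₁ z.1) +
            prob fun z : (L → ZMod 2) × (L → ZMod 2) =>
              Γ (mix I j z.1 z.2) ≠ Γ₁ (mix I j z.1 z.2))) := by
            refine (prob_mono fun z hz => ?_).trans ((prob_or_le _ _).trans (add_le_add le_rfl
              ((prob_or_le _ _).trans (add_le_add le_rfl (prob_or_le _ _)))))
            by_contra! hc
            rw [← hc.2.1, ← hc.2.2.1, ← hc.2.2.2, hc.1] at hz
            exact hz (add_self_two _)
        _ ≤ ε + (12 * ε + (12 * ε + 12 * ε)) := by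
            rw [prob_addMix I j fun y => Γ y ≠ Γ₁ y, prob_mix I j fun y => Γ y ≠ Γ₁ y,
              prob_fst fun y => Γ y ≠ Γ₁ y]
            gcongr
            exact hlin j hj
        _ = 37 * ε := by ring
    have h2 := prob_coeff_ne_zero_le (I := I) i
      (fun y y' => Γ₁ (addMix I j y y') + (Γ₁ y + Γ₁ (mix I j y y')))
      (fun y y' l => if j ∈ I l then γ (addMix I j y y') l + γ y l else
        γ (addMix I j y y') l + (γ y l + γ (mix I j y y') l))
      (fun y y' l => if j ∈ I l then γ (addMix I j y y') l + γ (mix I j y y') l else 0)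
      (fun y y' z z' => by
        simp only [ham, hmm, hΓmix, ← sum_add_distrib]
        refine sum_congr rfl fun l _ => ?_
        by_cases hl : j ∈ I l
        · simp only [mix, addMix, hl, if_true, add_smul, smul_add]; abel
        · simp only [mix, addMix, hl, if_false, smul_add, smul_zero]; abel)
    refine (prob_mono fun z hz => ?_).trans (h2.trans (by linarith))
    by_contra! hc
    refine hz fun l => ⟨fun hl => ?_, fun hl => ?_⟩
    · have := hc l
      simp only [hl, if_true, add_eq_zero_two] at this
      rw [← this.1, ← this.2]
    · have := (hc l).1
      simp only [hl, if_false, add_eq_zero_two] at this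
      exact this
  · have h1 : (prob fun z : (L → ZMod 2) × (L → ZMod 2) =>
        Γ₁ (mix I j z.1 z.2) + Γ₁ z.1 ≠ 0) ≤ 37 * ε := by
      calc _ ≤ (prob fun z : (L → ZMod 2) × (L → ZMod 2) =>
              Γ (mix I j z.1 z.2) ≠ Γ z.1) +
            ((prob fun z : (L → ZMod 2) × (L → ZMod 2) => Γ z.1 ≠ Γ₁ z.1) +
            prob fun z : (L → ZMod 2) × (L → ZMod 2) =>
              Γ (mix I j z.1 z.2) ≠ Γ₁ (mix I j z.1 z.2)) := by
            refine (prob_mono fun z hz => ?_).trans ((prob_or_le _ _).trans (add_le_add le_rfl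
              (prob_or_le _ _)))
            by_contra! hc
            rw [← hc.2.1, ← hc.2.2, hc.1] at hz
            exact hz (add_self_two _)
        _ ≤ ε + (12 * ε + 12 * ε) := by
            rw [prob_mix I j fun y => Γ y ≠ Γ₁ y, prob_fst fun y => Γ y ≠ Γ₁ y]
            gcongr
            exact hinv j hj
        _ ≤ 37 * ε := by linarith
    have h2 := prob_coeff_ne_zero_le (I := I) i
      (fun y y' => Γ₁ (mix I j y y') + Γ₁ y)
      (fun y y' l => if j ∈ I l then γ y l else γ (mix I j y y') l + γ y l)
      (fun y y' l => if j ∈ I l then γ (mix I j y y') l else 0)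
      (fun y y' z z' => by
        simp only [hmm, hΓmix, ← sum_add_distrib]
        refine sum_congr rfl fun l _ => ?_
        by_cases hl : j ∈ I l
        · simp only [mix, hl, if_true]; abel
        · simp only [mix, hl, if_false, smul_add, smul_zero]; abel)
    refine (prob_mono fun z hz => ?_).trans (h2.trans (by linarith))
    by_contra! hc
    refine hz fun l => ⟨fun hl => ?_, fun hl => ?_⟩
    · have := hc l
      simpa only [hl, if_true] using this
    · have := (hc l).1
      simp only [hl, if_false, add_eq_zero_two] at this
      exact this

end BlockTesting

theorem IsForm.comp_eval {ι : Type} [DecidableEq ι] {E : ι → Type} [∀ i, AddCommGroup (E i)]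
    {L W : Type} [AddCommGroup W] {I : Finset ι} {φ : (∀ i, E i) → L → W} (h : IsForm I φ) (l : L) :
    IsForm I fun u => φ u l :=
  h.comp_addHom (Pi.evalAddMonoidHom (fun _ => W) l)

/-- The testing theorem: a function of the bits `y l` that, block by block, is mostly additive (for
the blocks in `A`) or mostly invariant (for the blocks outside `A`) is close to an exact such
function. The error is independent of the number of bits, which is why the functions have to be
vector valued: all the coefficients from `exists_coeff_of_tests` with the same `I l` are treated at
once. -/
theorem exists_isBlockForm (s n : ℕ) : ∃ C : ℝ, 0 ≤ C ∧
    ∀ {ι : Type} [DecidableEq ι] {L : Type} [Fintype L] [DecidableEq L]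
      {E : ι → Type} [∀ i, AddCommGroup (E i)] {W : Type} [AddCommGroup W] [Module (ZMod 2) W]
      {I : L → Finset ι} {S A : Finset ι} {f : L → (∀ i, E i) → ZMod 2}
      (Γ : (L → ZMod 2) → W) {ε : ℝ}, 0 ≤ ε → S.card = s → A.card ≤ n → A ⊆ S →
      (∀ l, (I l).Nonempty ∧ I l ⊆ S) → (∀ l, IsForm (I l) (f l)) →
      (∀ j ∈ A, (prob fun z : (L → ZMod 2) × (L → ZMod 2) =>
        Γ (addMix I j z.1 z.2) ≠ Γ z.1 + Γ (mix I j z.1 z.2)) ≤ ε) →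
      (∀ j ∈ S \ A, (prob fun z : (L → ZMod 2) × (L → ZMod 2) =>
        Γ (mix I j z.1 z.2) ≠ Γ z.1) ≤ ε) →
      ∃ p : (L → ZMod 2) → W, (prob fun y => Γ y ≠ p y) ≤ C * ε ∧ IsBlockForm I f A p := by
  have base : ∀ {ι : Type} [DecidableEq ι] {L : Type} [Fintype L] [DecidableEq L]
      {E : ι → Type} [∀ i, AddCommGroup (E i)] {W : Type} [AddCommGroup W] [Module (ZMod 2) W]
      {I : L → Finset ι} {S : Finset ι} {f : L → (∀ i, E i) → ZMod 2}
      (Γ : (L → ZMod 2) → W) {ε : ℝ}, S.card = s → (∀ l, (I l).Nonempty ∧ I l ⊆ S) →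
      (∀ j ∈ S \ ∅, (prob fun z : (L → ZMod 2) × (L → ZMod 2) =>
        Γ (mix I j z.1 z.2) ≠ Γ z.1) ≤ ε) →
      ∃ p : (L → ZMod 2) → W, (prob fun y => Γ y ≠ p y) ≤ s * ε ∧ IsBlockForm I f ∅ p := by
    intro ι _ L _ _ E _ W _ _ I S f Γ ε hS hI hinv
    obtain ⟨w, hw⟩ := exists_const_of_inv_tests hI Γ (by simpa using hinv)
    exact ⟨fun _ => w, hS ▸ hw, IsForm.const w, fun h => absurd h not_nonempty_empty⟩
  induction n with
  | zero =>
    refine ⟨s, by positivity, ?_⟩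
    intro ι _ L _ _ E _ W _ _ I S A f Γ ε _ hS hA _ hI _ _ hinv
    obtain rfl : A = ∅ := card_eq_zero.1 (Nat.le_zero.1 hA)
    exact base Γ hS hI hinv
  | succ n ih =>
    obtain ⟨C, hC0, hC⟩ := ih
    refine ⟨12 + 2 ^ s * (C * 74) + s * 74 + s, by positivity, ?_⟩
    intro ι _ L _ _ E _ W _ _ I S A f Γ ε hε hS hA hAS hI hf hlin hinv
    rcases A.eq_empty_or_nonempty with rfl | ⟨i, hi⟩
    · obtain ⟨p, hp, hp'⟩ := base (f := f) Γ hS hI hinv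
      refine ⟨p, hp.trans ?_, hp'⟩
      gcongr
      have : 0 ≤ 2 ^ s * (C * 74) := by positivity
      have : (0 : ℝ) ≤ s * 74 := by positivity
      linarith
    classical
    obtain ⟨γ, hclose, hγ0, hγmix, hγlin, hγinv⟩ := exists_coeff_of_tests hi Γ hlin hinv
    -- the coefficients with a given `I l = J` approximately form a form on `A \ J`
    have hJ : ∀ J : Finset ι, ∃ p : (L → ZMod 2) → L → W, i ∈ J → J ⊆ A →
        (prob fun y => (fun l => if I l = J then γ y l else 0) ≠ p y) ≤ C * (74 * ε) ∧
          IsBlockForm I f (A \ J) p := by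
      intro J
      by_cases hJ : i ∈ J ∧ J ⊆ A
      swap
      · exact ⟨0, fun h1 h2 => absurd ⟨h1, h2⟩ hJ⟩
      obtain ⟨hiJ, hJA⟩ := hJ
      suffices h : ∃ p : (L → ZMod 2) → L → W,
          (prob fun y => (fun l => if I l = J then γ y l else 0) ≠ p y) ≤ C * (74 * ε) ∧
          IsBlockForm I f (A \ J) p from h.imp fun p hp _ _ => hp
      refine hC (S := S) (A := A \ J) (I := I) (f := f)
        (fun y l => if I l = J then γ y l else 0) (ε := 74 * ε) (by positivity) hS ?_
        (sdiff_subset.trans hAS) hI hf ?_ ?_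
      · have : (A \ J).card < A.card := card_lt_card
          ⟨sdiff_subset, fun h => (mem_sdiff.1 (h hi)).2 hiJ⟩
        omega
      · intro j hj
        obtain ⟨hjA, hjJ⟩ := mem_sdiff.1 hj
        refine (prob_mono fun z hz => ?_).trans
          (hγlin j hjA (by rintro rfl; exact hjJ hiJ))
        intro hc
        refine hz (funext fun l => ?_)
        simp only [Pi.add_apply]
        split_ifs with hl
        · exact (hc l).2 (hl ▸ hjJ)
        · rw [add_zero]
      · intro j hj
        obtain ⟨hjS, hj⟩ := mem_sdiff.1 hj
        by_cases hji : j = i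
        · subst hji
          refine (prob_mono (q := fun _ => False) fun z hz => hz ?_).trans
            (by rw [prob_false]; positivity)
          simp only [hγmix]
        by_cases hjA : j ∈ A
        · have hjJ : j ∈ J := by
            by_contra h; exact hj (mem_sdiff.2 ⟨hjA, h⟩)
          refine (prob_mono fun z hz => ?_).trans (hγlin j hjA hji)
          intro hc
          refine hz (funext fun l => ?_)
          split_ifs with hl
          · exact (hc l).1 (hl ▸ hjJ)
          · rfl
        · refine (prob_mono fun z hz => ?_).trans (hγinv j (mem_sdiff.2 ⟨hjS, hjA⟩))
          intro hc
          refine hz (funext fun l => ?_)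
          split_ifs with hl
          · by_cases hjl : j ∈ I l
            · rw [((hc l).1 hjl).1, ((hc l).1 hjl).2]
            · exact (hc l).2 hjl
          · rfl
    choose P hP using hJ
    set q : L → (L → ZMod 2) → W :=
      fun l y => if i ∈ I l ∧ I l ⊆ A then P (I l) y l else 0 with hq
    have hqform : ∀ l, (I l ⊆ A ∧ IsForm (A \ I l) fun u => q l fun l => f l u) ∨ q l = 0 := by
      intro l
      by_cases hl : i ∈ I l ∧ I l ⊆ A
      · refine Or.inl ⟨hl.2, ?_⟩
        simp only [hq, hl, true_and, if_true]
        exact (hP (I l) hl.1 hl.2).2.isForm.comp_eval l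
      · exact Or.inr (funext fun y => by simp only [hq, hl, if_false]; rfl)
    refine ⟨fun y => ∑ l, y l • q l y, ?_, ?_, fun _ => ⟨q, fun _ => rfl, hqform⟩⟩
    · have hT : ∀ j ∈ S \ A, (prob fun y : L → ZMod 2 => ∃ l, j ∈ I l ∧ γ y l ≠ 0) ≤ 74 * ε := by
        intro j hj
        rw [← prob_fst (β := L → ZMod 2)]
        refine (prob_mono fun z hz => ?_).trans (hγinv j hj)
        obtain ⟨l, hl, hne⟩ := hz
        exact fun hc => hne ((hc l).1 hl).1
      calc _ ≤ (prob fun y => Γ y ≠ ∑ l, y l • γ y l) +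
            ((prob fun y => ∃ J ∈ S.powerset.filter fun J => i ∈ J ∧ J ⊆ A,
              (fun l => if I l = J then γ y l else 0) ≠ P J y) +
            prob fun y => ∃ j ∈ S \ A, ∃ l, j ∈ I l ∧ γ y l ≠ 0) := by
            refine (prob_mono fun y hy => ?_).trans ((prob_or_le _ _).trans
              (add_le_add le_rfl (prob_or_le _ _)))
            by_contra! hc
            refine hy (hc.1.trans (sum_congr rfl fun l _ => ?_))
            congr 1
            by_cases hl : i ∈ I l ∧ I l ⊆ A
            · have := congrFun (hc.2.1 (I l) (by simp [hl, (hI l).2])) l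
              simpa only [hq, hl, true_and, if_true] using this
            · simp only [hq, hl, if_false]
              by_cases hil : i ∈ I l
              · obtain ⟨j, hjl, hjA⟩ := not_subset.1 fun h => hl ⟨hil, h⟩
                exact hc.2.2 j (mem_sdiff.2 ⟨(hI l).2 hjl, hjA⟩) l hjl
              · exact hγ0 y l hil
        _ ≤ 12 * ε + (2 ^ s * (C * (74 * ε)) + s * (74 * ε)) := by
            gcongr
            · refine (prob_exists_le _ _).trans ((sum_le_card_nsmul _ _ (C * (74 * ε))
                fun J hJ => ?_).trans ?_)
              · obtain ⟨-, h1, h2⟩ := mem_filter.1 hJ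
                exact (hP J h1 h2).1
              · rw [nsmul_eq_mul]
                gcongr
                refine (Nat.cast_le.2 (card_filter_le _ _)).trans ?_
                rw [card_powerset, hS]; push_cast; rfl
            · refine (prob_exists_le _ _).trans ((sum_le_card_nsmul _ _ (74 * ε)
                fun j hj => hT j hj).trans ?_)
              rw [nsmul_eq_mul]
              gcongr
              exact (card_le_card sdiff_subset).trans hS.le
        _ ≤ _ := by
            have : 0 ≤ (s : ℝ) * ε := by positivity
            linarith
    · refine IsForm.sum _ fun l _ => ?_
      rcases hqform l with ⟨h1, h2⟩ | h
      · exact ((hf l).smul h2 disjoint_sdiff).of_eq (union_sdiff_of_subset h1)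
      · simp only [h, Pi.zero_apply, smul_zero]
        exact IsForm.zero

/-! ### Spaces of forms of bounded partition rank -/

section FormSpan

variable {ι : Type} [DecidableEq ι] {E : ι → Type} [∀ i, AddCommGroup (E i)]

/-- The space of the sums of products `φ ψ` with `(I, φ) ∈ G` and `ψ` a form on `S \ I`. For a set
`G` of forms `φ` on non-empty `I ⊆ S` this is the space `∑_I V_I ⊗ 𝔽₂^{S \ I}`, where `V_I` is
spanned by the `φ` with `(I, φ) ∈ G`. -/
def formSpan (S : Finset ι) (G : Finset (Finset ι × ((∀ i, E i) → ZMod 2))) :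
    Submodule (ZMod 2) ((∀ i, E i) → ZMod 2) where
  carrier := {θ | ∃ ψ : Finset ι × ((∀ i, E i) → ZMod 2) → (∀ i, E i) → ZMod 2,
    (∀ p ∈ G, IsForm (S \ p.1) (ψ p)) ∧ θ = ∑ p ∈ G, p.2 * ψ p}
  add_mem' := by
    rintro _ _ ⟨ψ, hψ, rfl⟩ ⟨ψ', hψ', rfl⟩
    exact ⟨ψ + ψ', fun p hp => (hψ p hp).add' (hψ' p hp), by
      simp only [Pi.add_apply, mul_add, sum_add_distrib]⟩
  zero_mem' := ⟨0, fun _ _ => IsForm.zero, by simp⟩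
  smul_mem' := by
    rintro c _ ⟨ψ, hψ, rfl⟩
    rcases zmod_two_cases c with rfl | rfl
    · exact ⟨0, fun _ _ => IsForm.zero, by simp⟩
    · exact ⟨ψ, hψ, by simp⟩

/-- `G` consists of forms on non-empty subsets of `S`. -/
def IsValid (S : Finset ι) (G : Finset (Finset ι × ((∀ i, E i) → ZMod 2))) : Prop :=
  ∀ p ∈ G, p.1.Nonempty ∧ p.1 ⊆ S ∧ IsForm p.1 p.2

variable {S : Finset ι} {G G' : Finset (Finset ι × ((∀ i, E i) → ZMod 2))}

theorem mul_mem_formSpan {I : Finset ι} {φ ψ : (∀ i, E i) → ZMod 2} (h : (I, φ) ∈ G)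
    (hψ : IsForm (S \ I) ψ) : φ * ψ ∈ formSpan S G := by
  classical
  refine ⟨fun p => if p = (I, φ) then ψ else 0, fun p _ => ?_, ?_⟩
  · by_cases hp : p = (I, φ)
    · subst hp; simpa using hψ
    · simpa [hp] using IsForm.zero
  · rw [sum_eq_single_of_mem _ h fun p _ hp => by simp [hp]]
    simp

theorem formSpan_mono (h : G ⊆ G') : formSpan S G ≤ formSpan S G' := by
  rintro _ ⟨ψ, hψ, rfl⟩
  exact Submodule.sum_mem _ fun p hp => mul_mem_formSpan (h hp) (hψ p hp)

theorem eq_zero_of_mem_formSpan {θ : (∀ i, E i) → ZMod 2} (h : θ ∈ formSpan S G) {u : ∀ i, E i}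
    (hu : ∀ p ∈ G, p.2 u = 0) : θ u = 0 := by
  obtain ⟨ψ, hψ, rfl⟩ := h
  rw [Finset.sum_apply]
  exact sum_eq_zero fun p hp => by simp [hu p hp]

end FormSpan

/-! ### Forms close to a function of a regular family -/

section RegularFamily

theorem expect_sgn_sum_eq_zero {L : Type*} [Fintype L] [DecidableEq L] {T : Finset L}
    (hT : T.Nonempty) : 𝔼 z : L → ZMod 2, sgn (∑ l ∈ T, z l) = 0 := by
  obtain ⟨l, hl⟩ := hT
  exact expect_sgn_addHom (fun z : L → ZMod 2 => ∑ l ∈ T, z l)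
    (fun _ _ => by simp [sum_add_distrib])
    ⟨Pi.single l 1, by rw [sum_pi_single' l, if_pos hl]; simp⟩

variable {ι : Type} [DecidableEq ι] [Fintype ι] {E : ι → Type} [∀ i, AddCommGroup (E i)]
  [∀ i, Fintype (E i)]

theorem prob_update_prod (e : ι) (p : (∀ i, E i) → Prop) :
    (prob fun z : (∀ i, E i) × E e => p (update z.1 e z.2)) = prob p := by
  rw [prob_prod, ← prob_update]

theorem prob_update_add_prod (e : ι) (p : (∀ i, E i) → Prop) :
    (prob fun z : (∀ i, E i) × E e => p (update z.1 e (z.1 e + z.2))) = prob p := by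
  rw [prob_prod, prob_update e]
  exact expect_congr rfl fun u _ => prob_translate_left (fun v => p (update u e v)) _

variable {L : Type} [Fintype L] [DecidableEq L] {I : L → Finset ι}
  {f : L → (∀ i, E i) → ZMod 2} {d : ℕ} {κ τ : ℝ}

/-- If a form is close to a function of the values of a regular family of forms, then this function
passes the linearity tests. -/
theorem Regular.prob_test_le (hreg : Regular κ I f) (hf : ∀ l, IsForm (I l) (f l))
    (hI : ∀ l, (I l).Nonempty) (hd : ∀ l, (I l).card ≤ d) (hτ : 0 ≤ τ) (hκ : κ ≤ τ ^ 2 ^ d)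
    {S : Finset ι} {r : (∀ i, E i) → ZMod 2} (hr : IsForm S r) {Γ : (L → ZMod 2) → ZMod 2} {η : ℝ}
    (hΓ : (prob fun u => r u ≠ Γ fun l => f l u) ≤ η) {e : ι} (he : e ∈ S) :
    (prob fun z : (L → ZMod 2) × (L → ZMod 2) =>
      Γ (addMix I e z.1 z.2) ≠ Γ z.1 + Γ (mix I e z.1 z.2)) ≤
      3 * η + 4 ^ Fintype.card L * τ := by
  classical
  set F : (∀ i, E i) → L → ZMod 2 := fun u l => f l u with hF
  -- the bits of the second vector outside the block of `e` are irrelevant, and resampled freely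
  have h := abs_prob_comp_pair_sub_le (Ω := ((∀ i, E i) × E e) × (L → ZMod 2)) (K := L)
    (fun ω => F ω.1.1) (fun ω => mix I e ω.2 (F (update ω.1.1 e ω.1.2))) hτ
    (fun T T' hT => by
      simp only [expect_prod_type]
      by_cases hT' : ∀ l ∈ T', e ∈ I l
      · have h1 : ∀ u (w : E e) (z : L → ZMod 2),
            sgn (∑ l ∈ T, F u l + ∑ l ∈ T', mix I e z (F (update u e w)) l) =
              sgn (∑ l ∈ T, f l u + ∑ l ∈ T', f l (update u e w)) := by
          intro u w z
          congr 2
          exact sum_congr rfl fun l hl => by simp [mix, hT' l hl, hF]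
        simp only [h1, Fintype.expect_const]
        exact hreg.abs_expect_pair_le hf hI hd hτ hκ e T T' hT' hT
      · have h1 : ∀ u (w : E e), 𝔼 z : L → ZMod 2,
            sgn (∑ l ∈ T, F u l + ∑ l ∈ T', mix I e z (F (update u e w)) l) = 0 := by
          intro u w
          have h2 : ∀ z : L → ZMod 2,
              sgn (∑ l ∈ T, F u l + ∑ l ∈ T', mix I e z (F (update u e w)) l) =
              sgn (∑ l ∈ T, F u l + ∑ l ∈ T' with e ∈ I l, F (update u e w) l) *
                sgn (∑ l ∈ T' with ¬ e ∈ I l, z l) := by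
            intro z
            rw [← sgn_add, add_assoc]
            congr 2
            rw [← sum_filter_add_sum_filter_not T' fun l => e ∈ I l]
            congr 1
            · exact sum_congr rfl fun l hl => by simp [mix, (mem_filter.1 hl).2]
            · exact sum_congr rfl fun l hl => by simp [mix, (mem_filter.1 hl).2]
          simp only [h2]
          rw [← mul_expect, expect_sgn_sum_eq_zero, mul_zero]
          push Not at hT'
          obtain ⟨l, hl, hl'⟩ := hT'
          exact ⟨l, mem_filter.2 ⟨hl, hl'⟩⟩
        simp only [h1, expect_const_zero, abs_zero]
        exact hτ)
    (fun z => Γ (addMix I e z.1 z.2) ≠ Γ z.1 + Γ (mix I e z.1 z.2))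
  have h3 : (prob fun ω : ((∀ i, E i) × E e) × (L → ZMod 2) =>
      Γ (addMix I e (F ω.1.1) (mix I e ω.2 (F (update ω.1.1 e ω.1.2)))) ≠
        Γ (F ω.1.1) + Γ (mix I e (F ω.1.1) (mix I e ω.2 (F (update ω.1.1 e ω.1.2))))) ≤
      3 * η := by
    have hadd : ∀ u (w : E e) z, addMix I e (F u) (mix I e z (F (update u e w))) =
        F (update u e (u e + w)) := by
      intro u w z
      ext l
      simp only [addMix, mix, hF]
      split_ifs with hl
      · rw [(hf l).add e hl, update_eq_self]
      · rw [(hf l).update_of_notMem hl]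
    have hmix : ∀ u (w : E e) z, mix I e (F u) (mix I e z (F (update u e w))) =
        F (update u e w) := by
      intro u w z
      ext l
      simp only [mix, hF]
      split_ifs with hl
      · rfl
      · rw [(hf l).update_of_notMem hl]
    simp only [hadd, hmix]
    rw [prob_fst (β := L → ZMod 2) fun ω : (∀ i, E i) × E e =>
      Γ (F (update ω.1 e (ω.1 e + ω.2))) ≠ Γ (F ω.1) + Γ (F (update ω.1 e ω.2))]
    calc _ ≤ (prob fun z : (∀ i, E i) × E e =>
            r (update z.1 e (z.1 e + z.2)) ≠ Γ (F (update z.1 e (z.1 e + z.2)))) +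
          ((prob fun z : (∀ i, E i) × E e => r z.1 ≠ Γ (F z.1)) +
          prob fun z : (∀ i, E i) × E e => r (update z.1 e z.2) ≠ Γ (F (update z.1 e z.2))) := by
          refine (prob_mono fun z hz => ?_).trans ((prob_or_le _ _).trans
            (add_le_add le_rfl (prob_or_le _ _)))
          by_contra! hc
          rw [← hc.1, ← hc.2.1, ← hc.2.2, hr.add e he, update_eq_self] at hz
          exact hz rfl
      _ ≤ η + (η + η) := by
          rw [prob_update_add_prod e fun u => r u ≠ Γ (F u),
            prob_update_prod e fun u => r u ≠ Γ (F u), prob_fst fun u => r u ≠ Γ (F u)]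
          exact add_le_add hΓ (add_le_add hΓ hΓ)
      _ = 3 * η := by ring
  have h4 := (abs_le.1 h).1
  linarith

/-- The values of a regular family are equidistributed: an event that depends on them is hardly more
likely than for uniform bits. -/
theorem Regular.prob_comp_le (hreg : Regular κ I f) (hf : ∀ l, IsForm (I l) (f l))
    (hI : ∀ l, (I l).Nonempty) (hd : ∀ l, (I l).card ≤ d) (hτ : 0 ≤ τ) (hκ : κ ≤ τ ^ 2 ^ d)
    (p : (L → ZMod 2) → Prop) :
    (prob fun u => p fun l => f l u) ≤ prob p + 2 ^ Fintype.card L * τ := by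
  have h := abs_prob_comp_sub_le (fun (u : ∀ i, E i) (l : L) => f l u) hτ (fun T hT => by
    obtain ⟨l₀, hl₀, hmax⟩ := exists_max_image T (fun l => (I l).card) hT
    have := hreg.abs_expect_le hf hI hd hτ hκ T l₀ hl₀ hmax (∅ : Finset L) (fun _ _ => 0) (by simp)
    simpa using this) p
  linarith [(abs_le.1 h).2]

/-- There is an accuracy, depending only on `|S|`, such that a form on `S` that is that close to a
function `Γ` of a regular family of forms on proper subsets is a combination of the family. The
function `Γ` passes the linearity tests, so it is close to a multilinear function of the bits, and
the values of this function at the family make a form that agrees with the given one too often to be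
different from it. -/
theorem exists_accuracy (d : ℕ) : ∃ η : ℝ, 0 < η ∧
    ∀ {ι : Type} [DecidableEq ι] [Fintype ι] {E : ι → Type} [∀ i, AddCommGroup (E i)]
      [∀ i, Fintype (E i)] {L : Type} [Fintype L] [DecidableEq L] {I : L → Finset ι}
      {f : L → (∀ i, E i) → ZMod 2} {S : Finset ι} {r : (∀ i, E i) → ZMod 2}
      (Γ : (L → ZMod 2) → ZMod 2), S.Nonempty → S.card = d → IsForm S r →
      (∀ l, (I l).Nonempty ∧ I l ⊂ S) → (∀ l, IsForm (I l) (f l)) →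
      Regular ((η / 4 ^ Fintype.card L) ^ 2 ^ d) I f →
      (prob fun u => r u ≠ Γ fun l => f l u) ≤ η →
      r ∈ formSpan S (univ.image fun l => (I l, f l)) := by
  obtain ⟨C, hC0, hC⟩ := exists_isBlockForm d d
  -- two forms on `S` that differ with probability at most `η + (C * (4 * η) + η) < 2⁻¹ ^ d` agree
  refine ⟨(2⁻¹) ^ d / (4 * C + 3), by positivity, ?_⟩
  intro ι _ _ E _ _ L _ _ I f S r Γ hSne hS hr hI hf hreg hΓ
  set η : ℝ := (2⁻¹) ^ d / (4 * C + 3) with hη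
  have hη0 : 0 < η := by positivity
  set τ : ℝ := η / 4 ^ Fintype.card L with hτ
  have hτ0 : 0 ≤ τ := by positivity
  have h4τ : 4 ^ Fintype.card L * τ = η := by rw [hτ]; field_simp
  have h2τ : 2 ^ Fintype.card L * τ ≤ η := by
    rw [← h4τ]; gcongr; norm_num
  have hcard : ∀ l, (I l).card ≤ d := fun l => hS ▸ card_le_card (hI l).2.subset
  have hI' : ∀ l, (I l).Nonempty := fun l => (hI l).1
  obtain ⟨p, hp, hpform⟩ := hC (I := I) (S := S) (A := S) (f := f) Γ (ε := 4 * η) (by positivity) hS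
    hS.le subset_rfl (fun l => ⟨(hI l).1, (hI l).2.subset⟩) hf
    (fun j hj => (hreg.prob_test_le hf hI' hcard hτ0 le_rfl hr hΓ hj).trans (by linarith))
    (by simp)
  have hrp : r = fun u => p fun l => f l u := by
    by_contra hne
    have h1 : IsForm S (r + fun u => p fun l => f l u) := hr.add' hpform.isForm
    have h2 := h1.prob_ne_zero (fun h => hne (funext fun u => add_eq_zero_two.1 (congrFun h u)))
    have h3 : (prob fun u => (r + fun u => p fun l => f l u) u ≠ 0) ≤
        η + (C * (4 * η) + η) := by
      refine (prob_mono fun u hu => ?_).trans ((prob_or_le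
        (fun u => r u ≠ Γ fun l => f l u) (fun u => (Γ fun l => f l u) ≠ p fun l => f l u)).trans
        (add_le_add hΓ ((hreg.prob_comp_le hf hI' hcard hτ0 le_rfl fun y => Γ y ≠ p y).trans
          (add_le_add hp h2τ))))
      by_contra! hc
      exact hu (add_eq_zero_two.2 (hc.1.trans hc.2))
    have h4 : η * (4 * C + 3) = (2⁻¹ : ℝ) ^ d := by rw [hη]; field_simp
    rw [hS] at h2
    linarith
  obtain ⟨q, hpq, hq⟩ := hpform.decomp hSne
  have : r = ∑ l, f l * fun u => q l fun l => f l u := by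
    rw [hrp]; funext u
    rw [hpq, Finset.sum_apply]
    rfl
  rw [this]
  refine Submodule.sum_mem _ fun l _ => ?_
  refine mul_mem_formSpan (mem_image_of_mem _ (mem_univ l)) ?_
  rcases hq l with h | h
  · exact h.2
  · rw [h]; exact IsForm.zero

end RegularFamily

/-! ### Biased forms have bounded partition rank -/

section BiasRank

variable {ι : Type} [DecidableEq ι] [Fintype ι] {E : ι → Type} [∀ i, AddCommGroup (E i)]
  [∀ i, Fintype (E i)]

omit [Fintype ι] [∀ i, Fintype (E i)] in
/-- The expansion of a form in its coordinates in `s` at a sum of two points. -/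
theorem IsForm.piecewise_add {S : Finset ι} {r : (∀ i, E i) → ZMod 2} (hr : IsForm S r)
    {s : Finset ι} (hs : s ⊆ S) (u a w : ∀ i, E i) :
    r (s.piecewise (u + a) w) = ∑ J ∈ s.powerset, r (J.piecewise u (s.piecewise a w)) := by
  induction s using Finset.induction_on generalizing w with
  | empty => simp
  | insert e s he ih =>
    have ih := ih ((subset_insert _ _).trans hs)
    rw [sum_powerset_insert he, piecewise_insert, Pi.add_apply,
      hr.add e (hs (mem_insert_self _ _)), add_comm]
    simp only [update_piecewise_of_notMem _ _ _ he, ih]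
    congr 1
    · refine sum_congr rfl fun J _ => ?_
      rw [piecewise_insert, update_piecewise_of_notMem _ _ _ he]
    · refine sum_congr rfl fun J hJ => congrArg r ?_
      have heJ : e ∉ J := fun h => he (mem_powerset.1 hJ h)
      funext i
      by_cases hie : i = e
      · subst hie; simp [heJ, he]
      · simp [Finset.piecewise, hie]

omit [Fintype ι] [∀ i, Fintype (E i)] in
/-- The expansion of a form at a sum of two points. -/
theorem IsForm.apply_add {S : Finset ι} {r : (∀ i, E i) → ZMod 2} (hr : IsForm S r)
    (u a : ∀ i, E i) : r (u + a) = ∑ J ∈ S.powerset, r (J.piecewise u a) := by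
  have h := hr.piecewise_add subset_rfl u a a
  rw [piecewise_same] at h
  rw [← h]
  exact hr.dep _ _ fun i hi => by simp [hi]

omit [Fintype ι] [∀ i, Fintype (E i)] in
theorem IsForm.piecewise {S J : Finset ι} {r : (∀ i, E i) → ZMod 2} (hr : IsForm S r)
    (hJ : J ⊆ S) (a : ∀ i, E i) : IsForm J fun u => r (J.piecewise u a) := by
  refine ⟨fun u v h => congrArg r (by
    funext i; by_cases hi : i ∈ J <;> simp [hi, h i]), fun i hi u x y => ?_⟩
  simp only [← update_piecewise_of_mem _ _ _ hi]
  exact hr.add i (hJ hi) _ x y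

/-- For suitable translates, chosen one after the other, the sum of `(-1)^{r(u + a_j)}` is positive
for most `u`, by a second moment estimate. -/
theorem exists_translates {V : Type*} [AddCommGroup V] [Fintype V] (r : V → ZMod 2) {b : ℝ}
    (hb : b = 𝔼 v, sgn (r v)) (hb0 : 0 < b) (t : ℕ) (ht : 0 < t) :
    ∃ a : Fin t → V, (prob fun u => ∑ j, sgn (r (u + a j)) ≤ 0) ≤ 1 / (t * b ^ 2) := by
  have key : ∀ t : ℕ, ∃ a : Fin t → V, 𝔼 u, (∑ j, (sgn (r (u + a j)) - b)) ^ 2 ≤ t := by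
    intro t
    induction t with
    | zero => exact ⟨Fin.elim0, by simp⟩
    | succ t ih =>
      obtain ⟨a, ha⟩ := ih
      set s : V → ℝ := fun u => ∑ j, (sgn (r (u + a j)) - b) with hs
      have h1 : ∀ u, 𝔼 x, (s u + (sgn (r (u + x)) - b)) ^ 2 ≤ s u ^ 2 + 1 := by
        intro u
        have h2 : ∀ x, (s u + (sgn (r (u + x)) - b)) ^ 2 =
            (s u - b) ^ 2 + 1 + 2 * (s u - b) * sgn (r (u + x)) := fun x => by
          linear_combination sgn_mul_self (r (u + x))
        have h3 : 𝔼 x, sgn (r (u + x)) = b := by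
          rw [hb]
          exact Fintype.expect_equiv (Equiv.addLeft u) _ _ fun _ => rfl
        simp only [h2]
        rw [expect_add_distrib, Fintype.expect_const, ← mul_expect, h3]
        nlinarith [sq_nonneg b]
      obtain ⟨x, hx⟩ := exists_of_expect_le (f := fun x => 𝔼 u, (s u + (sgn (r (u + x)) - b)) ^ 2)
        (c := t + 1) (by
          rw [expect_comm]
          refine (expect_le_expect fun u _ => h1 u).trans ?_
          rw [expect_add_distrib, Fintype.expect_const]
          linarith)
      refine ⟨Fin.snoc a x, ?_⟩
      simp only [Fin.sum_univ_castSucc, Fin.snoc_castSucc, Fin.snoc_last]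
      push_cast
      exact hx
  obtain ⟨a, ha⟩ := key t
  refine ⟨a, ?_⟩
  have h1 := (mul_prob_le_expect (fun u => (∑ j, (sgn (r (u + a j)) - b)) ^ 2)
    (fun _ => sq_nonneg _) ((t * b) ^ 2)).trans ha
  have h2 : (prob fun u => ∑ j, sgn (r (u + a j)) ≤ 0) ≤
      prob fun u => (t * b) ^ 2 ≤ (∑ j, (sgn (r (u + a j)) - b)) ^ 2 := by
    refine prob_mono fun u hu => ?_
    rw [sum_sub_distrib, sum_const, card_univ, Fintype.card_fin, nsmul_eq_mul]
    have : 0 ≤ t * b := by positivity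
    nlinarith
  refine h2.trans ?_
  have ht' : (0 : ℝ) < t := by exact_mod_cast ht
  rw [le_div_iff₀ (by positivity)]
  have : (t : ℝ) * ((prob fun u => (t * b) ^ 2 ≤ (∑ j, (sgn (r (u + a j)) - b)) ^ 2) *
      (t * b ^ 2)) ≤ t * 1 := by nlinarith
  exact le_of_mul_le_mul_left this ht'

/-- A biased form is close to a function of boundedly many forms on proper subsets of its
coordinates. For most `u` the sign of `r u` is determined by the majority of the values `r (u + a_j)
- r u`, and by multilinearity these are sums of values at `u` of such forms. -/
theorem IsForm.exists_approx {S : Finset ι} {r : (∀ i, E i) → ZMod 2} (hr : IsForm S r)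
    (hS : S.Nonempty) {ε : ℝ} (hε : 0 < ε) (hb : ε ≤ bias r) {t : ℕ} (ht : 0 < t) :
    ∃ (L : Type) (_ : Fintype L) (_ : DecidableEq L) (I : L → Finset ι)
      (f : L → (∀ i, E i) → ZMod 2) (Γ : (L → ZMod 2) → ZMod 2),
      Fintype.card L ≤ 2 ^ S.card * t ∧ (∀ l, (I l).Nonempty ∧ I l ⊂ S) ∧
      (∀ l, IsForm (I l) (f l)) ∧ (prob fun u => r u ≠ Γ fun l => f l u) ≤ 1 / (t * ε ^ 2) := by
  classical
  obtain ⟨a, ha⟩ := exists_translates r (b := bias r) rfl (hε.trans_le hb) t ht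
  set P : Finset (Finset ι) := (S.powerset.erase S).erase ∅ with hP
  have hPmem : ∀ J ∈ P, J.Nonempty ∧ J ⊂ S := fun J hJ => by
    simp only [hP, mem_erase, mem_powerset] at hJ
    exact ⟨nonempty_iff_ne_empty.2 hJ.1, hJ.2.2.ssubset_of_ne hJ.2.1⟩
  have hexp : ∀ u x, r (u + x) = r u + (r x + ∑ J ∈ P, r (J.piecewise u x)) := by
    intro u x
    rw [hr.apply_add, ← add_sum_erase _ _ (mem_powerset_self S),
      ← add_sum_erase (S.powerset.erase S) _ (a := ∅) (by simp [hS.ne_empty.symm])]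
    congr 1
    exact hr.dep _ _ fun i hi => by simp [hi]
  refine ⟨P × Fin t, inferInstance, inferInstance, fun l => l.1, fun l u =>
    r ((l.1 : Finset ι).piecewise u (a l.2)),
    fun y => if 0 < ∑ j, sgn (r (a j) + ∑ J : P, y (J, j)) then 0 else 1, ?_,
    fun l => hPmem _ l.1.2, fun l => hr.piecewise (hPmem _ l.1.2).2.subset _, ?_⟩
  · rw [Fintype.card_prod, Fintype.card_coe, Fintype.card_fin]
    gcongr
    rw [← card_powerset]
    exact card_le_card ((erase_subset _ _).trans (erase_subset _ _))
  · refine (prob_mono fun u hu => ?_).trans (ha.trans ?_)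
    · by_contra! hc
      refine hu ?_
      simp only [hexp u, sgn_add (r u), ← mul_sum] at hc
      have h1 : ∀ j, ∑ J : P, r ((J : Finset ι).piecewise u (a j)) =
          ∑ J ∈ P, r (J.piecewise u (a j)) := fun j =>
        sum_coe_sort P fun J => r (J.piecewise u (a j))
      simp only [h1]
      rcases zmod_two_cases (r u) with h | h
      · rw [h, sgn_zero, one_mul] at hc
        rw [if_pos hc, h]
      · rw [h, sgn_one] at hc
        rw [if_neg (by linarith), h]
    · gcongr

/-- Every form on `d` coordinates of bias at least `ε` is a sum of `k` products of forms on proper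
subsets. -/
def BiasRank (d : ℕ) (ε : ℝ) (k : ℕ) : Prop :=
  ∀ {ι : Type} [DecidableEq ι] [Fintype ι] {E : ι → Type} [∀ i, AddCommGroup (E i)]
    [∀ i, Fintype (E i)] {S : Finset ι} {r : (∀ i, E i) → ZMod 2}, S.card = d → IsForm S r →
    ε ≤ bias r → ∃ G : Finset (Finset ι × ((∀ i, E i) → ZMod 2)),
      (∀ p ∈ G, p.1.Nonempty ∧ p.1 ⊂ S ∧ IsForm p.1 p.2) ∧ G.card ≤ k ∧ r ∈ formSpan S G

theorem BiasRank.mono {d : ℕ} {ε : ℝ} {k k' : ℕ} (h : BiasRank d ε k) (hk : k ≤ k') :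
    BiasRank d ε k' := fun hS hr hb => by
  obtain ⟨G, h1, h2, h3⟩ := h hS hr hb
  exact ⟨G, h1, h2.trans hk, h3⟩

omit [Fintype ι] [∀ i, Fintype (E i)] in
/-- If a sum of forms of a family, one of which is `f l₀`, is a combination of `G`, then `f l₀` can
be replaced by pairs of forms with fewer variables. The function `D` bounds the numbers of
variables. -/
theorem exists_replacement {L : Type} [Fintype L] [DecidableEq L] {I : L → Finset ι}
    {f : L → (∀ i, E i) → ZMod 2} (D : L → ℕ) {S : Finset ι} (Γ : (L → ZMod 2) → ZMod 2)
    (hI : ∀ l, (I l).Nonempty ∧ I l ⊂ S) (hD : ∀ l, (I l).card ≤ D l)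
    (hf : ∀ l, IsForm (I l) (f l)) {T : Finset L} {l₀ : L} (hl₀ : l₀ ∈ T)
    {G : Finset (Finset ι × ((∀ i, E i) → ZMod 2))}
    (hG : ∀ p ∈ G, p.1.Nonempty ∧ p.1 ⊂ I l₀ ∧ IsForm p.1 p.2)
    (hfG : (fun u => ∑ l ∈ T, f l u) ∈ formSpan (I l₀) G) :
    ∃ (L' : Type) (_ : Fintype L') (_ : DecidableEq L') (I' : L' → Finset ι)
      (f' : L' → (∀ i, E i) → ZMod 2) (D' : L' → ℕ) (Γ' : (L' → ZMod 2) → ZMod 2),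
      (∀ l, (I' l).Nonempty ∧ I' l ⊂ S) ∧ (∀ l, (I' l).card ≤ D' l) ∧
      (∀ l, IsForm (I' l) (f' l)) ∧ (∀ u, (Γ' fun l => f' l u) = Γ fun l => f l u) ∧
      ∑ l, ({D' l} : Multiset ℕ) + {D l₀} =
        ∑ l, ({D l} : Multiset ℕ) + Multiset.replicate (2 * G.card) (D l₀ - 1) := by
  classical
  obtain ⟨ψ, hψ, hsum⟩ := hfG
  have hlt : ∀ J, J ⊂ I l₀ → J.card ≤ D l₀ - 1 := fun J hJ => by
    have := card_lt_card hJ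
    have := hD l₀
    omega
  have hsd : ∀ p ∈ G, (I l₀ \ p.1).Nonempty ∧ I l₀ \ p.1 ⊂ I l₀ := fun p hp =>
    ⟨sdiff_nonempty.2 (hG p hp).2.1.2, sdiff_ssubset (hG p hp).2.1.1 (hG p hp).1⟩
  refine ⟨{l // l ≠ l₀} ⊕ (G ⊕ G), inferInstance, inferInstance,
    Sum.elim (fun l => I l) (Sum.elim (fun p => p.1.1) fun p => I l₀ \ p.1.1),
    Sum.elim (fun l => f l) (Sum.elim (fun p => p.1.2) fun p => ψ p),
    Sum.elim (fun l => D l) fun _ => D l₀ - 1,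
    fun y => Γ fun l => if h : l ≠ l₀ then y (Sum.inl ⟨l, h⟩) else
      ∑ l ∈ T.erase l₀, (if h : l ≠ l₀ then y (Sum.inl ⟨l, h⟩) else 0) +
        ∑ p : G, y (Sum.inr (Sum.inl p)) * y (Sum.inr (Sum.inr p)), ?_, ?_, ?_, ?_, ?_⟩
  · rintro (l | p | p)
    · exact hI l
    · exact ⟨(hG p p.2).1, (hG p p.2).2.1.trans (hI l₀).2⟩
    · exact ⟨(hsd p p.2).1, (hsd p p.2).2.trans (hI l₀).2⟩
  · rintro (l | p | p)
    · exact hD l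
    · exact hlt _ (hG p p.2).2.1
    · exact hlt _ (hsd p p.2).2
  · rintro (l | p | p)
    · exact hf l
    · exact (hG p p.2).2.2
    · exact hψ p p.2
  · intro u
    refine congrArg Γ (funext fun l => ?_)
    by_cases hl : l = l₀
    · subst hl
      have h1 := congrFun hsum u
      simp only [Finset.sum_apply, Pi.mul_apply] at h1
      rw [← add_sum_erase _ _ hl₀] at h1
      have h2 : ∑ p : G, p.1.2 u * ψ p u = ∑ p ∈ G, p.2 u * ψ p u :=
        sum_coe_sort G fun p => p.2 u * ψ p u
      have h3 : ∑ l' ∈ T.erase l, (if h : l' ≠ l then f l' u else 0) = ∑ l' ∈ T.erase l, f l' u :=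
        sum_congr rfl fun l' hl' => by simp [(mem_erase.1 hl').1]
      simp only [ne_eq, not_true_eq_false, Sum.elim_inl, Sum.elim_inr,
        dite_eq_ite, if_false] at h3 ⊢
      rw [h2, ← h1, h3]
      rw [add_comm (f l u), ← add_assoc, add_self_two, zero_add]
    · simp [hl]
  · rw [Fintype.sum_eq_add_sum_subtype_ne (fun l => ({D l} : Multiset ℕ)) l₀, Fintype.sum_sum_type]
    simp only [Sum.elim_inl, Sum.elim_inr, sum_const, card_univ, Fintype.card_sum, Fintype.card_coe,
      Multiset.nsmul_singleton, ← two_mul]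
    abel

/-- The regularisation of a family of forms that approximates `r`: while the family is not regular,
one of its forms is replaced by boundedly many forms with fewer variables, which decreases the
multiset of the numbers of variables in the Dershowitz–Manna order. -/
theorem exists_rank_of_approx (d : ℕ) (hd : 0 < d)
    (h : ∀ s < d, ∀ ε : ℝ, 0 < ε → ∃ k, BiasRank s ε k) :
    ∃ η : ℝ, 0 < η ∧ ∀ m : Multiset ℕ, ∃ k : ℕ,
    ∀ {ι : Type} [DecidableEq ι] [Fintype ι] {E : ι → Type} [∀ i, AddCommGroup (E i)]
      [∀ i, Fintype (E i)] {L : Type} [Fintype L] [DecidableEq L] {I : L → Finset ι}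
      {f : L → (∀ i, E i) → ZMod 2} (D : L → ℕ) {S : Finset ι} {r : (∀ i, E i) → ZMod 2}
      (Γ : (L → ZMod 2) → ZMod 2), S.card = d → IsForm S r →
      (∀ l, (I l).Nonempty ∧ I l ⊂ S) → (∀ l, (I l).card ≤ D l) → (∀ l, IsForm (I l) (f l)) →
      ∑ l, ({D l} : Multiset ℕ) ≤ m → (prob fun u => r u ≠ Γ fun l => f l u) ≤ η →
      ∃ G : Finset (Finset ι × ((∀ i, E i) → ZMod 2)),
        (∀ p ∈ G, p.1.Nonempty ∧ p.1 ⊂ S ∧ IsForm p.1 p.2) ∧ G.card ≤ k ∧ r ∈ formSpan S G := by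
  classical
  obtain ⟨η, hη0, hη⟩ := exists_accuracy d
  refine ⟨η, hη0, fun m => ?_⟩
  have wf : WellFounded (Multiset.IsDershowitzMannaLT : Multiset ℕ → Multiset ℕ → Prop) :=
    Multiset.wellFounded_isDershowitzMannaLT
  induction m using wf.induction with | _ m ih
  set κ : ℝ := (η / 4 ^ Multiset.card m) ^ 2 ^ d with hκ
  have hκ0 : 0 < κ := by positivity
  obtain ⟨K, hK⟩ : ∃ K, ∀ s < d, BiasRank s κ K := by
    choose! k hk using fun s hs => h s hs κ hκ0
    exact ⟨(range d).sup k, fun s hs => BiasRank.mono (@hk s hs) (le_sup (f := k) (mem_range.2 hs))⟩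
  set m' : ℕ → Multiset ℕ := fun s => m.erase s + Multiset.replicate (2 * K) (s - 1) with hm'
  have hlt : ∀ s, s ∈ m ∧ 0 < s → Multiset.IsDershowitzMannaLT (m' s) m := fun s hs =>
    ⟨m.erase s, Multiset.replicate (2 * K) (s - 1), {s}, by simp, rfl, by
      rw [add_comm, Multiset.singleton_add, Multiset.cons_erase hs.1], fun y hy =>
        ⟨s, by simp, by have := Multiset.eq_of_mem_replicate hy; omega⟩⟩
  choose! k hk using fun s hs => ih (m' s) (hlt s hs)
  refine ⟨max (Multiset.card m) (m.toFinset.sup k), ?_⟩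
  intro ι _ _ E _ _ L _ _ I f D S r Γ hS hr hI hD hf hm hΓ
  have hcard : Fintype.card L ≤ Multiset.card m := by
    have := Multiset.card_le_card hm
    simpa using this
  by_cases hreg : Regular ((η / 4 ^ Fintype.card L) ^ 2 ^ d) I f
  · refine ⟨univ.image fun l => (I l, f l), fun p hp => ?_, ?_, ?_⟩
    · obtain ⟨l, -, rfl⟩ := mem_image.1 hp
      exact ⟨(hI l).1, (hI l).2, hf l⟩
    · exact (card_image_le.trans hcard).trans (le_max_left _ _)
    · convert hη Γ (card_pos.1 (hS ▸ hd)) hS hr hI hf hreg hΓ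
  · unfold Regular at hreg
    push Not at hreg
    obtain ⟨T, J, ⟨l₀, hl₀⟩, hTJ, hbias⟩ := hreg
    have hJ : I l₀ = J := hTJ l₀ hl₀
    have hb : κ ≤ bias fun u => ∑ l ∈ T, f l u := by
      refine le_trans ?_ hbias.le
      rw [hκ]
      gcongr
      norm_num
    obtain ⟨G, hG, hGc, hfG⟩ := hK _ (hS ▸ card_lt_card (hI l₀).2) rfl
      (IsForm.sum T fun l hl => (hf l).of_eq ((hTJ l hl).trans hJ.symm)) hb
    obtain ⟨L', _, _, I', f', D', Γ', h1, h2, h3, h4, h5⟩ :=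
      exists_replacement D Γ hI hD hf hl₀ hG hfG
    have hDm : D l₀ ∈ m := Multiset.mem_of_le hm
      (Multiset.mem_of_le (single_le_sum_of_canonicallyOrdered (f := fun l => ({D l} : Multiset ℕ))
        (mem_univ l₀)) (Multiset.mem_singleton_self _))
    have hDpos : 0 < D l₀ := (hI l₀).1.card_pos.trans_le (hD l₀)
    obtain ⟨G₁, hG₁, hc, hmem⟩ := hk (D l₀) ⟨hDm, hDpos⟩ D' Γ' hS hr h1 h2 h3 (by
      rw [← add_le_add_iff_right ({D l₀} : Multiset ℕ), h5, hm']
      have : m.erase (D l₀) + Multiset.replicate (2 * K) (D l₀ - 1) + {D l₀} =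
          m + Multiset.replicate (2 * K) (D l₀ - 1) := by
        nth_rewrite 2 [← Multiset.cons_erase hDm]
        rw [← Multiset.singleton_add]
        abel
      simp only [this]
      gcongr)
      (by simpa only [h4] using hΓ)
    exact ⟨G₁, hG₁, hc.trans ((le_sup (f := k) (Multiset.mem_toFinset.2 hDm)).trans
      (le_max_right _ _)), hmem⟩

/-- Forms of large bias have bounded partition rank. By `IsForm.exists_approx` such a form is close
to a function of boundedly many forms with fewer variables, as close as `exists_rank_of_approx`
requires. -/
theorem exists_biasRank (d : ℕ) : ∀ ε : ℝ, 0 < ε → ∃ k, BiasRank d ε k := by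
  induction d using Nat.strong_induction_on with | _ d ih
  intro ε hε
  rcases Nat.eq_zero_or_pos d with rfl | hd
  · refine ⟨0, fun {ι _ _ E _ _ S r} hS hr hb => ⟨∅, by simp, by simp, ?_⟩⟩
    convert Submodule.zero_mem _
    rw [card_eq_zero] at hS
    subst hS
    funext u
    rcases zmod_two_cases (r u) with h | h
    · exact h
    · have h1 : bias r = -1 := by
        unfold bias
        rw [← Fintype.expect_const (ι := ∀ i, E i) (-1 : ℝ)]
        exact expect_congr rfl fun v _ => by rw [hr.dep v u (by simp), h, sgn_one]
      linarith
  · obtain ⟨η, hη, hk⟩ := exists_rank_of_approx d hd ih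
    obtain ⟨t, ht⟩ := exists_nat_gt (1 / (η * ε ^ 2))
    have ht0 : 0 < t := by
      have : (0 : ℝ) < t := lt_trans (by positivity) ht
      exact_mod_cast this
    obtain ⟨k, hk⟩ := hk (Multiset.replicate (2 ^ d * t) d)
    refine ⟨k, fun {ι _ _ E _ _ S r} hS hr hb => ?_⟩
    obtain ⟨L, _, _, I, f, Γ, h1, h2, h3, h4⟩ :=
      hr.exists_approx (card_pos.1 (hS ▸ hd)) hε hb ht0
    refine hk (fun _ => d) Γ hS hr h2 (fun l => hS ▸ card_le_card (h2 l).2.subset) h3 ?_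
      (h4.trans ?_)
    · simp only [sum_const, card_univ, Multiset.nsmul_singleton]
      exact (Multiset.replicate_le_replicate _).2 (hS ▸ h1)
    · rw [div_lt_iff₀ (by positivity)] at ht
      rw [div_le_iff₀ (by positivity)]
      linarith

end BiasRank

/-! ### Spaces of forms with many common zeros -/

section CommonZeros

/-- The family of groups `E`, with the group `W` added as one more coordinate. -/
abbrev OptionFamily {ι : Type} (W : Type) (E : ι → Type) : Option ι → Type
  | none => W
  | some i => E i

instance {ι : Type} {W : Type} [AddCommGroup W] {E : ι → Type} [∀ i, AddCommGroup (E i)] :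
    ∀ o, AddCommGroup (OptionFamily W E o)
  | none => inferInstanceAs (AddCommGroup W)
  | some i => inferInstanceAs (AddCommGroup (E i))

instance {ι : Type} {W : Type} [Fintype W] {E : ι → Type} [∀ i, Fintype (E i)] :
    ∀ o, Fintype (OptionFamily W E o)
  | none => inferInstanceAs (Fintype W)
  | some i => inferInstanceAs (Fintype (E i))

/-- The point with the additional coordinate `w` and the other coordinates given by `u`. -/
def optionPoint {ι : Type} {W : Type} {E : ι → Type} (w : W) (u : ∀ i, E i) :
    ∀ o, OptionFamily W E o
  | none => w
  | some i => u i

variable {ι : Type} [DecidableEq ι] {E : ι → Type} [∀ i, AddCommGroup (E i)] {W : Type}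
  [AddCommGroup W]

omit [∀ i, AddCommGroup (E i)] [AddCommGroup W] in
theorem update_optionPoint (w : W) (u : ∀ i, E i) (i : ι) (x : E i) :
    update (optionPoint w u) (some i) x = optionPoint w (update u i x) := by
  funext o
  rcases o with _ | j
  · rfl
  · by_cases h : j = i
    · subst h; simp [optionPoint]
    · rw [update_of_ne (by simpa using h)]
      simp [optionPoint, h]

theorem IsForm.optionPoint {J : Finset (Option ι)} {φ : (∀ o, OptionFamily W E o) → ZMod 2}
    (h : IsForm J φ) (w : W) : IsForm (eraseNone J) fun u => φ (optionPoint w u) := by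
  refine ⟨fun u v huv => h.dep _ _ ?_, fun i hi u x y => ?_⟩
  · rintro (_ | i) hi
    · rfl
    · exact huv i (mem_eraseNone.2 hi)
  · simp only [← update_optionPoint]
    exact h.add (some i) (mem_eraseNone.1 hi) _ x y

variable [Fintype ι] [∀ i, Fintype (E i)]

omit [DecidableEq ι] [∀ i, AddCommGroup (E i)] [AddCommGroup W] in
theorem expect_optionPoint [DecidableEq ι] [Fintype W] (F : (∀ o, OptionFamily W E o) → ℝ) :
    𝔼 u', F u' = 𝔼 u : ∀ i, E i, 𝔼 w : W, F (optionPoint w u) := by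
  rw [← expect_prod_type fun p : (∀ i, E i) × W => F (optionPoint p.2 p.1)]
  refine Fintype.expect_equiv ⟨fun u' => (fun i => u' (some i), u' none),
    fun p => optionPoint p.2 p.1, fun u' => ?_, fun p => rfl⟩ _ _ fun u' => congrArg F ?_
  all_goals
    funext o
    rcases o with _ | i <;> rfl

/-- A space of forms that often vanish simultaneously is contained in the space of combinations of
boundedly many forms. This is `exists_biasRank` for the evaluation form `(r, u) ↦ r u`, for which
the space itself is an additional coordinate. Its bias is the probability that all forms of the
space vanish at `u`. -/
theorem exists_formSpan_of_common_zeros (n : ℕ) {ε : ℝ} (hε : 0 < ε) : ∃ k : ℕ,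
    ∀ {ι : Type} [DecidableEq ι] [Fintype ι] {E : ι → Type} [∀ i, AddCommGroup (E i)]
      [∀ i, Fintype (E i)] {S : Finset ι} (R : Submodule (ZMod 2) ((∀ i, E i) → ZMod 2)),
      S.card = n → (∀ r ∈ R, IsForm S r) → (ε ≤ prob fun u => ∀ r ∈ R, r u = 0) →
      ∃ G, IsValid S G ∧ G.card ≤ k ∧ R ≤ formSpan S G := by
  classical
  obtain ⟨k, hk⟩ := exists_biasRank (n + 1) ε hε
  refine ⟨k, fun {ι _ _ E _ _ S} R hS hR hz => ?_⟩
  have : Fintype R := Fintype.ofFinite _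
  set θ : (∀ o, OptionFamily R E o) → ZMod 2 :=
    fun u' => (u' none : R).1 fun i => u' (some i) with hθ
  have hθu : ∀ (u' : ∀ o, OptionFamily R E o) (i : ι) (x : E i),
      (fun j => update u' (some i) x (some j)) = update (fun j => u' (some j)) i x := by
    intro u' i x
    funext j
    by_cases h : j = i
    · subst h; simp
    · rw [update_of_ne (by simpa using h), update_of_ne h]
  have hform : IsForm (insertNone S) θ := by
    refine ⟨fun u v huv => ?_, ?_⟩
    · simp only [hθ, huv none (by simp)]
      exact (hR _ (v none : R).2).dep _ _ fun i hi => huv (some i) (by simpa using hi)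
    · rintro (_ | i) hi u x y
      · rfl
      · simp only [hθ, hθu]
        exact (hR _ (u none : R).2).add i (by simpa using hi) _ x y
  have hbias : ε ≤ bias θ := by
    refine hz.trans ?_
    unfold bias
    rw [expect_optionPoint, prob_eq]
    refine expect_le_expect fun u _ => ?_
    split_ifs with h
    · have : ∀ w : R, sgn (θ (optionPoint w u)) = 1 := fun w => by
        simp only [hθ, optionPoint, h w.1 w.2, sgn_zero]
      simp [this]
    · exact expect_sgn_addHom_nonneg (fun w : R => θ (optionPoint w u)) fun _ _ => rfl
  obtain ⟨G, hG, hGk, ψ, hψ, hsum⟩ := hk (by simp [hS]) hform hbias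
  -- of the two factors of each product, the one that does not involve the additional coordinate
  set T : Finset (Option ι) × ((∀ o, OptionFamily R E o) → ZMod 2) →
      Finset ι × ((∀ i, E i) → ZMod 2) := fun p =>
    if none ∈ p.1 then (eraseNone (insertNone S \ p.1), fun u => ψ p (optionPoint 0 u))
    else (eraseNone p.1, fun u => p.2 (optionPoint 0 u)) with hT
  refine ⟨G.image T, fun q hq => ?_, card_image_le.trans hGk, fun r hr => ?_⟩
  · obtain ⟨p, hp, rfl⟩ := mem_image.1 hq
    obtain ⟨h1, h2, h3⟩ := hG p hp
    by_cases hn : none ∈ p.1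
    · simp only [hT, hn, if_true]
      refine ⟨?_, fun i hi => ?_, (hψ p hp).optionPoint 0⟩
      · obtain ⟨o, ho, ho'⟩ := exists_of_ssubset h2
        rcases o with _ | i
        · exact absurd hn ho'
        · exact ⟨i, by simpa using ⟨by simpa using ho, ho'⟩⟩
      · have := mem_eraseNone.1 hi
        simpa using (mem_sdiff.1 this).1
    · simp only [hT, hn, if_false]
      refine ⟨?_, fun i hi => ?_, h3.optionPoint 0⟩
      · obtain ⟨o, ho⟩ := h1
        rcases o with _ | i
        · exact absurd ho hn
        · exact ⟨i, by simpa using ho⟩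
      · simpa using h2.subset (mem_eraseNone.1 hi)
  · have hr' : r = ∑ p ∈ G, fun u => p.2 (optionPoint ⟨r, hr⟩ u) * ψ p (optionPoint ⟨r, hr⟩ u) := by
      funext u
      have := congrFun hsum (optionPoint ⟨r, hr⟩ u)
      simp only [Finset.sum_apply, Pi.mul_apply] at this
      rw [Finset.sum_apply, ← this]
      rfl
    rw [hr']
    refine Submodule.sum_mem _ fun p hp => ?_
    obtain ⟨h1, h2, h3⟩ := hG p hp
    have hind : ∀ {J : Finset (Option ι)} {φ : (∀ o, OptionFamily R E o) → ZMod 2}, IsForm J φ →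
        none ∉ J → ∀ u, φ (optionPoint ⟨r, hr⟩ u) = φ (optionPoint 0 u) := fun hφ hJ u =>
      hφ.dep _ _ fun o ho => by
        rcases o with _ | i
        · exact absurd ho hJ
        · rfl
    have hmem := mem_image_of_mem T hp
    by_cases hn : none ∈ p.1
    · have hT' : T p = (eraseNone (insertNone S \ p.1), fun u => ψ p (optionPoint 0 u)) := if_pos hn
      rw [hT'] at hmem
      convert mul_mem_formSpan hmem
        (ψ := fun u => p.2 (optionPoint ⟨r, hr⟩ u)) ((h3.optionPoint _).of_eq ?_) using 1
      · funext u
        rw [Pi.mul_apply, mul_comm, hind (hψ p hp) (by simp [hn])]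
      · ext i
        have : some i ∈ p.1 → i ∈ S := fun hi => by simpa using h2.subset hi
        simp only [mem_eraseNone, mem_sdiff, some_mem_insertNone]
        tauto
    · have hT' : T p = (eraseNone p.1, fun u => p.2 (optionPoint 0 u)) := if_neg hn
      rw [hT'] at hmem
      convert mul_mem_formSpan hmem
        (ψ := fun u => ψ p (optionPoint ⟨r, hr⟩ u)) (((hψ p hp).optionPoint _).of_eq ?_)
        using 1
      · funext u
        rw [Pi.mul_apply, hind h3 hn]
      · ext i
        simp only [mem_eraseNone, mem_sdiff, some_mem_insertNone]

omit [DecidableEq ι] in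
/-- Finitely many additive functions have many common zeros. -/
theorem pow_le_prob_forall_eq_zero {V : Type*} [AddCommGroup V] [Fintype V] {κ : Type*}
    (s : Finset κ) (χ : κ → V → ZMod 2) (h : ∀ l ∈ s, ∀ v w, χ l (v + w) = χ l v + χ l w) :
    (2⁻¹ : ℝ) ^ s.card ≤ prob fun v => ∀ l ∈ s, χ l v = 0 := by
  classical
  have h1 : ∀ v, (if ∀ l ∈ s, χ l v = 0 then (1 : ℝ) else 0) =
      2⁻¹ ^ s.card * ∑ t ∈ s.powerset, sgn (∑ l ∈ t, χ l v) := by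
    intro v
    simp only [sgn_sum]
    rw [← prod_one_add, ← prod_const, ← prod_mul_distrib]
    split_ifs with hv
    · exact (prod_eq_one fun l hl => by rw [hv l hl]; norm_num).symm
    · push Not at hv
      obtain ⟨l, hl, hlv⟩ := hv
      rw [prod_eq_zero hl]
      rw [(zmod_two_cases _).resolve_left hlv]
      norm_num
  rw [prob_eq]
  simp only [h1]
  rw [← mul_expect, expect_sum_comm]
  refine le_mul_of_one_le_right (by positivity) ?_
  rw [← add_sum_erase _ _ (empty_mem_powerset s)]
  have h2 : 0 ≤ ∑ t ∈ s.powerset.erase ∅, 𝔼 v, sgn (∑ l ∈ t, χ l v) :=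
    sum_nonneg fun t ht => expect_sgn_addHom_nonneg _ fun v w => by
      rw [← sum_add_distrib]
      exact sum_congr rfl fun l hl => h l (mem_powerset.1 (mem_erase.1 ht).2 hl) v w
  simpa using h2

/-- Boundedly many forms have many common zeros. -/
theorem IsValid.pow_le_prob {S : Finset ι} {G : Finset (Finset ι × ((∀ i, E i) → ZMod 2))}
    (hG : IsValid S G) : (2⁻¹ : ℝ) ^ G.card ≤ prob fun u => ∀ p ∈ G, p.2 u = 0 := by
  classical
  induction S using Finset.induction_on generalizing G with
  | empty =>
    have : G = ∅ := eq_empty_of_forall_notMem fun p hp =>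
      (hG p hp).1.ne_empty (subset_empty.1 (hG p hp).2.1)
    subst this
    simp [prob_true]
  | insert e S he ih =>
    set G₀ := G.filter fun p => e ∉ p.1 with hG₀
    set G₁ := G.filter fun p => ¬ e ∉ p.1 with hG₁
    have h0 := ih (G := G₀) fun p hp => by
      obtain ⟨hp, hpe⟩ := mem_filter.1 hp
      exact ⟨(hG p hp).1, (subset_insert_iff_of_notMem hpe).1 (hG p hp).2.1, (hG p hp).2.2⟩
    rw [← card_filter_add_card_filter_not (s := G) fun p => e ∉ p.1, pow_add, prob_update e]
    calc (2⁻¹ : ℝ) ^ G₀.card * 2⁻¹ ^ G₁.card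
        ≤ (prob fun u => ∀ p ∈ G₀, p.2 u = 0) * 2⁻¹ ^ G₁.card := by gcongr
      _ = 𝔼 u, (if ∀ p ∈ G₀, p.2 u = 0 then (1 : ℝ) else 0) * 2⁻¹ ^ G₁.card := by
          rw [← expect_mul]
          congr 1
          exact expect_congr rfl fun a _ => by congr
      _ ≤ _ := expect_le_expect fun u _ => ?_
    split_ifs with h
    · rw [one_mul]
      refine (pow_le_prob_forall_eq_zero G₁ (fun p (v : E e) => p.2 (update u e v))
        fun p hp v w => ?_).trans (prob_mono fun v hv p hp => ?_)
      · obtain ⟨hp, hpe⟩ := mem_filter.1 hp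
        exact (hG p hp).2.2.add e (not_not.1 hpe) u v w
      · by_cases hpe : e ∈ p.1
        · exact hv p (mem_filter.2 ⟨hp, not_not.2 hpe⟩)
        · rw [(hG p hp).2.2.update_of_notMem hpe]
          exact h p (mem_filter.2 ⟨hp, hpe⟩)
    · rw [zero_mul]
      exact prob_nonneg _

end CommonZeros

/-! ### Forms whose slices lie in given spaces -/

section Slices

/-- The forms `x` on `S` whose slices in the direction `e`, at all points of a subspace `U` of
bounded codimension, are combinations of boundedly many given forms, are themselves combinations of
boundedly many forms. After composition with a projection `π` of the coordinate `e` to `U`, they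
have many common zeros, namely those points `u` at which all the given forms for `v = π (u e)`
vanish. The difference of `x` and the composition depends on the coordinate `e` only through
boundedly many linear functionals. -/
theorem exists_formSpan_of_slices (n m k : ℕ) : ∃ K : ℕ,
    ∀ {ι : Type} [DecidableEq ι] [Fintype ι] {E : ι → Type} [∀ i, AddCommGroup (E i)]
      [∀ i, Fintype (E i)] [∀ i, Module (ZMod 2) (E i)] {S : Finset ι} {e : ι}
      (U : Submodule (ZMod 2) (E e)) (𝒢 : E e → Finset (Finset ι × ((∀ i, E i) → ZMod 2))),
      S.card = n → e ∈ S → Module.finrank (ZMod 2) (E e ⧸ U) ≤ m →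
      (∀ v ∈ U, IsValid (S.erase e) (𝒢 v) ∧ (𝒢 v).card ≤ k) →
      ∃ G, IsValid S G ∧ G.card ≤ K ∧ ∀ x, IsForm S x →
        (∀ v ∈ U, (fun u => x (update u e v)) ∈ formSpan (S.erase e) (𝒢 v)) →
        x ∈ formSpan S G := by
  classical
  obtain ⟨K, hK⟩ := exists_formSpan_of_common_zeros n (ε := 2⁻¹ ^ k) (by positivity)
  refine ⟨K + m, fun {ι _ _ E _ _ _ S e} U 𝒢 hS he hU h𝒢 => ?_⟩
  obtain ⟨W, hW⟩ := U.exists_isCompl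
  have hWm : Module.finrank (ZMod 2) W ≤ m := by
    rw [← (Submodule.quotientEquivOfIsCompl U W hW).finrank_eq]
    exact hU
  set c := Module.finBasis (ZMod 2) W with hc
  set π : E e →ₗ[ZMod 2] U := U.projectionOnto W hW with hπ
  set y : Fin (Module.finrank (ZMod 2) W) → E e →ₗ[ZMod 2] ZMod 2 :=
    fun i => (c.coord i).comp (W.projectionOnto U hW.symm) with hy
  have hdec : ∀ v : E e, v = π v + ∑ i, y i v • (c i : E e) := by
    intro v
    have h1 := c.sum_repr (W.projectionOnto U hW.symm v)
    have h2 := congrArg (Subtype.val) h1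
    rw [Submodule.coe_sum] at h2
    simp only [Submodule.coe_smul] at h2
    have h3 : ∑ i, y i v • (c i : E e) = W.projectionOnto U hW.symm v := h2
    rw [h3]
    exact (Submodule.projection_add_projection_eq_self hW v).symm
  -- the compositions of the forms in question with the projection to `U`
  set R : Submodule (ZMod 2) ((∀ i, E i) → ZMod 2) :=
    { carrier := {z | ∃ x, IsForm S x ∧
        (∀ v ∈ U, (fun u => x (update u e v)) ∈ formSpan (S.erase e) (𝒢 v)) ∧
        z = fun u => x (update u e (π (u e)))}
      add_mem' := by
        rintro _ _ ⟨x, hx, hx', rfl⟩ ⟨y, hy, hy', rfl⟩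
        exact ⟨x + y, hx.add' hy, fun v hv => Submodule.add_mem _ (hx' v hv) (hy' v hv), rfl⟩
      zero_mem' := ⟨0, IsForm.zero, fun v _ => Submodule.zero_mem _, rfl⟩
      smul_mem' := by
        rintro a _ ⟨x, hx, hx', rfl⟩
        refine ⟨a • x, ?_, fun v hv => Submodule.smul_mem _ a (hx' v hv), rfl⟩
        rcases zmod_two_cases a with rfl | rfl
        · rw [zero_smul]; exact IsForm.zero
        · rwa [one_smul] } with hR
  have hRform : ∀ r ∈ R, IsForm S r := by
    rintro _ ⟨x, hx, -, rfl⟩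
    refine ⟨fun u v huv => hx.dep _ _ fun i hi => ?_, fun i hi u a b => ?_⟩
    · by_cases hie : i = e
      · subst hie; simp [huv i hi]
      · simp [hie, huv i hi]
    · by_cases hie : i = e
      · subst hie
        simp only [update_self, update_idem, map_add, Submodule.coe_add]
        exact hx.add i hi u _ _
      · simp only [update_of_ne (Ne.symm hie), update_comm hie]
        exact hx.add i hi _ a b
  have hRzero : (2⁻¹ : ℝ) ^ k ≤ prob fun u => ∀ r ∈ R, r u = 0 := by
    rw [prob_update e]
    unfold prob
    rw [expect_comm]
    refine le_expect univ_nonempty fun v _ => ?_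
    obtain ⟨h1, h2⟩ := h𝒢 (π v) (π v).2
    refine ((pow_le_pow_of_le_one (by norm_num) (by norm_num) h2).trans h1.pow_le_prob).trans ?_
    refine prob_mono fun u hu => ?_
    rintro _ ⟨x, hx, hx', rfl⟩
    have := eq_zero_of_mem_formSpan (hx' (π v) (π v).2) hu
    simpa using this
  obtain ⟨G, hG, hGK, hRG⟩ := hK R hS hRform hRzero
  refine ⟨G ∪ univ.image fun i => ({e}, fun u => y i (u e)), ?_, ?_, fun x hx hx' => ?_⟩
  · intro p hp
    rcases mem_union.1 hp with hp | hp
    · exact hG p hp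
    · obtain ⟨i, -, rfl⟩ := mem_image.1 hp
      refine ⟨singleton_nonempty e, singleton_subset_iff.2 he, fun u v huv => ?_, ?_⟩
      · simp only [huv e (mem_singleton_self e)]
      · intro i hi u a b
        obtain rfl := mem_singleton.1 hi
        simp
  · refine (card_union_le _ _).trans (add_le_add hGK (card_image_le.trans ?_))
    simpa using hWm
  · have hadd : ∀ (u : ∀ i, E i) (s : Finset (Fin (Module.finrank (ZMod 2) W))) (v : E e),
        x (update u e (v + ∑ i ∈ s, y i (u e) • (c i : E e))) =
          x (update u e v) + ∑ i ∈ s, y i (u e) * x (update u e (c i)) := by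
      intro u s v
      induction s using Finset.induction_on with
      | empty => simp
      | insert i s hi ih =>
        rw [sum_insert hi, sum_insert hi, add_left_comm, hx.add e he, ih]
        rcases zmod_two_cases (y i (u e)) with h | h
        · rw [h, zero_smul, hx.update_zero he]; simp
        · rw [h, one_smul, one_mul]; abel
    have hxsum : x = (fun u => x (update u e (π (u e)))) +
        ∑ i, (fun u => y i (u e)) * fun u => x (update u e (c i)) := by
      funext u
      rw [Pi.add_apply, Finset.sum_apply]
      simp only [Pi.mul_apply]
      rw [← hadd u univ, ← hdec, update_eq_self]
    rw [hxsum]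
    refine Submodule.add_mem _ (formSpan_mono subset_union_left (hRG ⟨x, hx, hx', rfl⟩))
      (Submodule.sum_mem _ fun i _ => mul_mem_formSpan
        (mem_union_right _ (mem_image_of_mem _ (mem_univ i))) ?_)
    rw [sdiff_singleton_eq_erase]
    exact hx.slice e _

end Slices

/-! ### Forms that belong to many spaces of bounded complexity -/

section Popular

theorem prob_and_prod {α β : Type*} [Fintype α] [Fintype β] (p : α → Prop) (q : β → Prop) :
    (prob fun z : α × β => p z.1 ∧ q z.2) = prob p * prob q := by
  classical
  rw [prob_eq, prob_eq, prob_eq, Fintype.expect_mul_expect, expect_prod_type]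
  refine expect_congr rfl fun a _ => expect_congr rfl fun b _ => ?_
  by_cases ha : p a <;> by_cases hb : q b <;> simp [ha, hb]

/-- Finitely many linear functionals cut out a subspace of bounded codimension. -/
theorem finrank_quotient_ker_le {V : Type*} [AddCommGroup V] [Module (ZMod 2) V] [Finite V]
    (X : Finset (Module.Dual (ZMod 2) V)) :
    Module.finrank (ZMod 2) (V ⧸ (⨅ χ ∈ X, LinearMap.ker χ : Submodule (ZMod 2) V)) ≤ X.card := by
  have h : (⨅ χ ∈ X, LinearMap.ker χ : Submodule (ZMod 2) V) =
      LinearMap.ker (LinearMap.pi fun χ : X => (χ : Module.Dual (ZMod 2) V)) := by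
    rw [LinearMap.ker_pi, iInf_subtype]
  rw [h, (LinearMap.quotKerEquivRange _).finrank_eq]
  refine (Submodule.finrank_le _).trans ?_
  simp

/-- The annihilator of an intersection is the sum of the annihilators. -/
theorem exists_add_of_forall_inf {V : Type*} [AddCommGroup V] [Module (ZMod 2) V] [Finite V]
    (A B : Submodule (ZMod 2) (Module.Dual (ZMod 2) V)) {v : V}
    (h : ∀ χ, χ ∈ A → χ ∈ B → χ v = 0) :
    ∃ v₁ v₂ : V, v = v₁ + v₂ ∧ (∀ χ ∈ A, χ v₁ = 0) ∧ ∀ χ ∈ B, χ v₂ = 0 := by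
  have h1 : v ∈ (A ⊓ B).dualCoannihilator :=
    (Submodule.mem_dualCoannihilator _).2 fun χ hχ => h χ hχ.1 hχ.2
  have h2 : (A ⊓ B).dualCoannihilator = A.dualCoannihilator ⊔ B.dualCoannihilator :=
    (Subspace.orderIsoFiniteDimensional (K := ZMod 2) (V := V)).symm.map_sup
      (OrderDual.toDual A) (OrderDual.toDual B)
  rw [h2] at h1
  obtain ⟨v₁, hv₁, v₂, hv₂, rfl⟩ := Submodule.mem_sup.1 h1
  exact ⟨v₁, v₂, rfl, (Submodule.mem_dualCoannihilator _).1 hv₁,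
    (Submodule.mem_dualCoannihilator _).1 hv₂⟩

variable {ι : Type} [DecidableEq ι] {E : ι → Type} [∀ i, AddCommGroup (E i)]

open Classical in
/-- The slices at `v`, in the direction `e`, of those forms of `G` that depend on another
coordinate, too. -/
noncomputable def sliceGen (e : ι) (v : E e) (G : Finset (Finset ι × ((∀ i, E i) → ZMod 2))) :
    Finset (Finset ι × ((∀ i, E i) → ZMod 2)) :=
  (G.filter fun p => p.1 ≠ {e}).image fun p => (p.1.erase e, fun u => p.2 (update u e v))

variable {S : Finset ι} {e : ι} {G G' : Finset (Finset ι × ((∀ i, E i) → ZMod 2))}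

omit [∀ i, AddCommGroup (E i)] in
theorem card_sliceGen_le (e : ι) (v : E e) (G : Finset (Finset ι × ((∀ i, E i) → ZMod 2))) :
    (sliceGen e v G).card ≤ G.card := by
  classical
  exact card_image_le.trans (card_filter_le _ _)

theorem IsValid.sliceGen (hG : IsValid S G) (v : E e) :
    IsValid (S.erase e) (sliceGen e v G) := by
  classical
  intro q hq
  obtain ⟨p, hp, rfl⟩ := mem_image.1 hq
  obtain ⟨hp, hne⟩ := mem_filter.1 hp
  obtain ⟨h1, h2, h3⟩ := hG p hp
  refine ⟨?_, erase_subset_erase _ h2, h3.slice e v⟩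
  rw [nonempty_iff_ne_empty, Ne, erase_eq_empty_iff]
  rintro (h | h)
  · exact h1.ne_empty h
  · exact hne h

theorem IsValid.union [DecidableEq (Finset ι × ((∀ i, E i) → ZMod 2))] (hG : IsValid S G)
    (hG' : IsValid S G') : IsValid S (G ∪ G') := fun p hp =>
  (mem_union.1 hp).elim (hG p) (hG' p)

/-- At a point `v` at which the linear functionals of the coordinate `e` in `G` vanish, the slice of
a combination of `G` is a combination of the slices of `G`. -/
theorem slice_mem_formSpan {x : (∀ i, E i) → ZMod 2} (hx : x ∈ formSpan S G) {v : E e}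
    (hv : ∀ p ∈ G, p.1 = {e} → ∀ u, p.2 (update u e v) = 0) :
    (fun u => x (update u e v)) ∈ formSpan (S.erase e) (sliceGen e v G) := by
  classical
  obtain ⟨ψ, hψ, rfl⟩ := hx
  have h1 : (fun u => (∑ p ∈ G, p.2 * ψ p) (update u e v)) =
      ∑ p ∈ G, (fun u => p.2 (update u e v)) * fun u => ψ p (update u e v) := by
    funext u
    simp [Finset.sum_apply]
  rw [h1]
  refine Submodule.sum_mem _ fun p hp => ?_
  by_cases hpe : p.1 = {e}
  · convert Submodule.zero_mem _
    funext u
    simp [hv p hp hpe u]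
  · refine mul_mem_formSpan (mem_image_of_mem _ (mem_filter.2 ⟨hp, hpe⟩)) ?_
    refine ((hψ p hp).slice e v).of_eq ?_
    ext i
    simp only [mem_erase, mem_sdiff]
    tauto

variable [∀ i, Module (ZMod 2) (E i)]

open Classical in
/-- The space spanned by the linear functionals of the coordinate `e` that belong to `G`. -/
noncomputable def linearPart (e : ι) (G : Finset (Finset ι × ((∀ i, E i) → ZMod 2))) :
    Submodule (ZMod 2) (Module.Dual (ZMod 2) (E e)) :=
  (Submodule.span (ZMod 2)
    (((G.filter fun p => p.1 = {e}).image Prod.snd : Finset ((∀ i, E i) → ZMod 2)) :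
      Set ((∀ i, E i) → ZMod 2))).comap
    (LinearMap.pi fun u : ∀ i, E i => Module.Dual.eval (ZMod 2) (E e) (u e))

theorem eq_zero_of_linearPart (hG : IsValid S G) {v : E e}
    (hv : ∀ χ ∈ linearPart e G, χ v = 0) {p : Finset ι × ((∀ i, E i) → ZMod 2)} (hp : p ∈ G)
    (hpe : p.1 = {e}) (u : ∀ i, E i) : p.2 (update u e v) = 0 := by
  classical
  have hf : IsForm {e} p.2 := (hG p hp).2.2.of_eq hpe
  have hadd := hf.add e (mem_singleton_self e) u
  set χ : Module.Dual (ZMod 2) (E e) :=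
    { toFun := fun w => p.2 (update u e w)
      map_add' := hadd
      map_smul' := fun a w => by
        rcases zmod_two_cases a with rfl | rfl
        · simp [hf.update_zero (mem_singleton_self e)]
        · simp } with hχ
  refine hv χ ?_
  rw [linearPart, Submodule.mem_comap]
  have hmem : p.2 ∈ (G.filter fun p => p.1 = {e}).image Prod.snd :=
    mem_image_of_mem _ (mem_filter.2 ⟨hp, hpe⟩)
  refine (congrArg (· ∈ Submodule.span (ZMod 2) _) (funext fun w => ?_)).mpr
    (Submodule.subset_span (mem_coe.2 hmem))
  exact hf.dep _ _ fun i hi => by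
    rw [mem_singleton] at hi
    subst hi
    simp

theorem card_linearPart_le [Fintype ι] [∀ i, Fintype (E i)] (e : ι)
    (G : Finset (Finset ι × ((∀ i, E i) → ZMod 2))) :
    Nat.card (linearPart e G) ≤ 2 ^ G.card := by
  classical
  rw [Module.natCard_eq_pow_finrank (K := ZMod 2), Nat.card_zmod]
  refine Nat.pow_le_pow_right two_pos ?_
  set T : Module.Dual (ZMod 2) (E e) →ₗ[ZMod 2] (∀ i, E i) → ZMod 2 :=
    LinearMap.pi fun u : ∀ i, E i => Module.Dual.eval (ZMod 2) (E e) (u e) with hT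
  have hinj : Injective T := fun χ χ' h => LinearMap.ext fun v => by
    have := congrFun h (update 0 e v)
    simpa [hT] using this
  set B := (G.filter fun p => p.1 = {e}).image Prod.snd with hB
  refine (LinearMap.finrank_le_finrank_of_injective
    (f := T.restrict (p := linearPart e G)
      (q := Submodule.span (ZMod 2) (B : Set ((∀ i, E i) → ZMod 2))) fun χ hχ => by
        rw [linearPart, Submodule.mem_comap] at hχ; convert hχ)
    (fun χ χ' h => Subtype.ext (hinj (congrArg Subtype.val h)))).trans ?_
  refine (finrank_span_finset_le_card _).trans (card_image_le.trans (card_filter_le _ _))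

/-- The forms that belong with probability at least `γ` to a random space of combinations of `k`
forms lie in one space of combinations of boundedly many forms. By `exists_formSpan_of_slices` it
suffices to treat the slices at the common zeros `v` of the popular linear functionals of a
coordinate `e`. For a random pair `(ω, ω')` all common elements of the two linear parts are likely
to be popular, so that `v` is the sum of a zero of the first linear part and one of the second. Thus
the slice at `v` belongs with positive probability to a space built from `𝒱 ω` and `𝒱 ω'`, in fewer
variables. -/
theorem exists_formSpan_of_popular (n : ℕ) : ∀ (k : ℕ) (γ : ℝ), 0 < γ → ∃ K : ℕ,
    ∀ {ι : Type} [DecidableEq ι] [Fintype ι] {E : ι → Type} [∀ i, AddCommGroup (E i)]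
      [∀ i, Fintype (E i)] [∀ i, Module (ZMod 2) (E i)] {S : Finset ι} {Ω : Type} [Fintype Ω]
      [Nonempty Ω] (𝒱 : Ω → Finset (Finset ι × ((∀ i, E i) → ZMod 2))),
      S.card = n → (∀ ω, IsValid S (𝒱 ω) ∧ (𝒱 ω).card ≤ k) →
      ∃ G, IsValid S G ∧ G.card ≤ K ∧ ∀ x, IsForm S x →
        (γ ≤ prob fun ω => x ∈ formSpan S (𝒱 ω)) → x ∈ formSpan S G := by
  classical
  induction n with
  | zero =>
    intro k γ hγ
    refine ⟨0, fun {ι _ _ E _ _ _ S Ω _ _} 𝒱 hS h𝒱 => ⟨∅, fun _ h => by simp at h, by simp,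
      fun x _ hx => ?_⟩⟩
    obtain ⟨ω, hω⟩ := exists_of_prob_pos (hγ.trans_le hx)
    have : 𝒱 ω = ∅ := eq_empty_of_forall_notMem fun p hp => by
      have := ((h𝒱 ω).1 p hp)
      rw [card_eq_zero.1 hS] at this
      exact this.1.ne_empty (subset_empty.1 this.2.1)
    rwa [this] at hω
  | succ n ih =>
    intro k γ hγ
    obtain ⟨k', hk'⟩ := ih (2 * k) (γ ^ 2 / 2) (by positivity)
    -- a linear part has at most `2 ^ k` elements, so an unpopular one is shared with probability at
    -- most `2 ^ k * γ' = γ ^ 2 / 2`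
    set γ' : ℝ := γ ^ 2 / 2 / 2 ^ k with hγ'
    have hγ'0 : 0 < γ' := by positivity
    obtain ⟨m, hm⟩ := exists_nat_ge (2 ^ k / γ')
    obtain ⟨K, hK⟩ := exists_formSpan_of_slices (n + 1) m k'
    refine ⟨K, fun {ι _ _ E _ _ _ S Ω _ _} 𝒱 hS h𝒱 => ?_⟩
    obtain ⟨e, he⟩ := card_pos.1 (hS.symm ▸ Nat.succ_pos n : 0 < S.card)
    have : Finite (Module.Dual (ZMod 2) (E e)) := Finite.of_injective _ DFunLike.coe_injective
    have : Fintype (Module.Dual (ZMod 2) (E e)) := Fintype.ofFinite _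
    have hcardW : ∀ ω, ((univ.filter fun χ => χ ∈ linearPart e (𝒱 ω)).card : ℝ) ≤ 2 ^ k := by
      intro ω
      have h1 := card_linearPart_le e (𝒱 ω)
      rw [Nat.card_eq_fintype_card, Fintype.card_subtype] at h1
      exact_mod_cast h1.trans (Nat.pow_le_pow_right two_pos (h𝒱 ω).2)
    -- the popular linear functionals
    set X : Finset (Module.Dual (ZMod 2) (E e)) :=
      univ.filter fun χ => γ' ≤ prob fun ω => χ ∈ linearPart e (𝒱 ω) with hX
    have hXcard : X.card ≤ m := by
      have h1 : (X.card : ℝ) * γ' ≤ 2 ^ k := by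
        calc (X.card : ℝ) * γ' = ∑ χ ∈ X, γ' := by simp
          _ ≤ ∑ χ ∈ X, prob fun ω => χ ∈ linearPart e (𝒱 ω) :=
              sum_le_sum fun χ hχ => (mem_filter.1 hχ).2
          _ ≤ ∑ χ, prob fun ω => χ ∈ linearPart e (𝒱 ω) :=
              sum_le_sum_of_subset_of_nonneg (subset_univ _) fun _ _ _ => prob_nonneg _
          _ = 𝔼 ω, ((univ.filter fun χ => χ ∈ linearPart e (𝒱 ω)).card : ℝ) := by
              simp only [prob_eq]
              rw [← expect_sum_comm]
              refine expect_congr rfl fun ω _ => ?_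
              simp
          _ ≤ 2 ^ k := expect_le univ_nonempty fun ω _ => hcardW ω
      have h2 : (X.card : ℝ) ≤ 2 ^ k / γ' := by rwa [le_div_iff₀ hγ'0]
      exact_mod_cast h2.trans hm
    set U : Submodule (ZMod 2) (E e) := ⨅ χ ∈ X, LinearMap.ker χ with hU
    have hUX : ∀ v ∈ U, ∀ χ ∈ X, χ v = 0 := fun v hv χ hχ => by
      simp only [hU, Submodule.mem_iInf] at hv
      exact hv χ hχ
    -- splitting a point along a pair of families
    set P : E e → Ω × Ω → E e × E e → Prop := fun v z w => v = w.1 + w.2 ∧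
      (∀ χ ∈ linearPart e (𝒱 z.1), χ w.1 = 0) ∧ ∀ χ ∈ linearPart e (𝒱 z.2), χ w.2 = 0 with hP
    set 𝒱' : E e → Ω × Ω → Finset (Finset ι × ((∀ i, E i) → ZMod 2)) := fun v z =>
      if h : ∃ w, P v z w then sliceGen e h.choose.1 (𝒱 z.1) ∪ sliceGen e h.choose.2 (𝒱 z.2)
      else ∅ with h𝒱'
    have hvalid : ∀ v z, IsValid (S.erase e) (𝒱' v z) ∧ (𝒱' v z).card ≤ 2 * k := by
      intro v z
      simp only [h𝒱']
      split_ifs with h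
      · refine ⟨((h𝒱 z.1).1.sliceGen _).union ((h𝒱 z.2).1.sliceGen _), ?_⟩
        rw [two_mul]
        exact (card_union_le _ _).trans (add_le_add ((card_sliceGen_le _ _ _).trans (h𝒱 z.1).2)
          ((card_sliceGen_le _ _ _).trans (h𝒱 z.2).2))
      · exact ⟨fun _ h => by simp at h, by simp⟩
    choose 𝒢 h𝒢 using fun v => hk' (𝒱' v) (by rw [card_erase_of_mem he, hS]; rfl) (hvalid v)
    obtain ⟨G, hG, hGK, hmem⟩ := hK U 𝒢 hS he ((finrank_quotient_ker_le X).trans hXcard)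
      fun v _ => ⟨(h𝒢 v).1, (h𝒢 v).2.1⟩
    refine ⟨G, hG, hGK, fun x hx hxγ => hmem x hx fun v hv => ?_⟩
    refine (h𝒢 v).2.2 _ (hx.slice e v) ?_
    have hbad : (prob fun z : Ω × Ω =>
        ∃ χ, χ ∈ linearPart e (𝒱 z.1) ∧ χ ∈ linearPart e (𝒱 z.2) ∧ χ ∉ X) ≤ γ ^ 2 / 2 := by
      rw [prob_prod]
      refine expect_le univ_nonempty fun ω _ => ?_
      calc _ ≤ prob fun ω' => ∃ χ ∈ (univ.filter fun χ => χ ∈ linearPart e (𝒱 ω)).filter (· ∉ X),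
              χ ∈ linearPart e (𝒱 ω') := prob_mono fun ω' ⟨χ, h1, h2, h3⟩ =>
                ⟨χ, by simp [h1, h3], h2⟩
        _ ≤ ∑ χ ∈ (univ.filter fun χ => χ ∈ linearPart e (𝒱 ω)).filter (· ∉ X), γ' := by
              refine (prob_exists_le _ _).trans (sum_le_sum fun χ hχ => ?_)
              have := (mem_filter.1 hχ).2
              simp only [hX, mem_filter, mem_univ, true_and, not_le] at this
              exact this.le
        _ ≤ 2 ^ k * γ' := by
              rw [sum_const, nsmul_eq_mul]
              gcongr
              refine le_trans ?_ (hcardW ω)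
              exact_mod_cast card_filter_le _ _
        _ = γ ^ 2 / 2 := by rw [hγ']; field_simp
    have hboth : γ ^ 2 ≤ prob fun z : Ω × Ω =>
        x ∈ formSpan S (𝒱 z.1) ∧ x ∈ formSpan S (𝒱 z.2) := by
      rw [prob_and_prod (fun ω => x ∈ formSpan S (𝒱 ω)) fun ω => x ∈ formSpan S (𝒱 ω), sq]
      exact mul_le_mul hxγ hxγ hγ.le (prob_nonneg _)
    have hor := hboth.trans ((prob_mono (q := fun z : Ω × Ω =>
      (fun u => x (update u e v)) ∈ formSpan (S.erase e) (𝒱' v z) ∨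
        ∃ χ, χ ∈ linearPart e (𝒱 z.1) ∧ χ ∈ linearPart e (𝒱 z.2) ∧ χ ∉ X) fun z hz => ?_).trans
          (prob_or_le _ _))
    · linarith
    · by_cases hz' : ∃ χ, χ ∈ linearPart e (𝒱 z.1) ∧ χ ∈ linearPart e (𝒱 z.2) ∧ χ ∉ X
      · exact Or.inr hz'
      · refine Or.inl ?_
        push Not at hz'
        obtain ⟨v₁, v₂, h1, h2, h3⟩ := exists_add_of_forall_inf _ _
          fun χ hχ hχ' => hUX v hv χ (hz' χ hχ hχ')
        have hex : ∃ w, P v z w := ⟨(v₁, v₂), h1, h2, h3⟩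
        have h𝒱z : 𝒱' v z = sliceGen e hex.choose.1 (𝒱 z.1) ∪ sliceGen e hex.choose.2 (𝒱 z.2) :=
          dif_pos hex
        obtain ⟨g1, g2, g3⟩ := hex.choose_spec
        rw [h𝒱z]
        have hsplit : (fun u => x (update u e v)) = (fun u => x (update u e hex.choose.1)) +
            fun u => x (update u e hex.choose.2) := by
          funext u
          rw [Pi.add_apply, ← hx.add e he, ← g1]
        rw [hsplit]
        exact Submodule.add_mem _
          (formSpan_mono subset_union_left (slice_mem_formSpan hz.1 fun p hp hpe u =>
            eq_zero_of_linearPart (h𝒱 z.1).1 g2 hp hpe u))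
          (formSpan_mono subset_union_right (slice_mem_formSpan hz.2 fun p hp hpe u =>
            eq_zero_of_linearPart (h𝒱 z.2).1 g3 hp hpe u))

end Popular

/-! ### Sums of four elements of a dense set -/

section Fourier

variable {V : Type} [AddCommGroup V] [Module (ZMod 2) V] [Fintype V]

instance : Finite (Module.Dual (ZMod 2) V) := Finite.of_injective _ DFunLike.coe_injective

noncomputable instance : Fintype (Module.Dual (ZMod 2) V) := Fintype.ofFinite _

/-- The Fourier coefficient of `f` at the character `v ↦ (-1)^{χ(v)}`. -/
noncomputable def fourier (f : V → ℝ) (χ : Module.Dual (ZMod 2) V) : ℝ := 𝔼 v, f v * sgn (χ v)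

/-- Orthogonality of characters. -/
theorem sum_sgn_dual (v : V) [Decidable (v = 0)] :
    ∑ χ : Module.Dual (ZMod 2) V, sgn (χ v) = if v = 0 then (Fintype.card V : ℝ) else 0 := by
  split_ifs with h
  · have h1 : Fintype.card (Module.Dual (ZMod 2) V) = Fintype.card V := by
      rw [← Nat.card_eq_fintype_card, ← Nat.card_eq_fintype_card,
        Module.natCard_eq_pow_finrank (K := ZMod 2), Module.natCard_eq_pow_finrank (K := ZMod 2)
        (V := V), Subspace.dual_finrank_eq]
    simp [h, h1]
  · have h1 := expect_sgn_addHom (fun χ : Module.Dual (ZMod 2) V => χ v) (fun _ _ => rfl) (by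
      by_contra! hc
      exact h ((Module.forall_dual_apply_eq_zero_iff (ZMod 2) v).1 hc))
    rw [Fintype.expect_eq_sum_div_card, div_eq_zero_iff] at h1
    exact h1.resolve_right (by positivity)

/-- The Fourier inversion formula. -/
theorem fourier_inversion (f : V → ℝ) (y : V) : f y = ∑ χ, fourier f χ * sgn (χ y) := by
  classical
  have h1 : ∀ v, f v * ∑ χ : Module.Dual (ZMod 2) V, sgn (χ v) * sgn (χ y) =
      if v = y then Fintype.card V * f y else 0 := by
    intro v
    simp only [← sgn_add, ← map_add]
    rw [sum_sgn_dual, add_eq_zero_two]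
    split_ifs with h
    · rw [h, mul_comm]
    · rw [mul_zero]
  unfold fourier
  simp only [expect_mul, mul_assoc]
  rw [← expect_sum_comm]
  simp only [← mul_sum, h1]
  rw [Fintype.expect_eq_sum_div_card, sum_ite_eq' univ y]
  simp only [mem_univ, if_true]
  field_simp

/-- Parseval’s identity. -/
theorem sum_fourier_sq (f : V → ℝ) : ∑ χ, fourier f χ ^ 2 = 𝔼 v, f v ^ 2 := by
  calc ∑ χ, fourier f χ ^ 2 = ∑ χ, 𝔼 v, f v * (fourier f χ * sgn (χ v)) := by
        refine sum_congr rfl fun χ _ => ?_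
        rw [sq]
        nth_rewrite 1 [fourier]
        rw [expect_mul]
        exact expect_congr rfl fun v _ => by ring
    _ = 𝔼 v, f v * f v := by
        rw [← expect_sum_comm]
        simp only [← mul_sum, ← fourier_inversion]
    _ = _ := by simp only [sq]

/-- The number of quadruples with sum `t`, weighted by four functions, in terms of Fourier
coefficients. -/
theorem expect_four (f₁ f₂ f₃ f₄ : V → ℝ) (t : V) :
    𝔼 z : V × V × V, f₁ z.1 * f₂ z.2.1 * f₃ z.2.2 * f₄ (z.1 + z.2.1 + z.2.2 + t) =
      ∑ χ, fourier f₁ χ * fourier f₂ χ * fourier f₃ χ * fourier f₄ χ * sgn (χ t) := by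
  have h1 : ∀ z : V × V × V, f₁ z.1 * f₂ z.2.1 * f₃ z.2.2 * f₄ (z.1 + z.2.1 + z.2.2 + t) =
      ∑ χ, (f₁ z.1 * sgn (χ z.1)) * ((f₂ z.2.1 * sgn (χ z.2.1)) * (f₃ z.2.2 * sgn (χ z.2.2))) *
        (fourier f₄ χ * sgn (χ t)) := by
    intro z
    rw [fourier_inversion f₄, mul_sum]
    refine sum_congr rfl fun χ _ => ?_
    simp only [map_add, sgn_add]
    ring
  simp only [h1]
  rw [expect_sum_comm]
  refine sum_congr rfl fun χ _ => ?_
  rw [← expect_mul, expect_prod_type]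
  simp only [← mul_expect]
  rw [← expect_mul, expect_prod_type]
  simp only [← mul_expect]
  rw [← expect_mul]
  simp only [fourier]
  ring

/-- If the non-trivial Fourier coefficients of the indicator function `f` are small, then the number
of quadruples with sum `t`, of which one element is weighted by `e` and the others by `f`, is close
to the expected one. -/
theorem abs_sum_fourier_sub_le {e f : V → ℝ} {κ : ℝ} (hf : ∀ χ, χ ≠ 0 → |fourier f χ| ≤ κ)
    (he2 : ∀ v, e v ^ 2 = e v) (hf2 : ∀ v, f v ^ 2 = f v) (hef : 𝔼 v, e v ≤ 𝔼 v, f v) (t : V) :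
    |∑ χ, fourier e χ * fourier f χ ^ 3 * sgn (χ t) - (𝔼 v, e v) * (𝔼 v, f v) ^ 3| ≤
      κ ^ 2 * 𝔼 v, f v := by
  classical
  have h0 : ∀ g : V → ℝ, fourier g 0 = 𝔼 v, g v := fun g => by simp [fourier]
  rw [← add_sum_erase _ _ (mem_univ (0 : Module.Dual (ZMod 2) V)), h0, h0]
  simp only [LinearMap.zero_apply, sgn_zero, mul_one, add_sub_cancel_left]
  refine (abs_sum_le_sum_abs _ _).trans ?_
  calc _ ≤ ∑ χ ∈ univ.erase (0 : Module.Dual (ZMod 2) V),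
        κ ^ 2 * ((fourier e χ ^ 2 + fourier f χ ^ 2) / 2) := by
        refine sum_le_sum fun χ hχ => ?_
        rw [abs_mul, abs_mul, abs_sgn, mul_one, abs_pow]
        have h1 := hf χ (mem_erase.1 hχ).1
        have h2 : |fourier f χ| ^ 2 ≤ κ ^ 2 := pow_le_pow_left₀ (abs_nonneg _) h1 2
        have h3 : |fourier e χ| * |fourier f χ| ≤ (fourier e χ ^ 2 + fourier f χ ^ 2) / 2 := by
          rw [← sq_abs (fourier e χ), ← sq_abs (fourier f χ)]
          linarith [two_mul_le_add_sq |fourier e χ| |fourier f χ|]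
        calc |fourier e χ| * |fourier f χ| ^ 3
            = |fourier f χ| ^ 2 * (|fourier e χ| * |fourier f χ|) := by ring
          _ ≤ _ := mul_le_mul h2 h3 (by positivity) (sq_nonneg _)
    _ ≤ ∑ χ : Module.Dual (ZMod 2) V, κ ^ 2 * ((fourier e χ ^ 2 + fourier f χ ^ 2) / 2) :=
        sum_le_sum_of_subset_of_nonneg (erase_subset _ _) fun _ _ _ => by positivity
    _ = κ ^ 2 * ((𝔼 v, e v + 𝔼 v, f v) / 2) := by
        rw [← mul_sum, ← sum_div, sum_add_distrib, sum_fourier_sq, sum_fourier_sq]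
        simp only [he2, hf2]
    _ ≤ _ := by
        gcongr
        linarith

end Fourier

section FourSums

variable {V : Type} [AddCommGroup V]

/-- The triples in `X` that are completed by another element of `X` to a quadruple with sum `t` (in
a group of exponent two). -/
def fourSums (X : Set V) (t : V) : Set (V × V × V) :=
  {z | z.1 ∈ X ∧ z.2.1 ∈ X ∧ z.2.2 ∈ X ∧ z.1 + z.2.1 + z.2.2 + t ∈ X}

variable [Module (ZMod 2) V] [Fintype V]

theorem ncard_eq_prob_mul {α : Type*} [Fintype α] [Nonempty α] (X : Set α) :
    (X.ncard : ℝ) = (prob fun a => a ∈ X) * Fintype.card α := by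
  classical
  rw [← card_eq_prob_mul, Set.ncard_eq_toFinset_card', Set.toFinset_card, Fintype.card_subtype]

/-- A dense set with small non-trivial Fourier coefficients represents every `t` as a sum of four
elements, and removing at most `1/16` of the set destroys at most half of the representations: each
of them uses only four elements. -/
theorem ncard_fourSums_of_regular {D : Set V} {β κ : ℝ} (hβ : (prob fun v => v ∈ D) = β)
    (hβ0 : 0 < β) (hκ : 36 * κ ^ 2 ≤ β ^ 3)
    (hD : ∀ χ : Module.Dual (ZMod 2) V, χ ≠ 0 → |fourier (D.indicator fun _ => 1) χ| ≤ κ)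
    {D' : Set V} (hcard : 16 * (D \ D').ncard ≤ D.ncard) (t : V) :
    0 < (fourSums D t).ncard ∧ (fourSums D t).ncard ≤ 2 * (fourSums D' t).ncard := by
  classical
  set f : V → ℝ := D.indicator fun _ => 1 with hf
  set e : V → ℝ := (D \ D').indicator fun _ => 1 with he
  have hfv : ∀ v, f v = if v ∈ D then 1 else 0 := fun v => Set.indicator_apply _ _ _
  have hev : ∀ v, e v = if v ∈ D \ D' then 1 else 0 := fun v => Set.indicator_apply _ _ _
  have hfE : 𝔼 v, f v = β := by rw [← hβ, prob_eq]; simp only [hfv]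
  have heE : 16 * 𝔼 v, e v ≤ β := by
    have h1 : 𝔼 v, e v = prob fun v => v ∈ D \ D' := by rw [prob_eq]; simp only [hev]
    have h2 : (16 : ℝ) * (D \ D').ncard ≤ D.ncard := by exact_mod_cast hcard
    rw [ncard_eq_prob_mul, ncard_eq_prob_mul, hβ, ← mul_assoc] at h2
    rw [h1]
    exact le_of_mul_le_mul_right h2 (by positivity)
  have hf2 : ∀ v, f v ^ 2 = f v := fun v => by rw [hfv]; split_ifs <;> norm_num
  have he2 : ∀ v, e v ^ 2 = e v := fun v => by rw [hev]; split_ifs <;> norm_num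
  have hf0 : ∀ v, 0 ≤ f v := fun v => by rw [hfv]; split_ifs <;> norm_num
  have he0 : ∀ v, 0 ≤ e v := fun v => by rw [hev]; split_ifs <;> norm_num
  have b1 := abs_sum_fourier_sub_le (e := f) hD hf2 hf2 le_rfl t
  have b2 := abs_sum_fourier_sub_le (e := e) hD he2 hf2 (by linarith) t
  rw [hfE] at b1 b2
  have q0 : (prob fun z => z ∈ fourSums D t) = ∑ χ, fourier f χ * fourier f χ ^ 3 * sgn (χ t) := by
    rw [prob_eq]
    trans ∑ χ, fourier f χ * fourier f χ * fourier f χ * fourier f χ * sgn (χ t)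
    · rw [← expect_four]
      refine expect_congr rfl fun z _ => ?_
      simp only [fourSums, Set.mem_ofPred_eq, hfv, ← ite_and, mul_ite, mul_one, mul_zero]
      congr 1
      simp only [eq_iff_iff]
      tauto
    · exact sum_congr rfl fun χ _ => by ring
  set Q := ∑ χ, fourier e χ * fourier f χ ^ 3 * sgn (χ t) with hQ
  have q1 : (prob fun z => z ∈ fourSums D t) ≤ (prob fun z => z ∈ fourSums D' t) + 4 * Q := by
    have e1 := expect_four e f f f t
    have e2 := expect_four f e f f t
    have e3 := expect_four f f e f t
    have e4 := expect_four f f f e t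
    have r1 : ∀ χ : Module.Dual (ZMod 2) V, fourier e χ * fourier f χ * fourier f χ * fourier f χ *
      sgn (χ t) = fourier e χ * fourier f χ ^ 3 * sgn (χ t) := fun χ => by ring
    have r2 : ∀ χ : Module.Dual (ZMod 2) V, fourier f χ * fourier e χ * fourier f χ * fourier f χ *
      sgn (χ t) = fourier e χ * fourier f χ ^ 3 * sgn (χ t) := fun χ => by ring
    have r3 : ∀ χ : Module.Dual (ZMod 2) V, fourier f χ * fourier f χ * fourier e χ * fourier f χ *
      sgn (χ t) = fourier e χ * fourier f χ ^ 3 * sgn (χ t) := fun χ => by ring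
    have r4 : ∀ χ : Module.Dual (ZMod 2) V, fourier f χ * fourier f χ * fourier f χ * fourier e χ *
      sgn (χ t) = fourier e χ * fourier f χ ^ 3 * sgn (χ t) := fun χ => by ring
    simp only [r1] at e1
    simp only [r2] at e2
    simp only [r3] at e3
    simp only [r4] at e4
    have : 4 * Q = Q + Q + Q + Q := by ring
    rw [this]
    nth_rewrite 1 [hQ, ← e1]
    nth_rewrite 1 [hQ, ← e2]
    nth_rewrite 1 [hQ, ← e3]
    rw [hQ, ← e4, ← expect_add_distrib, ← expect_add_distrib, ← expect_add_distrib, prob_eq,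
      prob_eq, ← expect_add_distrib]
    refine expect_le_expect fun z _ => ?_
    have n1 := mul_nonneg (mul_nonneg (mul_nonneg (he0 z.1) (hf0 z.2.1)) (hf0 z.2.2))
      (hf0 (z.1 + z.2.1 + z.2.2 + t))
    have n2 := mul_nonneg (mul_nonneg (mul_nonneg (hf0 z.1) (he0 z.2.1)) (hf0 z.2.2))
      (hf0 (z.1 + z.2.1 + z.2.2 + t))
    have n3 := mul_nonneg (mul_nonneg (mul_nonneg (hf0 z.1) (hf0 z.2.1)) (he0 z.2.2))
      (hf0 (z.1 + z.2.1 + z.2.2 + t))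
    have n4 := mul_nonneg (mul_nonneg (mul_nonneg (hf0 z.1) (hf0 z.2.1)) (hf0 z.2.2))
      (he0 (z.1 + z.2.1 + z.2.2 + t))
    by_cases hz : z ∈ fourSums D t
    · by_cases hz' : z ∈ fourSums D' t
      · rw [if_pos hz, if_pos hz']
        linarith
      · obtain ⟨h1, h2, h3, h4⟩ := hz
        have f1 : f z.1 = 1 := by rw [hfv, if_pos h1]
        have f2 : f z.2.1 = 1 := by rw [hfv, if_pos h2]
        have f3 : f z.2.2 = 1 := by rw [hfv, if_pos h3]
        have f4 : f (z.1 + z.2.1 + z.2.2 + t) = 1 := by rw [hfv, if_pos h4]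
        have h5 : ∃ y ∈ ({z.1, z.2.1, z.2.2, z.1 + z.2.1 + z.2.2 + t} : Set V), e y = 1 := by
          by_contra! hc
          have hin : ∀ y ∈ ({z.1, z.2.1, z.2.2, z.1 + z.2.1 + z.2.2 + t} : Set V), y ∈ D →
              y ∈ D' := fun y hy hyD => by
            by_contra hyD'
            exact hc y hy (by rw [hev, if_pos ⟨hyD, hyD'⟩])
          exact hz' ⟨hin _ (by simp) h1, hin _ (by simp) h2, hin _ (by simp) h3,
            hin _ (by simp) h4⟩
        rw [if_pos ⟨h1, h2, h3, h4⟩, if_neg hz', zero_add]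
        simp only [f1, f2, f3, f4, one_mul, mul_one] at n1 n2 n3 n4 ⊢
        obtain ⟨y, hy, hy1⟩ := h5
        simp only [Set.mem_insert_iff, Set.mem_singleton_iff] at hy
        rcases hy with rfl | rfl | rfl | rfl <;> rw [hy1] <;> linarith
    · rw [if_neg hz]
      have : (0 : ℝ) ≤ if z ∈ fourSums D' t then (1 : ℝ) else 0 := by split_ifs <;> norm_num
      linarith
  have hQle : Q ≤ β ^ 4 / 16 + κ ^ 2 * β := by
    have h1 := (abs_le.1 b2).2
    have h2 : (𝔼 v, e v) * β ^ 3 ≤ β / 16 * β ^ 3 := by gcongr; linarith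
    nlinarith
  have hP : β ^ 4 - κ ^ 2 * β ≤ prob fun z => z ∈ fourSums D t := by
    rw [q0]
    have h1 := (abs_le.1 b1).1
    nlinarith
  have hκβ : 36 * (κ ^ 2 * β) ≤ β ^ 4 := by nlinarith
  have hβ4 : 0 < β ^ 4 := by positivity
  have hpos : (0 : ℝ) < Fintype.card (V × V × V) := by positivity
  constructor
  · have : (0 : ℝ) < (fourSums D t).ncard := by
      rw [ncard_eq_prob_mul]
      exact mul_pos (by linarith) hpos
    exact_mod_cast this
  · have : ((fourSums D t).ncard : ℝ) ≤ 2 * (fourSums D' t).ncard := by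
      rw [ncard_eq_prob_mul, ncard_eq_prob_mul, ← mul_assoc]
      gcongr
      linarith
    exact_mod_cast this

/-- Density increment: a large Fourier coefficient gives a coset of a hyperplane on which the set is
denser. -/
theorem exists_translate_of_fourier {D : Set V} {κ : ℝ} {χ : Module.Dual (ZMod 2) V}
    [Fintype (LinearMap.ker χ)] (hχ : χ ≠ 0) (hD : κ < |fourier (D.indicator fun _ => 1) χ|) :
    ∃ x : V, (prob fun v => v ∈ D) + κ ≤ prob fun u : LinearMap.ker χ => x + (u : V) ∈ D := by
  classical
  set f : V → ℝ := D.indicator fun _ => 1 with hf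
  have hfv : ∀ v, f v = if v ∈ D then 1 else 0 := fun v => Set.indicator_apply _ _ _
  obtain ⟨s, hs, hsκ⟩ : ∃ s : ℝ, |s| = 1 ∧ κ < s * fourier f χ := by
    rcases abs_cases (fourier f χ) with h | h
    · exact ⟨1, by simp, by linarith [h.1]⟩
    · exact ⟨-1, by simp, by linarith [h.1]⟩
  by_contra! hc
  set β := prob fun v => v ∈ D with hβ
  have h1 : β + s * fourier f χ = 𝔼 v, (1 + s * sgn (χ v)) * f v := by
    rw [hβ, prob_eq, fourier, mul_expect, ← expect_add_distrib]
    refine expect_congr rfl fun v _ => ?_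
    rw [← hfv]
    ring
  have h2 : 𝔼 v, (1 + s * sgn (χ v)) * f v =
      𝔼 v, (1 + s * sgn (χ v)) * prob fun u : LinearMap.ker χ => v + (u : V) ∈ D := by
    have h3 : ∀ u : LinearMap.ker χ, 𝔼 v, (1 + s * sgn (χ v)) * f (v + u) =
        𝔼 v, (1 + s * sgn (χ v)) * f v := by
      intro u
      rw [← expect_translate (fun v => (1 + s * sgn (χ v)) * f v) (u : V)]
      refine expect_congr rfl fun v _ => ?_
      rw [map_add, LinearMap.mem_ker.1 u.2, add_zero]
    rw [← Fintype.expect_const (ι := LinearMap.ker χ) (𝔼 v, (1 + s * sgn (χ v)) * f v)]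
    rw [← expect_congr rfl fun u _ => h3 u, expect_comm]
    refine expect_congr rfl fun v _ => ?_
    rw [← mul_expect, prob_eq]
    simp only [hfv]
  have h4 : 𝔼 v, (1 + s * sgn (χ v)) * (prob fun u : LinearMap.ker χ => v + (u : V) ∈ D) ≤
      𝔼 v, (1 + s * sgn (χ v)) * (β + κ) := by
    refine expect_le_expect fun v _ => mul_le_mul_of_nonneg_left (hc v).le ?_
    have : |s * sgn (χ v)| = 1 := by rw [abs_mul, hs, abs_sgn, one_mul]
    linarith [(abs_le.1 this.le).1]
  have h5 : 𝔼 v, sgn (χ v) = 0 := expect_sgn_addHom χ (map_add χ) (by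
    by_contra! h
    exact hχ (LinearMap.ext h))
  rw [← expect_mul, expect_add_distrib, Fintype.expect_const, ← mul_expect, h5] at h4
  linarith

omit [Fintype V] in
/-- In a group of exponent two a translation does not change the sum of four elements. -/
theorem fourSums_image {W : Submodule (ZMod 2) V} (x : V) (X : Set W) (t : W) :
    fourSums ((fun u : W => x + (u : V)) '' X) t =
      Prod.map (fun u : W => x + (u : V)) (Prod.map (fun u : W => x + (u : V))
        fun u : W => x + (u : V)) '' fourSums X t := by
  have hsum : ∀ a b c : W, x + (a : V) + (x + b) + (x + c) + t = x + ((a + b + c + t : W) : V) := by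
    intro a b c
    push_cast
    have := add_self_two x
    calc x + (a : V) + (x + b) + (x + c) + t = (x + x) + (x + (a + b + c + t)) := by abel
      _ = _ := by rw [this, zero_add]
  have hinj : ∀ a b : W, x + (a : V) = x + b → a = b := fun a b h => Subtype.ext (add_left_cancel h)
  ext ⟨a, b, c⟩
  constructor
  · rintro ⟨⟨a, ha, rfl⟩, ⟨b, hb, rfl⟩, ⟨c, hc, rfl⟩, ⟨y, hy, hy'⟩⟩
    refine ⟨(a, b, c), ⟨ha, hb, hc, ?_⟩, rfl⟩
    simp only at hy'
    rw [hsum] at hy'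
    rwa [hinj _ _ hy'] at hy
  · rintro ⟨⟨a, b, c⟩, ⟨ha, hb, hc, hd⟩, h⟩
    rw [← h]
    refine ⟨⟨a, ha, rfl⟩, ⟨b, hb, rfl⟩, ⟨c, hc, rfl⟩, ⟨_, hd, ?_⟩⟩
    exact (hsum a b c).symm

/-- A dense set has a non-empty subset `D'` whose quadruples represent all elements of a subspace of
bounded codimension, in a way that is robust under the removal of a small part of `D'`. The subset
is the intersection with a coset on which the set has small Fourier coefficients, and which is found
by density increments. -/
theorem exists_robust_four_sums {δ : ℝ} (hδ : 0 < δ) : ∃ m : ℕ, ∀ {V : Type} [AddCommGroup V]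
    [Module (ZMod 2) V] [Fintype V] (D : Set V), (δ ≤ prob fun v => v ∈ D) →
    ∃ (U : Submodule (ZMod 2) V) (D' : Set V), Module.finrank (ZMod 2) (V ⧸ U) ≤ m ∧ D' ⊆ D ∧
      ∀ D'' ⊆ D', 16 * (D' \ D'').ncard ≤ D'.ncard → ∀ t ∈ U,
        0 < (fourSums D' t).ncard ∧ (fourSums D' t).ncard ≤ 2 * (fourSums D'' t).ncard := by
  -- the largest `κ` with `36 * κ ^ 2 ≤ δ ^ 4`, as is needed for `ncard_fourSums_of_regular`
  set κ : ℝ := δ ^ 2 / 6 with hκ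
  have hκ0 : 0 < κ := by positivity
  have hbase : ∀ {V : Type} [AddCommGroup V] [Module (ZMod 2) V] [Fintype V] (D : Set V),
      (δ ≤ prob fun v => v ∈ D) → (∀ χ : Module.Dual (ZMod 2) V, χ ≠ 0 →
        |fourier (D.indicator fun _ => 1) χ| ≤ κ) →
      ∃ (U : Submodule (ZMod 2) V) (D' : Set V),
        Module.finrank (ZMod 2) V ≤ Module.finrank (ZMod 2) U + 0 ∧ D' ⊆ D ∧
        ∀ D'' ⊆ D', 16 * (D' \ D'').ncard ≤ D'.ncard → ∀ t ∈ U,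
          0 < (fourSums D' t).ncard ∧ (fourSums D' t).ncard ≤ 2 * (fourSums D'' t).ncard := by
    intro V _ _ _ D hδD hreg
    refine ⟨⊤, D, by simp, subset_rfl, fun D'' _ hcard t _ =>
      ncard_fourSums_of_regular rfl (hδ.trans_le hδD) ?_ hreg hcard t⟩
    have h1 : δ ≤ 1 := hδD.trans (prob_le_one _)
    calc 36 * κ ^ 2 = δ ^ 4 := by rw [hκ]; ring
      _ ≤ δ ^ 3 := pow_le_pow_of_le_one hδ.le h1 (by norm_num)
      _ ≤ _ := pow_le_pow_left₀ hδ.le hδD 3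
  -- the density is at most one, so that at most `j` increments by `κ` are possible
  have key : ∀ j : ℕ, ∀ {V : Type} [AddCommGroup V] [Module (ZMod 2) V] [Fintype V] (D : Set V),
      (δ ≤ prob fun v => v ∈ D) → (1 ≤ (prob fun v => v ∈ D) + j * κ) →
      ∃ (U : Submodule (ZMod 2) V) (D' : Set V),
        Module.finrank (ZMod 2) V ≤ Module.finrank (ZMod 2) U + j ∧ D' ⊆ D ∧
        ∀ D'' ⊆ D', 16 * (D' \ D'').ncard ≤ D'.ncard → ∀ t ∈ U,
          0 < (fourSums D' t).ncard ∧ (fourSums D' t).ncard ≤ 2 * (fourSums D'' t).ncard := by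
    intro j
    induction j with
    | zero =>
      intro V _ _ _ D hδD hD
      by_cases hreg : ∀ χ : Module.Dual (ZMod 2) V, χ ≠ 0 →
          |fourier (D.indicator fun _ => 1) χ| ≤ κ
      · exact hbase D hδD hreg
      · push Not at hreg
        obtain ⟨χ, hχ, h⟩ := hreg
        have : Fintype (LinearMap.ker χ) := Fintype.ofFinite _
        obtain ⟨x, hx⟩ := exists_translate_of_fourier hχ h
        have := prob_le_one fun u : LinearMap.ker χ => x + (u : V) ∈ D
        simp only [Nat.cast_zero, zero_mul, add_zero] at hD
        linarith
    | succ j ih =>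
      intro V _ _ _ D hδD hD
      by_cases hreg : ∀ χ : Module.Dual (ZMod 2) V, χ ≠ 0 →
          |fourier (D.indicator fun _ => 1) χ| ≤ κ
      · obtain ⟨U, D', h1, h2⟩ := hbase D hδD hreg
        exact ⟨U, D', by omega, h2⟩
      · push Not at hreg
        obtain ⟨χ, hχ, h⟩ := hreg
        have : Fintype (LinearMap.ker χ) := Fintype.ofFinite _
        obtain ⟨x, hx⟩ := exists_translate_of_fourier hχ h
        set g : LinearMap.ker χ → V := fun u => x + (u : V) with hg
        have hginj : Injective g := fun a b h => Subtype.ext (add_left_cancel h)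
        obtain ⟨U, X, hU, hXD, hX⟩ := ih (g ⁻¹' D) (hδD.trans (by
            refine le_trans ?_ hx
            linarith)) (by
          push_cast at hD
          refine hD.trans ?_
          have : (prob fun v => v ∈ D) + κ ≤ prob fun u => u ∈ g ⁻¹' D := hx
          linarith)
        refine ⟨U.map (LinearMap.ker χ).subtype, g '' X, ?_, Set.image_subset_iff.2 hXD, ?_⟩
        · have h1 := LinearMap.finrank_range_add_finrank_ker χ
          have h2 : Module.finrank (ZMod 2) (LinearMap.range χ) ≤ 1 :=
            (Submodule.finrank_le _).trans (by simp)
          rw [LinearEquiv.finrank_eq (Submodule.equivMapOfInjective _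
            (LinearMap.ker χ).injective_subtype U).symm]
          omega
        · rintro D'' hD'' hcard _ ⟨t, ht, rfl⟩
          obtain ⟨Y, hYX, rfl⟩ := Set.subset_image_iff.1 hD''
          rw [← Set.image_sdiff hginj, Set.ncard_image_of_injective _ hginj,
            Set.ncard_image_of_injective _ hginj] at hcard
          have h3 : Injective (Prod.map g (Prod.map g g)) :=
            hginj.prodMap (hginj.prodMap hginj)
          have h4 := hX Y hYX hcard t ht
          simp only [Submodule.subtype_apply]
          rw [fourSums_image, fourSums_image, Set.ncard_image_of_injective _ h3,
            Set.ncard_image_of_injective _ h3]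
          exact h4
  obtain ⟨m, hm⟩ := exists_nat_ge (1 / κ)
  refine ⟨m, fun {V _ _ _} D hD => ?_⟩
  obtain ⟨U, D', hU, h⟩ := key m D hD (by
    rw [div_le_iff₀ hκ0] at hm
    linarith)
  refine ⟨U, D', ?_, h⟩
  have := Submodule.finrank_quotient_add_finrank U
  omega

end FourSums

/-! ### Forms that vanish at most points of a dense set -/

section RandomPoint

theorem prob_pi_eval {κ : Type*} [Fintype κ] [DecidableEq κ] {Ω : κ → Type*}
    [∀ i, Fintype (Ω i)] [∀ i, Nonempty (Ω i)] (i : κ) (p : Ω i → Prop) :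
    (prob fun ω : ∀ j, Ω j => p (ω i)) = prob p := by
  rw [prob_equiv (Equiv.piSplitAt i Ω) (fun ω => p (ω i)) (fun z => p z.1) fun _ => Iff.rfl]
  exact prob_fst p

theorem prob_subtype_mul_ncard {α : Type*} [Finite α] {A B : Set α} [Fintype A] (hBA : B ⊆ A) :
    (prob fun a : A => (a : α) ∈ B) * A.ncard = B.ncard := by
  rcases isEmpty_or_nonempty A with h | h
  · have hA : A = ∅ := Set.isEmpty_coe_sort.1 h
    have hB : B = ∅ := Set.subset_empty_iff.1 (hA ▸ hBA)
    simp [hA, hB]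
  · have h1 : B = Subtype.val '' {a : A | (a : α) ∈ B} := by
      ext b
      simp only [Set.mem_image, Set.mem_ofPred_eq, Subtype.exists, exists_and_left, exists_prop,
        exists_eq_right_right]
      exact ⟨fun hb => ⟨hb, hBA hb⟩, fun hb => hb.1⟩
    calc _ = (({a : A | (a : α) ∈ B} : Set A).ncard : ℝ) := by
          rw [← Nat.card_coe_set_eq A, Nat.card_eq_fintype_card]
          exact (ncard_eq_prob_mul {a : A | (a : α) ∈ B}).symm
      _ = B.ncard := by
          rw [← Set.ncard_image_of_injective _ Subtype.val_injective, ← h1]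

/-- A dense set of points supports a random point such that all forms that vanish at this point with
probability close to one are combinations of boundedly many forms. Its coordinate `e` is uniform on
a set `D'` of points with dense slices, and the other coordinates are the random point of the slice.
The slice of a form at a sum of four elements of `D'` is the sum of the slices at these elements.
The threshold loses a factor of `16` for each coordinate, because the slices at `15/16` of the
elements of `D'` are needed. -/
theorem exists_random_point (n : ℕ) : ∀ δ : ℝ, 0 < δ → ∃ k : ℕ,
    ∀ {ι : Type} [DecidableEq ι] [Fintype ι] {E : ι → Type} [∀ i, AddCommGroup (E i)]
      [∀ i, Fintype (E i)] [∀ i, Module (ZMod 2) (E i)] {S : Finset ι} (B : Set (∀ i, E i)),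
      S.card = n → (δ ≤ prob fun u => u ∈ B) →
      ∃ (Ω : Type) (_ : Fintype Ω) (_ : Nonempty Ω) (b : Ω → ∀ i, E i)
        (G : Finset (Finset ι × ((∀ i, E i) → ZMod 2))), (∀ ω, b ω ∈ B) ∧ IsValid S G ∧
        G.card ≤ k ∧ ∀ r, IsForm S r → (prob fun ω => r (b ω) ≠ 0) ≤ 16⁻¹ ^ n / 2 →
          r ∈ formSpan S G := by
  classical
  induction n with
  | zero =>
    refine fun δ hδ => ⟨0, fun {ι _ _ E _ _ _ S} B hS hB => ?_⟩
    obtain ⟨u, hu⟩ := exists_of_prob_pos (hδ.trans_le hB)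
    refine ⟨Unit, inferInstance, inferInstance, fun _ => u, ∅, fun _ => hu, fun _ h => by simp at h,
      by simp, fun r hr h => ?_⟩
    have h1 : r u = 0 := by
      by_contra hne
      rw [prob_congr (q := fun _ => True) fun _ => by simp [hne], prob_true] at h
      norm_num at h
    rw [card_eq_zero] at hS
    subst hS
    have : r = 0 := funext fun v => by rw [hr.dep v u (by simp), h1]; rfl
    rw [this]
    exact Submodule.zero_mem _
  | succ n ih =>
    intro δ hδ
    obtain ⟨k₁, hk₁⟩ := ih (δ / 2) (by positivity)
    obtain ⟨m, hm⟩ := exists_robust_four_sums (δ := δ / 2) (by positivity)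
    obtain ⟨k₂, hk₂⟩ := exists_formSpan_of_popular n (4 * k₁) (1 / 2) (by norm_num)
    obtain ⟨K, hK⟩ := exists_formSpan_of_slices (n + 1) m k₂
    refine ⟨K, fun {ι _ _ E _ _ _ S} B hS hB => ?_⟩
    obtain ⟨e, he⟩ := card_pos.1 (hS.symm ▸ Nat.succ_pos n : 0 < S.card)
    have hSe : (S.erase e).card = n := by rw [card_erase_of_mem he, hS]; rfl
    -- the points at which the slice of `B` is dense
    set D : Set (E e) := {v | δ / 2 ≤ prob fun u => update u e v ∈ B} with hD
    have hDdense : δ / 2 ≤ prob fun v => v ∈ D := by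
      have h1 : (prob fun u => u ∈ B) = 𝔼 v : E e, prob fun u => update u e v ∈ B := by
        rw [prob_update e]
        unfold prob
        exact expect_comm _ _ _
      have h2 : 𝔼 v : E e, (prob fun u => update u e v ∈ B) ≤
          𝔼 v : E e, ((if v ∈ D then (1 : ℝ) else 0) + δ / 2) := by
        refine expect_le_expect fun v _ => ?_
        split_ifs with hv
        · linarith [prob_le_one fun u => update u e v ∈ B]
        · have : ¬ δ / 2 ≤ prob fun u => update u e v ∈ B := hv
          linarith
      rw [expect_add_distrib, Fintype.expect_const, ← prob_eq] at h2
      linarith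
    have hslice : ∀ v, ∃ (Ω : Type) (_ : Fintype Ω) (_ : Nonempty Ω) (b : Ω → ∀ i, E i)
        (G : Finset (Finset ι × ((∀ i, E i) → ZMod 2))), IsValid (S.erase e) G ∧ G.card ≤ k₁ ∧
        (v ∈ D → (∀ ω, update (b ω) e v ∈ B) ∧ ∀ r, IsForm (S.erase e) r →
          (prob fun ω => r (b ω) ≠ 0) ≤ 16⁻¹ ^ n / 2 → r ∈ formSpan (S.erase e) G) := by
      intro v
      by_cases hv : v ∈ D
      · obtain ⟨Ω, h1, h2, b, G, hb, hG, hGk, hr⟩ := hk₁ {u | update u e v ∈ B} hSe hv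
        exact ⟨Ω, h1, h2, b, G, hG, hGk, fun _ => ⟨hb, hr⟩⟩
      · exact ⟨Unit, inferInstance, inferInstance, fun _ => 0, ∅, fun _ h => by simp at h, by simp,
          fun h => absurd h hv⟩
    choose Ω hF hN b 𝒢₀ hvalid hcard hDv using hslice
    obtain ⟨U, D', hU, hD'D, hsum⟩ := hm D hDdense
    have hD'ne : Nonempty D' := by
      have := (hsum D' subset_rfl (by simp) 0 U.zero_mem).1
      obtain ⟨z, hz⟩ := Set.nonempty_of_ncard_ne_zero this.ne'
      exact ⟨⟨z.1, hz.1⟩⟩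
    -- the forms that belong to the elements of a quadruple with sum `t`
    set 𝒱 : E e → E e × E e × E e → Finset (Finset ι × ((∀ i, E i) → ZMod 2)) := fun t z =>
      𝒢₀ z.1 ∪ 𝒢₀ z.2.1 ∪ (𝒢₀ z.2.2 ∪ 𝒢₀ (z.1 + z.2.1 + z.2.2 + t)) with h𝒱
    have hpop : ∀ t ∈ U, ∃ G, IsValid (S.erase e) G ∧ G.card ≤ k₂ ∧ ∀ x, IsForm (S.erase e) x →
        (1 / 2 ≤ prob fun z : fourSums D' t => x ∈ formSpan (S.erase e) (𝒱 t z)) →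
        x ∈ formSpan (S.erase e) G := by
      intro t ht
      have : Nonempty (fourSums D' t) := by
        have := (hsum D' subset_rfl (by simp) t ht).1
        exact (Set.nonempty_of_ncard_ne_zero this.ne').to_subtype
      refine hk₂ (fun z : fourSums D' t => 𝒱 t z) hSe fun z =>
        ⟨((hvalid _).union (hvalid _)).union ((hvalid _).union (hvalid _)), ?_⟩
      have h4 : 4 * k₁ = (k₁ + k₁) + (k₁ + k₁) := by ring
      rw [h4]
      refine (card_union_le _ _).trans (add_le_add ?_ ?_) <;>
        exact (card_union_le _ _).trans (add_le_add (hcard _) (hcard _))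
    choose! 𝒢 h𝒢 using hpop
    obtain ⟨G, hG, hGK, hmem⟩ := hK U 𝒢 hS he hU fun t ht => ⟨(h𝒢 t ht).1, (h𝒢 t ht).2.1⟩
    -- the product of all `Ω v` serves as one space for the random points of all slices
    refine ⟨D' × ∀ v, Ω v, inferInstance, inferInstance,
      fun z => update (b z.1 (z.2 z.1)) e z.1, G, fun z => (hDv _ (hD'D z.1.2)).1 _, hG, hGK,
      fun r hr hprob => hmem r hr fun t ht => ?_⟩
    refine (h𝒢 t ht).2.2 _ (hr.slice e t) ?_
    -- the points of `D'` at which the slice of `r` mostly vanishes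
    set q : E e → ℝ := fun v => prob fun ω => r (update (b v ω) e v) ≠ 0 with hq
    set D'' : Set (E e) := {v | v ∈ D' ∧ q v ≤ 16⁻¹ ^ n / 2} with hD''
    have hD''r : ∀ v ∈ D'', (fun u => r (update u e v)) ∈ formSpan (S.erase e) (𝒢₀ v) :=
      fun v hv => (hDv v (hD'D hv.1)).2 _ (hr.slice e v) hv.2
    have hD''D' : D'' ⊆ D' := fun v hv => hv.1
    have hlarge : 16 * (D' \ D'').ncard ≤ D'.ncard := by
      have h1 : 𝔼 v : D', q v ≤ 16⁻¹ ^ (n + 1) / 2 := by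
        refine le_trans (le_of_eq ?_) hprob
        rw [prob_prod]
        exact expect_congr rfl fun v _ =>
          (prob_pi_eval (v : E e) fun ω => r (update (b v ω) e v) ≠ 0).symm
      have h2 := (mul_prob_le_expect (fun v : D' => q v) (fun _ => prob_nonneg _)
        (16⁻¹ ^ n / 2)).trans h1
      have h3 : (prob fun v : D' => (v : E e) ∈ D' \ D'') ≤ prob fun v : D' =>
          16⁻¹ ^ n / 2 ≤ q v := prob_mono fun v hv => by
        by_contra! hc
        exact hv.2 ⟨v.2, hc.le⟩
      have h4 : 16 * (prob fun v : D' => (v : E e) ∈ D' \ D'') ≤ 1 := by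
        have hp : (0 : ℝ) < 16⁻¹ ^ n / 2 := by positivity
        have : (16⁻¹ ^ n / 2) * (16 * prob fun v : D' => (v : E e) ∈ D' \ D'') ≤
            (16⁻¹ ^ n / 2 : ℝ) * 1 := by
          rw [pow_succ] at h2
          nlinarith
        exact le_of_mul_le_mul_left this hp
      have h5 := prob_subtype_mul_ncard (A := D') (B := D' \ D'') Set.sdiff_subset
      have : (16 : ℝ) * (D' \ D'').ncard ≤ D'.ncard := by
        rw [← h5, ← mul_assoc]
        exact mul_le_of_le_one_left (Nat.cast_nonneg _) h4
      exact_mod_cast this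
    obtain ⟨hpos, hle⟩ := hsum D'' hD''D' hlarge t ht
    have hsub : fourSums D'' t ⊆ fourSums D' t := fun z hz =>
      ⟨hD''D' hz.1, hD''D' hz.2.1, hD''D' hz.2.2.1, hD''D' hz.2.2.2⟩
    have hhalf : 1 / 2 ≤ prob fun z : fourSums D' t => (z : E e × E e × E e) ∈ fourSums D'' t := by
      have h1 := prob_subtype_mul_ncard hsub
      have h2 : ((fourSums D' t).ncard : ℝ) ≤ 2 * (fourSums D'' t).ncard := by exact_mod_cast hle
      have h3 : (0 : ℝ) < (fourSums D' t).ncard := by exact_mod_cast hpos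
      rw [← h1, ← mul_assoc] at h2
      have := le_of_mul_le_mul_right ((one_mul _).trans_le h2) h3
      linarith
    refine hhalf.trans (prob_mono ?_)
    rintro ⟨⟨a₁, a₂, a₃⟩, _⟩ ⟨h1, h2, h3, h4⟩
    have hsplit : (fun u => r (update u e t)) =
        ((fun u => r (update u e a₁)) + fun u => r (update u e a₂)) +
          ((fun u => r (update u e a₃)) + fun u => r (update u e (a₁ + a₂ + a₃ + t))) := by
      have : t = (a₁ + a₂) + (a₃ + (a₁ + a₂ + a₃ + t)) := by
        calc t = (a₁ + a₂ + a₃) + (a₁ + a₂ + a₃) + t := by rw [add_self_two, zero_add]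
          _ = _ := by abel
      funext u
      simp only [Pi.add_apply, ← hr.add e he]
      rw [← this]
    rw [hsplit]
    refine Submodule.add_mem _ (Submodule.add_mem _ ?_ ?_) (Submodule.add_mem _ ?_ ?_)
    · exact formSpan_mono (subset_union_left.trans subset_union_left) (hD''r _ h1)
    · exact formSpan_mono (subset_union_right.trans subset_union_left) (hD''r _ h2)
    · exact formSpan_mono (subset_union_left.trans subset_union_right) (hD''r _ h3)
    · exact formSpan_mono (subset_union_right.trans subset_union_right) (hD''r _ h4)

end RandomPoint

/-! ### Almost closed sets are dense on cosets -/

section Cosets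

variable {G : Type} [AddCommGroup G]

/-- If `C` is almost `B`-closed, it is almost invariant under at least half of the elements of
`B`. -/
theorem IsClosedFor.ncard_le [Finite G] {B C : Set G} {ε : ℝ} (hε : 0 < ε) (hC : C.Nonempty)
    (h : IsClosedFor B (1 - ε) C) :
    (B.ncard : ℝ) ≤ 2 * ({b ∈ B |
      (1 - 2 * ε) * C.ncard ≤ ({a ∈ C | a + b ∈ C} : Set G).ncard} : Set G).ncard := by
  classical
  have := Fintype.ofFinite G
  set N : G → ℕ := fun b => ({a ∈ C | a + b ∈ C} : Set G).ncard with hN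
  set B₁ : Set G := {b ∈ B | (1 - 2 * ε) * C.ncard ≤ N b} with hB₁
  have hC0 : (0 : ℝ) < C.ncard := by exact_mod_cast hC.ncard_pos
  have hsum : (({p : G × G | p.1 ∈ C ∧ p.2 ∈ B ∧ p.1 + p.2 ∈ C} : Set (G × G)).ncard : ℝ) =
      ∑ b ∈ B.toFinset, (N b : ℝ) := by
    have h1 : ({p : G × G | p.1 ∈ C ∧ p.2 ∈ B ∧ p.1 + p.2 ∈ C} : Set (G × G)).toFinset =
        (B.toFinset.sigma fun b => ({a ∈ C | a + b ∈ C} : Set G).toFinset).image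
          fun z => (z.2, z.1) := by
      ext ⟨a, b⟩
      simp only [Set.mem_toFinset, Set.mem_ofPred_eq, mem_image, mem_sigma, Prod.mk.injEq,
        Sigma.exists]
      constructor
      · rintro ⟨h1, h2, h3⟩
        exact ⟨b, a, ⟨h2, h1, h3⟩, rfl, rfl⟩
      · rintro ⟨b, a, ⟨h2, h1, h3⟩, rfl, rfl⟩
        exact ⟨h1, h2, h3⟩
    rw [Set.ncard_eq_toFinset_card', h1, card_image_of_injective, card_sigma]
    · push_cast
      exact sum_congr rfl fun b _ => congrArg _ (Set.ncard_eq_toFinset_card' _).symm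
    · rintro ⟨b, a⟩ ⟨b', a'⟩ h
      simp only [Prod.mk.injEq] at h
      obtain ⟨rfl, rfl⟩ := h
      rfl
  have hle : ∑ b ∈ B.toFinset, (N b : ℝ) ≤
      ∑ b ∈ B.toFinset, ((1 - 2 * ε) * C.ncard +
        if b ∈ B₁ then 2 * ε * C.ncard else 0) := by
    refine sum_le_sum fun b hb => ?_
    split_ifs with hb'
    · have : N b ≤ C.ncard := Set.ncard_le_ncard (fun a ha => ha.1)
      have : (N b : ℝ) ≤ C.ncard := by exact_mod_cast this
      linarith
    · by_contra! hlt
      refine hb' ⟨Set.mem_toFinset.1 hb, ?_⟩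
      linarith
  have hcount : ∑ b ∈ B.toFinset, (if b ∈ B₁ then 2 * ε * (C.ncard : ℝ) else 0) =
      B₁.ncard * (2 * ε * C.ncard) := by
    rw [← sum_filter, sum_const, nsmul_eq_mul, Set.ncard_eq_toFinset_card' B₁]
    congr 3
    ext b
    simp only [mem_filter, Set.mem_toFinset]
    exact ⟨fun h => h.2, fun h => ⟨h.1, h⟩⟩
  unfold IsClosedFor at h
  rw [hsum] at h
  rw [sum_add_distrib, hcount, sum_const, nsmul_eq_mul, ← Set.ncard_eq_toFinset_card'] at hle
  have h2 : (ε * C.ncard) * B.ncard ≤ (ε * C.ncard) * (2 * B₁.ncard) := by nlinarith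
  exact le_of_mul_le_mul_left h2 (by positivity)

/-- The autocorrelation of a function in terms of its Fourier coefficients. -/
theorem expect_mul_translate [Module (ZMod 2) G] [Fintype G] (f : G → ℝ) (b : G) :
    𝔼 x, f x * f (x + b) = ∑ χ, fourier f χ ^ 2 * sgn (χ b) := by
  have h1 : ∀ x, f x * f (x + b) = ∑ χ, (f x * sgn (χ x)) * (fourier f χ * sgn (χ b)) := by
    intro x
    rw [fourier_inversion f (x + b), mul_sum]
    refine sum_congr rfl fun χ _ => ?_
    rw [map_add, sgn_add]
    ring
  simp only [h1]
  rw [expect_sum_comm]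
  refine sum_congr rfl fun χ _ => ?_
  rw [← expect_mul]
  simp only [fourier]
  ring

/-- Let `C` be almost invariant under each value of a random element `b`. If all characters that are
mostly trivial at `b` are trivial on `K`, then `C` is dense in a coset of `K`. Indeed the characters
that are not mostly trivial at `b` carry a small part of the Fourier mass of `1_C`, so the average
over `K` of the translates of `C` still correlates with `C`. -/
theorem exists_dense_coset [Module (ZMod 2) G] [Fintype G] {C : Set G} (hC : C.Nonempty) {Ω : Type}
    [Fintype Ω] [Nonempty Ω] (b : Ω → G) {ε α : ℝ} (hα : 0 < α) (hεα : 2 * ε ≤ α)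
    (hb : ∀ ω, (1 - 2 * ε) * C.ncard ≤ ({a ∈ C | a + b ω ∈ C} : Set G).ncard)
    (K : Submodule (ZMod 2) G) [Fintype K]
    (hK : ∀ χ : Module.Dual (ZMod 2) G, (prob fun ω => χ (b ω) ≠ 0) ≤ α → ∀ x ∈ K, χ x = 0) :
    ∃ x, 1 / 2 ≤ prob fun k : K => x + (k : G) ∈ C := by
  classical
  set f : G → ℝ := C.indicator fun _ => 1 with hf
  have hfv : ∀ v, f v = if v ∈ C then 1 else 0 := fun v => Set.indicator_apply _ _ _
  have hf2 : ∀ v, f v ^ 2 = f v := fun v => by rw [hfv]; split_ifs <;> norm_num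
  set β := 𝔼 v, f v with hβ
  have hβC : (prob fun v => v ∈ C) = β := by rw [hβ, prob_eq]; simp only [hfv]
  have hβ0 : 0 ≤ β := hβC ▸ prob_nonneg _
  have hβsq : ∑ χ, fourier f χ ^ 2 = β := by rw [sum_fourier_sq]; simp only [hf2, hβ]
  have h1 : ∀ ω, (1 - 2 * ε) * β ≤ ∑ χ, fourier f χ ^ 2 * sgn (χ (b ω)) := by
    intro ω
    rw [← expect_mul_translate]
    have h2 := hb ω
    have h3 : (prob fun a => a ∈ ({a ∈ C | a + b ω ∈ C} : Set G)) =
        𝔼 x, f x * f (x + b ω) := by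
      rw [prob_eq]
      refine expect_congr rfl fun x _ => ?_
      by_cases hx : x ∈ C <;> by_cases hx' : x + b ω ∈ C <;> simp [hfv, hx, hx']
    rw [ncard_eq_prob_mul, ncard_eq_prob_mul, ← mul_assoc, hβC, h3] at h2
    exact le_of_mul_le_mul_right h2 (by positivity)
  set P : Module.Dual (ZMod 2) G → ℝ := fun χ => prob fun ω => χ (b ω) ≠ 0 with hP
  have h2 : ∑ χ, fourier f χ ^ 2 * P χ ≤ ε * β := by
    have h3 : (1 - 2 * ε) * β ≤ 𝔼 ω, ∑ χ, fourier f χ ^ 2 * sgn (χ (b ω)) :=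
      le_expect univ_nonempty fun ω _ => h1 ω
    rw [expect_sum_comm] at h3
    have h4 : ∀ χ : Module.Dual (ZMod 2) G, 𝔼 ω, fourier f χ ^ 2 * sgn (χ (b ω)) =
        fourier f χ ^ 2 - 2 * (fourier f χ ^ 2 * P χ) := by
      intro χ
      simp only [sgn_eq]
      rw [← mul_expect, expect_sub_distrib, Fintype.expect_const, ← mul_expect, ← prob_eq]
      ring
    simp only [h4] at h3
    rw [sum_sub_distrib, hβsq, ← mul_sum] at h3
    linarith
  -- the average is `1` if `χ` is mostly trivial at `b`, otherwise the left hand side is negative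
  have h3 : ∀ χ : Module.Dual (ZMod 2) G, 1 - P χ / α ≤ 𝔼 k : K, sgn (χ (k : G)) := by
    intro χ
    by_cases hχ : P χ ≤ α
    · have h4 : ∀ k : K, sgn (χ (k : G)) = 1 := fun k => by rw [hK χ hχ k k.2, sgn_zero]
      simp only [h4, Fintype.expect_const]
      have : 0 ≤ P χ / α := div_nonneg (prob_nonneg _) hα.le
      linarith
    · refine le_trans ?_ (expect_sgn_addHom_nonneg (fun k : K => χ (k : G)) fun _ _ => by simp)
      have : 1 ≤ P χ / α := by
        rw [le_div_iff₀ hα]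
        linarith
      linarith
  have h4 : β / 2 ≤ 𝔼 x, f x * prob fun k : K => x + (k : G) ∈ C := by
    calc β / 2 ≤ ∑ χ, fourier f χ ^ 2 * (1 - P χ / α) := by
          have : ∀ χ : Module.Dual (ZMod 2) G, fourier f χ ^ 2 * (1 - P χ / α) =
              fourier f χ ^ 2 - fourier f χ ^ 2 * P χ / α := fun χ => by ring
          simp only [this]
          rw [sum_sub_distrib, hβsq, ← sum_div]
          have h5 : (∑ χ, fourier f χ ^ 2 * P χ) / α ≤ β / 2 := by
            rw [div_le_iff₀ hα]
            nlinarith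
          linarith
      _ ≤ ∑ χ, fourier f χ ^ 2 * 𝔼 k : K, sgn (χ (k : G)) :=
          sum_le_sum fun χ _ => mul_le_mul_of_nonneg_left (h3 χ) (sq_nonneg _)
      _ = 𝔼 k : K, 𝔼 x, f x * f (x + k) := by
          simp only [expect_mul_translate, mul_expect]
          rw [expect_sum_comm]
      _ = _ := by
          rw [expect_comm]
          refine expect_congr rfl fun x _ => ?_
          rw [← mul_expect, prob_eq]
          simp only [hfv]
  by_contra! hc
  obtain ⟨x₀, hx₀⟩ := hC
  have h5 : (𝔼 x, f x * prob fun k : K => x + (k : G) ∈ C) < 𝔼 x, f x * (1 / 2) := by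
    rw [Fintype.expect_eq_sum_div_card, Fintype.expect_eq_sum_div_card]
    refine div_lt_div_of_pos_right (sum_lt_sum (fun x _ => ?_) ⟨x₀, mem_univ _, ?_⟩)
      (by positivity)
    · refine mul_le_mul_of_nonneg_left (hc x).le ?_
      rw [hfv]
      split_ifs <;> norm_num
    · rw [hfv, if_pos hx₀, one_mul, one_mul]
      exact hc x₀
  rw [← expect_mul] at h5
  linarith

theorem conv_eq_expect [Fintype G] (f g : G → ℝ) (x : G) :
    conv f g x = 𝔼 z, f (x - z) * g z := by
  rw [conv, finsum_eq_sum_of_fintype, Nat.card_eq_fintype_card, ← Fintype.expect_eq_sum_div_card]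
  exact Fintype.expect_equiv (Equiv.subLeft x) _ _ fun y => by simp

omit [AddCommGroup G] in
theorem charMeasure_nonneg (B : Set G) (x : G) : 0 ≤ charMeasure B x :=
  Set.indicator_nonneg (fun _ _ => by positivity) x

/-- The average is `1` unless `B` is empty, in which case it is `0`. -/
theorem expect_charMeasure_le [Fintype G] (B : Set G) : 𝔼 x, charMeasure B x ≤ 1 := by
  classical
  have h1 : ∀ x, charMeasure B x = (if x ∈ B then 1 else 0) * ((Nat.card G : ℝ) / B.ncard) := by
    intro x
    rw [charMeasure, Set.indicator_apply]
    split_ifs <;> simp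
  simp only [h1]
  rw [← expect_mul, ← prob_eq, ncard_eq_prob_mul, Nat.card_eq_fintype_card, mul_comm,
    div_mul_eq_mul_div, mul_comm]
  exact div_self_le_one _

/-- Smoothing does not increase the largest average over a coset. -/
theorem expect_conv_charMeasure_le [Module (ZMod 2) G] [Fintype G] {K : Submodule (ZMod 2) G}
    [Fintype K] (B : Set G) {f : G → ℝ} {M : ℝ} (hM : 0 ≤ M)
    (h : ∀ x, 𝔼 k : K, f (x + k) ≤ M) (x : G) :
    𝔼 k : K, conv f (charMeasure B) (x + k) ≤ M := by
  simp only [conv_eq_expect]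
  rw [expect_comm]
  calc _ ≤ 𝔼 z, M * charMeasure B z := by
        refine expect_le_expect fun z _ => ?_
        rw [← expect_mul]
        refine mul_le_mul_of_nonneg_right ?_ (charMeasure_nonneg _ _)
        simp only [add_sub_right_comm]
        exact h _
    _ ≤ M * 1 := by
        rw [← mul_expect]
        exact mul_le_mul_of_nonneg_left (expect_charMeasure_le B) hM
    _ = M := mul_one M

theorem smoothed_nonneg [Fintype G] (A B : Set G) (l : ℕ) (x : G) : 0 ≤ smoothed A B l x := by
  unfold smoothed
  induction l generalizing x with
  | zero => exact Set.indicator_nonneg (fun _ _ => zero_le_one) x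
  | succ l ih =>
    rw [iterate_succ_apply', conv_eq_expect]
    exact expect_nonneg fun z _ => mul_nonneg (ih _) (charMeasure_nonneg _ _)

/-- If a smoothed version of `1_A` has average at least `c` over some coset of `K`, then `A` has
density at least `c` on some coset of `K`. -/
theorem exists_le_prob_of_smoothed [Module (ZMod 2) G] [Fintype G] {K : Submodule (ZMod 2) G}
    [Fintype K] {A B : Set G} {l : ℕ} {x : G} {c : ℝ} (h : c ≤ 𝔼 k : K, smoothed A B l (x + k)) :
    ∃ y, c ≤ prob fun k : K => y + (k : G) ∈ A := by
  classical
  obtain ⟨y, -, hy⟩ := exists_max_image (univ : Finset G)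
    (fun y => prob fun k : K => y + (k : G) ∈ A) univ_nonempty
  refine ⟨y, h.trans ?_⟩
  have key : ∀ l x, 𝔼 k : K, smoothed A B l (x + k) ≤ prob fun k : K => y + (k : G) ∈ A := by
    intro l
    unfold smoothed
    induction l with
    | zero =>
      intro x
      refine le_trans (le_of_eq ?_) (hy x (mem_univ x))
      rw [prob_eq]
      exact expect_congr rfl fun k _ => Set.indicator_apply _ _ _
    | succ l ih =>
      intro x
      simp only [iterate_succ_apply']
      exact expect_conv_charMeasure_le B (prob_nonneg _) ih x
  exact key l x

end Cosets

/-! ### Forms and tensor products -/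

section TensorForms

variable {d : ℕ} {n : Fin d → ℕ}

theorem isForm_comp_tprod (χ : Module.Dual (ZMod 2) (TensorSpace n)) :
    IsForm univ fun u : ∀ i, Fin (n i) → ZMod 2 => χ (PiTensorProduct.tprod (ZMod 2) u) :=
  ⟨fun u v h => by rw [funext fun i => h i (mem_univ i)], fun i _ u x y => by
    rw [MultilinearMap.map_update_add, map_add]⟩

/-- A form on `I` comes from a linear functional on `𝔽₂^I`. The index set is given by a predicate,
because the complement of `I` appears both as a set and as `i ∉ I`. -/
theorem IsForm.exists_lift {I : Finset (Fin d)} {φ : (∀ i, Fin (n i) → ZMod 2) → ZMod 2}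
    (hφ : IsForm I φ) (q : Fin d → Prop) (hq : ∀ i, q i ↔ i ∈ I) :
    ∃ Φ : Module.Dual (ZMod 2) (PartialTensorSpace n q), ∀ u : ∀ i, Fin (n i) → ZMod 2,
      Φ (PiTensorProduct.tprod (ZMod 2) fun i : {i // q i} => u i) = φ u := by
  classical
  set ext : (∀ i : {i // q i}, Fin (n i) → ZMod 2) → ∀ i, Fin (n i) → ZMod 2 :=
    fun v i => if h : q i then v ⟨i, h⟩ else 0 with hext
  have hup : ∀ [DecidableEq {i // q i}] (v : ∀ i : {i // q i}, Fin (n i) → ZMod 2)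
      (i : {i // q i}) x,
      ext (update v i x) = update (ext v) i x := by
    intro _ v i x
    funext j
    by_cases hj : j = i
    · subst hj
      simp [hext, i.2]
    · rw [update_of_ne hj]
      simp only [hext]
      split_ifs with h
      · rw [update_of_ne fun h' => hj (congrArg Subtype.val h')]
      · rfl
  have hmem : ∀ i : {i // q i}, (i : Fin d) ∈ I := fun i => (hq i).1 i.2
  let M : MultilinearMap (ZMod 2) (fun i : {i // q i} => Fin (n i) → ZMod 2) (ZMod 2) :=
    { toFun := fun v => φ (ext v)
      map_update_add' := fun v i x y => by
        simp only [hup]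
        exact hφ.add _ (hmem i) _ x y
      map_update_smul' := fun v i c x => by
        simp only [hup]
        rcases zmod_two_cases c with rfl | rfl
        · rw [zero_smul, zero_smul, hφ.update_zero (hmem i)]
        · rw [one_smul, one_smul] }
  refine ⟨PiTensorProduct.lift M, fun u => ?_⟩
  rw [PiTensorProduct.lift.tprod]
  exact hφ.dep _ _ fun i hi => by simp [hext, (hq i).2 hi]

/-- The characters that are, as forms, combinations of forms in `G` are trivial on an intersection
of cylinders over subspaces `H I` of codimension at most `|G|`, namely the common kernels of the
forms in `G`. -/
theorem exists_cylinders {G : Finset (Finset (Fin d) × ((∀ i, Fin (n i) → ZMod 2) → ZMod 2))}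
    (hG : IsValid univ G) :
    ∃ H : ∀ I : Finset (Fin d), Submodule (ZMod 2) (PartialTensorSpace n (fun i => i ∈ I)),
      (∀ I, Module.finrank (ZMod 2) (PartialTensorSpace n (fun i => i ∈ I) ⧸ H I) ≤ G.card) ∧
      ∀ χ : Module.Dual (ZMod 2) (TensorSpace n),
        (fun u => χ (PiTensorProduct.tprod (ZMod 2) u)) ∈ formSpan univ G →
        ∀ x ∈ (⨅ (I : Finset (Fin d)) (_ : I.Nonempty), cylinder n I (H I) :
          Submodule (ZMod 2) (TensorSpace n)), χ x = 0 := by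
  classical
  set Φ : ∀ I : Finset (Fin d), Finset (Fin d) × ((∀ i, Fin (n i) → ZMod 2) → ZMod 2) →
      Module.Dual (ZMod 2) (PartialTensorSpace n (fun i => i ∈ I)) := fun I p =>
    if h : ∃ Φ : Module.Dual (ZMod 2) (PartialTensorSpace n (fun i => i ∈ I)),
      ∀ u : ∀ i, Fin (n i) → ZMod 2,
        Φ (PiTensorProduct.tprod (ZMod 2) fun i : {i // i ∈ I} => u i) = p.2 u then h.choose
    else 0 with hΦ
  have hΦp : ∀ p ∈ G, ∀ u : ∀ i, Fin (n i) → ZMod 2,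
      Φ p.1 p (PiTensorProduct.tprod (ZMod 2) fun i : {i // i ∈ p.1} => u i) = p.2 u := by
    intro p hp
    have h := (hG p hp).2.2.exists_lift (fun i => i ∈ p.1) fun _ => Iff.rfl
    simp only [hΦ]
    rw [dif_pos h]
    exact h.choose_spec
  set H : ∀ I : Finset (Fin d), Submodule (ZMod 2) (PartialTensorSpace n (fun i => i ∈ I)) :=
    fun I => ⨅ χ ∈ (G.filter fun p => p.1 = I).image (Φ I), LinearMap.ker χ with hH
  refine ⟨H, fun I => ?_, ?_⟩
  · have : Finite (PartialTensorSpace n (fun i => i ∈ I)) := Module.finite_of_finite (ZMod 2)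
    exact (finrank_quotient_ker_le _).trans (card_image_le.trans (card_filter_le _ _))
  · rintro χ ⟨ψ, hψ, hχ⟩ x hx
    have hΛ : ∀ p ∈ G, ∃ Λ : Module.Dual (ZMod 2) (TensorSpace n),
        (∀ u, Λ (PiTensorProduct.tprod (ZMod 2) u) = p.2 u * ψ p u) ∧
          ∀ x ∈ cylinder n p.1 (H p.1), Λ x = 0 := by
      intro p hp
      obtain ⟨Ψ, hΨ⟩ := (hψ p hp).exists_lift (fun i => i ∉ p.1) fun i => by simp
      refine ⟨LinearMap.mul' (ZMod 2) (ZMod 2) ∘ₗ TensorProduct.map (Φ p.1 p) Ψ ∘ₗ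
        (mergeEquiv n p.1).symm.toLinearMap, fun u => ?_, ?_⟩
      · simp only [LinearMap.comp_apply, LinearEquiv.coe_coe]
        rw [← mergeEquiv_tprod n p.1 u, LinearEquiv.symm_apply_apply, TensorProduct.map_tmul,
          LinearMap.mul'_apply, hΦp p hp, hΨ]
      · rintro _ ⟨_, ⟨z, rfl⟩, rfl⟩
        have h0 : Φ p.1 p ∘ₗ (H p.1).subtype = 0 := by
          ext1 h
          have := h.2
          simp only [hH, Submodule.mem_iInf] at this
          exact this _ (mem_image_of_mem _ (mem_filter.2 ⟨hp, rfl⟩))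
        simp only [LinearMap.comp_apply, LinearEquiv.coe_coe, LinearEquiv.symm_apply_apply]
        have h1 : TensorProduct.map (Φ p.1 p) Ψ ((H p.1).subtype.rTensor _ z) =
            TensorProduct.map (Φ p.1 p ∘ₗ (H p.1).subtype) Ψ z := by
          rw [LinearMap.rTensor, TensorProduct.map_map, LinearMap.comp_id]
        rw [h1, h0, TensorProduct.map_zero_left, LinearMap.zero_apply, map_zero]
    choose! Λ hΛ using hΛ
    have hsum : χ = ∑ p ∈ G, Λ p := by
      refine PiTensorProduct.ext (MultilinearMap.ext fun u => ?_)
      have h1 := congrFun hχ u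
      simp only [Finset.sum_apply, Pi.mul_apply] at h1
      simp only [LinearMap.compMultilinearMap_apply]
      rw [h1, LinearMap.sum_apply]
      exact sum_congr rfl fun p hp => ((hΛ p hp).1 u).symm
    rw [hsum, LinearMap.sum_apply]
    simp only [Submodule.mem_iInf] at hx
    exact sum_eq_zero fun p hp => (hΛ p hp).2 x (hx p.1 (hG p hp).1)

end TensorForms

/-! ### Rank-1 tensors -/

section RankOne

variable {d : ℕ} {n : Fin d → ℕ}

/-- The functional that extracts one coordinate of a tensor. -/
noncomputable def coordFunctional (m : ∀ i, Fin (n i)) : Module.Dual (ZMod 2) (TensorSpace n) :=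
  PiTensorProduct.lift ((MultilinearMap.mkPiAlgebra (ZMod 2) (Fin d) (ZMod 2)).compLinearMap
    fun i => LinearMap.proj (m i))

theorem coordFunctional_tprod (m : ∀ i, Fin (n i)) (u : ∀ i, Fin (n i) → ZMod 2) :
    coordFunctional m (PiTensorProduct.tprod (ZMod 2) u) = ∏ i, u i (m i) := by
  simp [coordFunctional]

/-- Over `𝔽₂`, a non-zero rank-1 tensor has only one representation. -/
theorem tprod_injOn : Set.InjOn (PiTensorProduct.tprod (ZMod 2))
    {u : ∀ i : Fin d, Fin (n i) → ZMod 2 | ∀ i, u i ≠ 0} := by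
  intro u hu u' _ h
  have h1 : ∀ m : ∀ i, Fin (n i), ∏ i, u i (m i) = ∏ i, u' i (m i) := fun m => by
    rw [← coordFunctional_tprod, ← coordFunctional_tprod, h]
  have h2 : ∀ i, ∃ m, u i m = 1 := by
    intro i
    by_contra! hc
    exact hu i (funext fun m => (zmod_two_cases _).resolve_right (hc m))
  choose m hm using h2
  funext i a
  have h3 : ∀ (w : ∀ i, Fin (n i) → ZMod 2) (a : Fin (n i)), ∏ j, w j (update m i a j) =
      w i a * ∏ j ∈ univ.erase i, w j (m j) := by
    intro w a
    rw [← mul_prod_erase _ _ (mem_univ i), update_self]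
    congr 1
    exact prod_congr rfl fun j hj => by rw [update_of_ne (mem_erase.1 hj).1]
  have h4 := h1 (update m i a)
  have h5 := h1 (update m i (m i))
  rw [h3, h3, prod_congr rfl fun j _ => hm j, prod_const_one, mul_one] at h4 h5
  rw [hm] at h5
  rcases zmod_two_cases (∏ j ∈ univ.erase i, u' j (m j)) with h6 | h6
  · rw [h6, mul_zero] at h5
    exact absurd h5 one_ne_zero
  · rw [h4, h6, mul_one]

theorem rankOne_eq_image : rankOne n =
    PiTensorProduct.tprod (ZMod 2) '' {u : ∀ i : Fin d, Fin (n i) → ZMod 2 | ∀ i, u i ≠ 0} := by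
  ext t
  exact ⟨fun ⟨u, hu, h⟩ => ⟨u, hu, h.symm⟩, fun ⟨u, hu, h⟩ => ⟨u, hu, h.symm⟩⟩

theorem ncard_rankOne : (rankOne n).ncard =
    {u : ∀ i : Fin d, Fin (n i) → ZMod 2 | ∀ i, u i ≠ 0}.ncard := by
  rw [rankOne_eq_image, tprod_injOn.ncard_image]

/-- All `u i` are non-zero if the form `∏ i, u i 0` does not vanish. -/
theorem pow_le_prob_forall_ne_zero (hn : ∀ i, 0 < n i) :
    (2⁻¹ : ℝ) ^ d ≤ prob fun u : ∀ i, Fin (n i) → ZMod 2 =>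
      u ∈ {u : ∀ i : Fin d, Fin (n i) → ZMod 2 | ∀ i, u i ≠ 0} := by
  have h := (isForm_comp_tprod (coordFunctional fun i => ⟨0, hn i⟩)).prob_ne_zero (by
    intro h
    have := congrFun h fun _ _ => 1
    rw [coordFunctional_tprod] at this
    simp at this)
  rw [card_univ, Fintype.card_fin] at h
  refine h.trans (prob_mono fun u hu i hi => hu ?_)
  rw [coordFunctional_tprod]
  exact prod_eq_zero (mem_univ i) (by rw [hi]; rfl)

/-- The two notions agree, since rank-1 tensors correspond to tuples of non-zero vectors. -/
theorem IsEtaClosed.isClosedFor {η : ℝ} (hn : ∀ i, 0 < n i) {A : Set (TensorSpace n)}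
    (hA : A.Nonempty) (h : IsEtaClosed η A) : IsClosedFor (rankOne n) η A := by
  have := finite_tensorSpace n
  set Z : Set (∀ i : Fin d, Fin (n i) → ZMod 2) := {u | ∀ i, u i ≠ 0} with hZ
  have hZ0 : (0 : ℝ) < Z.ncard := by
    rw [ncard_eq_prob_mul]
    exact mul_pos (lt_of_lt_of_le (by positivity) (pow_le_prob_forall_ne_zero hn))
      (by positivity)
  have hA0 : (0 : ℝ) < A.ncard := by exact_mod_cast hA.ncard_pos
  have himage : {p : TensorSpace n × TensorSpace n | p.1 ∈ A ∧ p.2 ∈ rankOne n ∧ p.1 + p.2 ∈ A} =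
      Prod.map id (PiTensorProduct.tprod (ZMod 2)) ''
        {p : TensorSpace n × (∀ i : Fin d, Fin (n i) → ZMod 2) |
          p.1 ∈ A ∧ (∀ i, p.2 i ≠ 0) ∧ p.1 + PiTensorProduct.tprod (ZMod 2) p.2 ∈ A} := by
    ext ⟨a, b⟩
    constructor
    · rintro ⟨h1, ⟨u, hu, rfl⟩, h3⟩
      exact ⟨(a, u), ⟨h1, hu, h3⟩, rfl⟩
    · rintro ⟨⟨a, u⟩, ⟨h1, hu, h3⟩, h⟩
      obtain ⟨rfl, rfl⟩ := Prod.mk.inj h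
      exact ⟨h1, ⟨u, hu, rfl⟩, h3⟩
  unfold IsEtaClosed at h
  rw [le_div_iff₀ (mul_pos hA0 hZ0)] at h
  unfold IsClosedFor
  rw [himage, Set.InjOn.ncard_image, ncard_rankOne, mul_assoc]
  · exact h
  · rintro ⟨a, u⟩ ⟨-, hu, -⟩ ⟨a', u'⟩ ⟨-, hu', -⟩ h
    obtain ⟨h1, h2⟩ := Prod.mk.inj h
    exact Prod.ext h1 (tprod_injOn hu hu' h2)

end RankOne

/-! ### Closed sets are dense in simple sets -/

/-- The tuples of vectors whose tensor product is in a dense set of rank-1 tensors form a dense set.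
-/
theorem le_prob_tprod_mem {d : ℕ} {n : Fin d → ℕ} (hn : ∀ i, 0 < n i) {δ : ℝ} (hδ : 0 ≤ δ)
    {B : Set (TensorSpace n)} (hB : B ⊆ rankOne n) (hδB : δ * (rankOne n).ncard ≤ B.ncard) :
    δ * 2⁻¹ ^ d ≤ prob fun u : ∀ i, Fin (n i) → ZMod 2 =>
      u ∈ PiTensorProduct.tprod (ZMod 2) ⁻¹' B := by
  have h1 : B.ncard ≤ (PiTensorProduct.tprod (ZMod 2) ⁻¹' B).ncard := by
    refine le_trans (Set.ncard_le_ncard ?_ (Set.toFinite _))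
      (Set.ncard_image_le (f := PiTensorProduct.tprod (ZMod 2)) (Set.toFinite _))
    intro b hb
    obtain ⟨u, -, rfl⟩ := hB hb
    exact ⟨u, hb, rfl⟩
  have h2 : (B.ncard : ℝ) ≤ (PiTensorProduct.tprod (ZMod 2) ⁻¹' B).ncard := by exact_mod_cast h1
  have h3 := hδB.trans h2
  rw [ncard_rankOne, ncard_eq_prob_mul, ncard_eq_prob_mul, ← mul_assoc] at h3
  refine le_trans ?_ (le_of_mul_le_mul_right h3 (by positivity))
  exact mul_le_mul_of_nonneg_left (pow_le_prob_forall_ne_zero hn) hδ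

/-- A coset of the intersection of the cylinders from `exists_cylinders`, applied to the forms from
`exists_random_point`, is the `k`-simple set in which `A` is dense. -/
theorem exists_isSimple_of_positiveAnswer {d : ℕ} (hQ : PositiveAnswer d) {η : ℝ} (hη : 0 < η) :
    ∃ (k : ℕ) (ρ : ℝ), 0 < ρ ∧ ∀ n : Fin d → ℕ, (∀ i, 0 < n i) →
      ∀ A : Set (TensorSpace n), A.Nonempty → IsEtaClosed η A →
        ∃ C : Set (TensorSpace n), IsSimple k C ∧ ρ * (C.ncard : ℝ) ≤ ((A ∩ C).ncard : ℝ) := by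
  classical
  -- the threshold of `exists_random_point`
  set α : ℝ := 16⁻¹ ^ d / 2 with hα
  have hα0 : 0 < α := by positivity
  obtain ⟨c, δ, l, hc, hδ, -, h⟩ := hQ η (α / 2) hη (by positivity)
  obtain ⟨k, hk⟩ := exists_random_point d (δ / 2 * 2⁻¹ ^ d) (by positivity)
  refine ⟨k, c / 2, by positivity, fun n hn A hA hclosed => ?_⟩
  have := finite_tensorSpace n
  have := Fintype.ofFinite (TensorSpace n)
  obtain ⟨B, C, hB, hC, hδB, hBC, hsm⟩ := h n hn A hA (hclosed.isClosedFor hn hA)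
  -- the elements of `B` under which `C` is almost invariant
  set B₁ : Set (TensorSpace n) := {b ∈ B | (1 - 2 * (α / 2)) * C.ncard ≤
    ({a ∈ C | a + b ∈ C} : Set (TensorSpace n)).ncard} with hB₁
  have hB₁card : δ / 2 * (rankOne n).ncard ≤ B₁.ncard := by
    have := hBC.ncard_le (by positivity) hC
    linarith
  obtain ⟨Ω, _, _, b, G, hb, hG, hGk, hGr⟩ := hk (S := univ) _ (by simp)
    (le_prob_tprod_mem hn (by positivity) (fun _ hx => hB hx.1) hB₁card)
  obtain ⟨H, hHk, hH⟩ := exists_cylinders hG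
  set K : Submodule (ZMod 2) (TensorSpace n) :=
    ⨅ (I : Finset (Fin d)) (_ : I.Nonempty), cylinder n I (H I) with hK
  obtain ⟨x, hx⟩ := exists_dense_coset hC (fun ω => PiTensorProduct.tprod (ZMod 2) (b ω)) hα0
    (by linarith) (fun ω => (hb ω).2) K fun χ hχ => hH χ (hGr _ (isForm_comp_tprod χ) hχ)
  have hsmooth : c / 2 ≤ 𝔼 y : K, smoothed A (rankOne n) l (x + y) := by
    calc c / 2 ≤ c * prob fun y : K => x + (y : TensorSpace n) ∈ C := by nlinarith
      _ ≤ _ := by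
          rw [prob_eq, mul_expect]
          refine expect_le_expect fun y _ => ?_
          split_ifs with hy
          · rw [mul_one]
            exact hsm hy
          · rw [mul_zero]
            exact smoothed_nonneg _ _ _ _
  obtain ⟨y, hy⟩ := exists_le_prob_of_smoothed hsmooth
  refine ⟨(fun z => y + z) '' (K : Set (TensorSpace n)), ⟨H, y, fun I _ => (hHk I).trans hGk, rfl⟩,
    ?_⟩
  set g : K → TensorSpace n := fun z => y + (z : TensorSpace n) with hg
  have hginj : Function.Injective g := fun a b h => Subtype.ext (add_left_cancel h)
  have h1 : (fun z => y + z) '' (K : Set (TensorSpace n)) = g '' Set.univ := by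
    ext t
    constructor
    · rintro ⟨z, hz, rfl⟩
      exact ⟨⟨z, hz⟩, trivial, rfl⟩
    · rintro ⟨z, -, rfl⟩
      exact ⟨z, z.2, rfl⟩
  have h2 : A ∩ g '' Set.univ = g '' {z : K | y + (z : TensorSpace n) ∈ A} := by
    ext t
    constructor
    · rintro ⟨ht, z, -, rfl⟩
      exact ⟨z, ht, rfl⟩
    · rintro ⟨z, hz, rfl⟩
      exact ⟨hz, z, trivial, rfl⟩
  rw [h1, h2, Set.ncard_image_of_injective _ hginj, Set.ncard_image_of_injective _ hginj,
    Set.ncard_univ, Nat.card_eq_fintype_card, ncard_eq_prob_mul]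
  exact mul_le_mul_of_nonneg_right hy (by positivity)

end ClosedTensor

theorem mainTheorem6 (d : ℕ) (hd : 0 < d) (hQ : ClosedTensor.PositiveAnswer d) :
    ∀ η : ℝ, 0 < η → ∃ (k : ℕ) (ρ : ℝ), 0 < ρ ∧
      ∀ n : Fin d → ℕ, (∀ i, 0 < n i) →
        ∀ A : Set (ClosedTensor.TensorSpace n), A.Nonempty → ClosedTensor.IsEtaClosed η A →
          ∃ C : Set (ClosedTensor.TensorSpace n), ClosedTensor.IsSimple k C ∧
            ρ * (C.ncard : ℝ) ≤ ((A ∩ C).ncard : ℝ) :=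
  fun _ hη => ClosedTensor.exists_isSimple_of_positiveAnswer hQ hη
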